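/- **Setting.** An instance of *motion planning along given paths* consists of a finite undirected graph $W$, a finite set $R$ of robots with pairwise distinct start vertices $s(r)$, target vertices $t(r)$, and for every robot $r$ a path $\pi(r)$ in $W$ (no repeated vertices) from $s(r)$ to $t(r)$. Every robot starts at $s(r)$. A legal move moves one robot to the next vertex of its path, provided that no other robot is located there. A *motion plan* is a finite sequence of legal moves after which every robot is at its target. The instance has *non-blocking targets* if $t(r')\notin\pi(r)$ for all $r\ne r'$. Its *vertex multiplicity* is the maximum over the vertices $v$ of the number of robots $r$ with $v\in\pi(r)$. Let $L$ be the total length of the given paths, each measured by its number of vertices. *Clearing.* A robot has a clear path if no other robot is located on the remainder of its path. As long as possible, choose a robot that is not at its target and has a clear path, and move it to its target. *Blocking cycles.* A robot $r$ is blocked by $r'\neq r$ if the remainder of the path of $r$ contains the current position of $r'$. A blocking cycle is a sequence of distinct robots $r_0,\dots,r_{h-1}$ in which each $r_i$ is blocked by $r_{i+1}$ (indices modulo $h$). The cycle path of $r_i$ is the part of its path from its current position to that of $r_{i+1}$. The robot $r_i$ is a scout if some vertex of its cycle path is on no other cycle path of the cycle. The graph $G(C)$ of a blocking cycle $C$ is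 the directed graph composed of the cycle paths of its robots, each edge being labelled by the robot whose cycle path it belongs to. *Untangling.* In a directed graph with labelled edges, a start vertex is the start vertex of the path formed by the edges with some label. Let $v_0,\dots,v_{k-1}$ be a simple directed cycle in which $v_0$ is not a start vertex and all other vertices are, and let $(u,v_0),(v_0,v_1)$ be edges with label $r$ and $(v_{k-1},v_0),(v_0,w)$ edges with a label $r'\neq r$. Untangling this cycle deletes $v_0$, replaces the first two edges by an edge $(u,v_1)$ labelled $r$, and the other two by an edge $(v_{k-1},w)$ labelled $r'$. **Theorem.** Consider instances with non-blocking targets and vertex multiplicity at most $2$. 1. For every such instance, clearing can be carried out until no further step is possible. Whenever this has been done, in whatever order: for every blocking cycle $C$ without scout, some sequence of untanglings starting from $G(C)$ ends in a graph that cannot be untangled further; and the instance has a motion plan if and only if for every blocking cycle $C$ without scout, no graph that arises from $G(C)$ by untangling until this is no longer possible contains a simple directed cycle consisting of start vertices only. In this equivalence, "no graph that arises … contains" may be replaced by "some graph that arises … does not contain", so the choices made do not matter. 2. There is an algorithm that, given the paths of such an instance, outputs a motion plan (as the sequence of robots to be moved) or reports that none exists, in time $O(L+1)$, with an absolute implied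 constant. Here an algorithm is one fixed program (assignments, sequencing, conditionals, while loops) of a random access machine whose memory consists of finitely many arrays of natural numbers. Its operations are reading or writing a cell at a computed index, constants, successor, predecessor (truncated at $0$) and comparison, each at unit cost. Vertices and robots are given as numbers. The input consists of the number of robots, the concatenation of the vertex lists of the paths, and the place at which each list begins. All other cells are initially $0$. -/

import Mathlib

/-! ## Motion planning along given paths -/

/-- An instance of multi-robot motion planning with given paths: a workspace graph on the positions
`V`, and for every robot in `R` a source, a target and a path of the workspace joining them.
Since a position holds at most one robot, different robots have different sources. -/
structure MRMPGP (V R : Type*) where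
  W : SimpleGraph V
  src : R → V
  trg : R → V
  path : ∀ r : R, W.Path (src r) (trg r)
  src_injective : Function.Injective src

namespace MRMPGP

variable {V R : Type*}

/-- The number of edges of the path of `r`. -/
def len (I : MRMPGP V R) (r : R) : ℕ := (I.path r).1.length

/-- The `i`-th vertex of the path of `r`, counted from `0`; it is the source for `i = 0` and the
target for `i = I.len r`. -/
def vert (I : MRMPGP V R) (r : R) (i : ℕ) : V := (I.path r).1.getVert i

/-- `v` lies on the path of `r`. -/
def OnPath (I : MRMPGP V R) (r : R) (v : V) : Prop := v ∈ (I.path r).1.support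

/-- No target lies on the path of another robot. -/
def NonBlockingTargets (I : MRMPGP V R) : Prop :=
  ∀ r r' : R, r ≠ r' → ¬ I.OnPath r (I.trg r')

/-- The number of paths in which `v` appears. -/
noncomputable def pathCount (I : MRMPGP V R) (v : V) : ℕ := {r : R | I.OnPath r v}.ncard

/-- The vertex multiplicity. -/
noncomputable def vertexMultiplicity [Fintype V] (I : MRMPGP V R) : ℕ :=
  Finset.univ.sup I.pathCount

/-- The total length of the given paths, where a path contributes its number of vertices. -/
def totalLength [Fintype R] (I : MRMPGP V R) : ℕ := ∑ r : R, (I.path r).1.support.length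

/-! A configuration `σ : R → ℕ` records for every robot the number of edges of its path that it has
traversed. Initially it is constantly `0`. -/

/-- The vertex at which `r` is located. -/
def pos (I : MRMPGP V R) (σ : R → ℕ) (r : R) : V := I.vert r (σ r)

/-- In `σ`, the robot `r` may move to the next vertex of its path. -/
def Legal (I : MRMPGP V R) (σ : R → ℕ) (r : R) : Prop :=
  σ r < I.len r ∧ ∀ r' : R, r' ≠ r → I.pos σ r' ≠ I.vert r (σ r + 1)

/-- Starting in `σ`, the sequence of moves is legal (an entry `r` stands for the move of `r` to the
next vertex of its path) and brings all robots to their targets. -/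
def IsPlanFrom [DecidableEq R] (I : MRMPGP V R) : (R → ℕ) → List R → Prop
  | σ, [] => ∀ r, σ r = I.len r
  | σ, r :: rs => I.Legal σ r ∧ IsPlanFrom I (Function.update σ r (σ r + 1)) rs

/-- Motion plans. -/
def IsMotionPlan [DecidableEq R] (I : MRMPGP V R) (plan : List R) : Prop :=
  I.IsPlanFrom (fun _ => 0) plan

/-- There is a motion plan. -/
def Solvable [DecidableEq R] (I : MRMPGP V R) : Prop := ∃ plan, I.IsMotionPlan plan

/-! ## Clearing and blocking cycles -/

/-- No other robot is located on the remainder of the path of `r`. -/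
def HasClearPath (I : MRMPGP V R) (σ : R → ℕ) (r : R) : Prop :=
  ∀ r' : R, r' ≠ r → ∀ i, σ r ≤ i → i ≤ I.len r → I.pos σ r' ≠ I.vert r i

/-- A robot with a clear path that has not reached its target is moved to its target. -/
def ClearStep [DecidableEq R] (I : MRMPGP V R) (σ σ' : R → ℕ) : Prop :=
  ∃ r, σ r < I.len r ∧ I.HasClearPath σ r ∧ σ' = Function.update σ r (I.len r)

/-- `σ` arises from the initial configuration by moving robots with clear paths to their targets
until this is no longer possible. -/
def ClearedTo [DecidableEq R] (I : MRMPGP V R) (σ : R → ℕ) : Prop :=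
  Relation.ReflTransGen I.ClearStep (fun _ => 0) σ ∧ ¬ ∃ σ', I.ClearStep σ σ'

/-- In `σ`, the robot `r` is blocked by the robot `r'`. -/
def BlockedBy (I : MRMPGP V R) (σ : R → ℕ) (r r' : R) : Prop :=
  r' ≠ r ∧ ∃ i, σ r ≤ i ∧ i ≤ I.len r ∧ I.pos σ r' = I.vert r i

/-- Distinct robots `r_0, …, r_k` such that each `r_i` is blocked by `r_{i+1}`, where the indices
are taken modulo `k + 1`. -/
structure BlockingCycle (I : MRMPGP V R) (σ : R → ℕ) where
  k : ℕ
  robot : Fin (k + 1) → R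
  injective : Function.Injective robot
  blocked : ∀ i, I.BlockedBy σ (robot i) (robot (i + 1))

/-- `v` lies on the cycle path of `r_i`, the part of its path from its current position to the
current position of `r_{i+1}`. -/
def BlockingCycle.OnCyclePath {I : MRMPGP V R} {σ : R → ℕ} (C : I.BlockingCycle σ)
    (i : Fin (C.k + 1)) (v : V) : Prop :=
  ∃ a b, σ (C.robot i) ≤ a ∧ a ≤ b ∧ b ≤ I.len (C.robot i) ∧
    I.vert (C.robot i) b = I.pos σ (C.robot (i + 1)) ∧ v = I.vert (C.robot i) a

/-- `(u, v)` is a directed edge of the cycle path of `r_i`. -/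
def BlockingCycle.CyclePathEdge {I : MRMPGP V R} {σ : R → ℕ} (C : I.BlockingCycle σ)
    (i : Fin (C.k + 1)) (u v : V) : Prop :=
  ∃ a b, σ (C.robot i) ≤ a ∧ a < b ∧ b ≤ I.len (C.robot i) ∧
    I.vert (C.robot i) b = I.pos σ (C.robot (i + 1)) ∧
    u = I.vert (C.robot i) a ∧ v = I.vert (C.robot i) (a + 1)

/-- Some vertex of the cycle path of `r_i` is on no other cycle path. -/
def BlockingCycle.IsScout {I : MRMPGP V R} {σ : R → ℕ} (C : I.BlockingCycle σ)
    (i : Fin (C.k + 1)) : Prop :=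
  ∃ v, C.OnCyclePath i v ∧ ∀ j, j ≠ i → ¬ C.OnCyclePath j v

end MRMPGP

/-! ## Directed graphs with labelled edges, and untangling -/

/-- A directed graph on a set of vertices in `V` whose edges are labelled by elements of `R`;
edges with different labels may be parallel. -/
structure LabeledDigraph (V R : Type*) where
  verts : Set V
  edge : R → V → V → Prop

namespace LabeledDigraph

variable {V R : Type*}

/-- `v` is the start vertex of the path formed by the edges with some label. -/
def IsStart (G : LabeledDigraph V R) (v : V) : Prop :=
  ∃ r, (∃ w, G.edge r v w) ∧ ∀ u, ¬ G.edge r u v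

/-- `c 0, …, c k` is a simple directed cycle. -/
def IsSimpleCycle (G : LabeledDigraph V R) {k : ℕ} (c : Fin (k + 1) → V) : Prop :=
  Function.Injective c ∧ ∀ i, c i ∈ G.verts ∧ ∃ r, G.edge r (c i) (c (i + 1))

/-- Some simple cycle consists of start vertices only. -/
def HasStartCycle (G : LabeledDigraph V R) : Prop :=
  ∃ (k : ℕ) (c : Fin (k + 1) → V), G.IsSimpleCycle c ∧ ∀ i, G.IsStart (c i)

/-- Removal of the vertex `v₀`, where the edges `(u, v₀)`, `(v₀, v₁)` with label `r` are replaced by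
the edge `(u, v₁)` with label `r`, and the edges `(z, v₀)`, `(v₀, w)` with label `r'` by the edge
`(z, w)` with label `r'`. -/
def bypass (G : LabeledDigraph V R) (v₀ : V) (r : R) (u v₁ : V) (r' : R) (z w : V) :
    LabeledDigraph V R where
  verts := G.verts \ {v₀}
  edge ρ a b := (G.edge ρ a b ∧ a ≠ v₀ ∧ b ≠ v₀) ∨
    (ρ = r ∧ a = u ∧ b = v₁) ∨ (ρ = r' ∧ a = z ∧ b = w)

/-- `G'` arises from `G` by untangling a simple cycle `c 0, …, c k` in which `c 0` is the only
vertex that is not a start vertex: a path with label `r` enters the cycle at `c 0`, a path with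
another label `r'` leaves it there, and both are made to bypass `c 0`. -/
def Untangle (G G' : LabeledDigraph V R) : Prop :=
  ∃ (k : ℕ) (c : Fin (k + 1) → V) (r r' : R) (u w : V),
    G.IsSimpleCycle c ∧ ¬ G.IsStart (c 0) ∧ (∀ i, i ≠ 0 → G.IsStart (c i)) ∧ r ≠ r' ∧
    G.edge r u (c 0) ∧ G.edge r (c 0) (c (0 + 1)) ∧
    G.edge r' (c (Fin.last k)) (c 0) ∧ G.edge r' (c 0) w ∧
    G' = G.bypass (c 0) r u (c (0 + 1)) r' (c (Fin.last k)) w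

/-- `G'` arises from `G` by untangling until this is no longer possible. -/
def UntanglesTo (G G' : LabeledDigraph V R) : Prop :=
  Relation.ReflTransGen Untangle G G' ∧ ¬ ∃ G'', G'.Untangle G''

end LabeledDigraph

/-- The graph composed of the cycle paths of a blocking cycle, each edge labelled by the robot whose
cycle path it belongs to. -/
def MRMPGP.BlockingCycle.graph {V R : Type*} {I : MRMPGP V R} {σ : R → ℕ}
    (C : I.BlockingCycle σ) : LabeledDigraph V R where
  verts := {v | ∃ i, C.OnCyclePath i v}
  edge r u v := ∃ i, r = C.robot i ∧ C.CyclePathEdge i u v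

/-! ## Random access machines

A memory consists of arrays of natural numbers, both the arrays and their cells being numbered by
natural numbers. A program is a finite text and so refers to finitely many arrays only. Apart from
indirect access to cells, the only operations are constants, successor, predecessor and comparison,
so that numbers grow by a bounded amount per step. -/

namespace RAM

abbrev Memory := ℕ → ℕ → ℕ

/-- `cell a e` is the content of the cell of the array `a` whose index is the value of `e`. -/
inductive Expr where
  | lit (n : ℕ)
  | cell (a : ℕ) (e : Expr)
  | succ (e : Expr)
  | pred (e : Expr)

def Expr.eval (s : Memory) : Expr → ℕ
  | lit n => n
  | cell a e => s a (e.eval s)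
  | succ e => e.eval s + 1
  | pred e => e.eval s - 1

/-- The number of elementary operations needed to evaluate an expression. -/
def Expr.cost : Expr → ℕ
  | lit _ => 1
  | cell _ e => e.cost + 1
  | succ e => e.cost + 1
  | pred e => e.cost + 1

inductive Test where
  | eq (e f : Expr)
  | lt (e f : Expr)

def Test.Holds (s : Memory) : Test → Prop
  | eq e f => e.eval s = f.eval s
  | lt e f => e.eval s < f.eval s

def Test.cost : Test → ℕ
  | eq e f => e.cost + f.cost + 1
  | lt e f => e.cost + f.cost + 1

inductive Program where
  | skip
  | assign (a : ℕ) (i e : Expr)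
  | seq (p q : Program)
  | ite (b : Test) (p q : Program)
  | loop (b : Test) (p : Program)

/-- Replace the content of the cell `i` of the array `a` by `x`. -/
def Memory.write (s : Memory) (a i x : ℕ) : Memory :=
  Function.update s a (Function.update (s a) i x)

/-- `Exec p s s' t`: started in the memory `s`, the program `p` halts after `t` steps in the
memory `s'`. -/
inductive Exec : Program → Memory → Memory → ℕ → Prop
  | skip (s : Memory) : Exec .skip s s 1
  | assign (a : ℕ) (i e : Expr) (s : Memory) :
      Exec (.assign a i e) s (s.write a (i.eval s) (e.eval s)) (i.cost + e.cost + 1)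
  | seq {p q : Program} {s s' s'' : Memory} {t t' : ℕ} :
      Exec p s s' t → Exec q s' s'' t' → Exec (.seq p q) s s'' (t + t')
  | ite_true {b : Test} {p q : Program} {s s' : Memory} {t : ℕ} :
      b.Holds s → Exec p s s' t → Exec (.ite b p q) s s' (b.cost + t)
  | ite_false {b : Test} {p q : Program} {s s' : Memory} {t : ℕ} :
      ¬ b.Holds s → Exec q s s' t → Exec (.ite b p q) s s' (b.cost + t)
  | loop_true {b : Test} {p : Program} {s s' s'' : Memory} {t t' : ℕ} :
      b.Holds s → Exec p s s' t → Exec (.loop b p) s' s'' t' →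
      Exec (.loop b p) s s'' (b.cost + t + t')
  | loop_false {b : Test} {p : Program} {s : Memory} :
      ¬ b.Holds s → Exec (.loop b p) s s b.cost

end RAM

namespace MRMPGP

variable {m n : ℕ}

/-- The vertices of the given paths, listed path after path. -/
def pathData (I : MRMPGP (Fin m) (Fin n)) : List ℕ :=
  (List.finRange n).flatMap fun r => (I.path r).1.support.map Fin.val

/-- The place in `I.pathData` at which the path of the `j`-th robot begins; for `j = n`, the length
of `I.pathData`. -/
def offset (I : MRMPGP (Fin m) (Fin n)) (j : ℕ) : ℕ :=
  ∑ r : Fin n with r.val < j, (I.path r).1.support.length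

/-- The given paths as the input of a random access machine: the cell `0` of the array `0` holds the
number of robots, the array `1` the offsets, and the array `2` the vertices of the paths. All other
cells are `0`. -/
def input (I : MRMPGP (Fin m) (Fin n)) : RAM.Memory
  | 0, 0 => n
  | 1, j => if j ≤ n then I.offset j else 0
  | 2, j => I.pathData.getD j 0
  | _, _ => 0

/-- The memory reports `plan`: the cell `0` of the array `3` holds `1`, the cell `1` of this array
the number of moves, and the array `4` begins with the robots to be moved, in order. -/
def ReportsPlan (s : RAM.Memory) (plan : List (Fin n)) : Prop :=
  s 3 0 = 1 ∧ s 3 1 = plan.length ∧ ∀ j : Fin plan.length, s 4 j = (plan.get j).val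

/-- The memory reports that there is no motion plan. -/
def ReportsNone (s : RAM.Memory) : Prop := s 3 0 = 0

end MRMPGP

/-!
Once clearing has come to an end, the robots that have not been moved are blocked by each other: each
of them, say `r`, has exactly one other robot `nx r` on its path, namely at its source, and `nx` is a
permutation since every vertex is on at most two paths (`ClearedTo.exists_jam`, `Jam.injOn`). Its
orbits are the blocking cycles, here called rings (`IsRing`). Robots outside a ring are not in its
way, so that rings can be treated separately, and robots at their targets do not matter, so that
nothing is lost by clearing or by dissolving a ring (`steps_waiting_of_solvable`).

Writing the inner vertices of the cycle paths of a ring one after the other, one gets a word in which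
every letter occurs at most twice. There are two cases.

* The word contains a letter that occurs once (the ring has a scout), or letters `v` and `w` in the
  order `v … w … v … w`. Then the ring can be rotated by one robot: robots halt at `v` and `w` in
  turn, each of which makes room for the robots behind (`IsRing.macroSteps_rotation`). After this, all
  targets can be reached.
* All letters occur twice and no two of them cross (`Balanced`). Then the two visits of a vertex must
  take place in the order opposite to that of the word, by induction from the inside to the outside.
  Hence each of the moves that are not enclosed by a pair of equal letters has to be preceded by
  another one, and the ring is a deadlock (`IsRing.no_plan_of_balanced`).

Untangling a cycle of the graph of a ring amounts to the removal of a letter between whose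
occurrences, in cyclic order, no letter is left. Letters that cross are never removed, and thus no
cycle of start vertices appears (`IsRing.not_hasStartCycle_of_crossing`). In the balanced case an
innermost pair can be removed as long as letters are left, and in the end the start vertices form a
cycle (`IsRing.hasStartCycle_of_balanced`). This proves the characterization of solvable instances,
`solvable_iff_of_clearedTo`.

The algorithm clears by scanning every path once, where a scan that meets a waiting robot is suspended
until that robot has left (`runs_clear`). Then it reads the word of each ring with a stack: new
letters are pushed, and a letter met again is popped. If the letter met again is not at the top of
the stack, two letters cross; if the stack is not empty in the end, a letter occurs once; otherwise
the ring is balanced (`ScanState`, `runs_search`). Since robots only move forward along their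
paths, the total time is linear. Running times are bounded by potentials (`runs_loop`).
-/

/-! ### Paths, moves and macro moves -/

namespace MRMPGP

variable {V R : Type*}

theorem vert_zero (I : MRMPGP V R) (r : R) : I.vert r 0 = I.src r := by simp [vert]

theorem vert_len (I : MRMPGP V R) (r : R) : I.vert r (I.len r) = I.trg r := by simp [vert, len]

theorem vert_inj (I : MRMPGP V R) {r : R} {i j : ℕ} (hi : i ≤ I.len r) (hj : j ≤ I.len r)
    (h : I.vert r i = I.vert r j) : i = j :=
  (I.path r).2.getVert_injOn hi hj h

theorem onPath_iff (I : MRMPGP V R) (r : R) (v : V) :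
    I.OnPath r v ↔ ∃ i, i ≤ I.len r ∧ I.vert r i = v := by
  rw [OnPath, SimpleGraph.Walk.mem_support_iff_exists_getVert]
  exact ⟨fun ⟨i, h, h'⟩ => ⟨i, h', h⟩, fun ⟨i, h, h'⟩ => ⟨i, h', h⟩⟩

theorem onPath_vert (I : MRMPGP V R) {r : R} {i : ℕ} (hi : i ≤ I.len r) :
    I.OnPath r (I.vert r i) := (I.onPath_iff _ _).2 ⟨i, hi, rfl⟩

theorem onPath_src (I : MRMPGP V R) (r : R) : I.OnPath r (I.src r) := by
  rw [← I.vert_zero]; exact I.onPath_vert (Nat.zero_le _)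

/-- No three different robots share a vertex of their paths. -/
def AtMostTwo (I : MRMPGP V R) : Prop :=
  ∀ v r₁ r₂ r₃, I.OnPath r₁ v → I.OnPath r₂ v → I.OnPath r₃ v → r₁ = r₂ ∨ r₁ = r₃ ∨ r₂ = r₃

theorem atMostTwo_of_vertexMultiplicity_le [Fintype V] [Finite R] {I : MRMPGP V R}
    (h : I.vertexMultiplicity ≤ 2) : I.AtMostTwo := by
  intro v r₁ r₂ r₃ h₁ h₂ h₃
  by_contra! hne
  have hv : I.pathCount v ≤ 2 :=
    (Finset.le_sup (f := I.pathCount) (Finset.mem_univ v)).trans h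
  have hsub : ({r₁, r₂, r₃} : Set R) ⊆ {r | I.OnPath r v} := by
    rintro r (rfl | rfl | rfl) <;> assumption
  have := Set.ncard_le_ncard hsub (Set.toFinite _)
  rw [Set.ncard_eq_three.2 ⟨r₁, r₂, r₃, hne.1, hne.2.1, hne.2.2, rfl⟩] at this
  rw [pathCount] at hv
  omega

/-- A vertex shared by two different paths is the target of neither. -/
theorem ne_len_of_vert_eq {I : MRMPGP V R} (hN : I.NonBlockingTargets) {r r' : R} (hne : r ≠ r')
    {i j : ℕ} (hi : i ≤ I.len r) (h : I.vert r i = I.vert r' j) : j ≠ I.len r' := by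
  rintro rfl
  rw [vert_len] at h
  exact hN r r' hne (h ▸ I.onPath_vert hi)

/-- In `σ`, the robot `r` can be moved along its path to the vertex number `j`. -/
def CanMoveTo (I : MRMPGP V R) (σ : R → ℕ) (r : R) (j : ℕ) : Prop :=
  σ r ≤ j ∧ j ≤ I.len r ∧ ∀ r' ≠ r, ∀ i, σ r < i → i ≤ j → I.pos σ r' ≠ I.vert r i

theorem CanMoveTo.legal {I : MRMPGP V R} {σ : R → ℕ} {r : R} {j : ℕ} (h : I.CanMoveTo σ r j)
    (hlt : σ r < j) : I.Legal σ r :=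
  ⟨hlt.trans_le h.2.1, fun r' hr' => h.2.2 r' hr' _ (Nat.lt_succ_self _) hlt⟩

variable [DecidableEq R]

/-- The sequence of moves is legal when started in `σ`, and leads to `σ'`. -/
def Steps (I : MRMPGP V R) : (R → ℕ) → List R → (R → ℕ) → Prop
  | σ, [], σ' => σ' = σ
  | σ, r :: rs, σ' => I.Legal σ r ∧ Steps I (Function.update σ r (σ r + 1)) rs σ'

theorem isPlanFrom_iff_steps (I : MRMPGP V R) (plan : List R) (σ : R → ℕ) :
    I.IsPlanFrom σ plan ↔ I.Steps σ plan I.len := by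
  induction plan generalizing σ with
  | nil => exact ⟨fun h => funext fun r => (h r).symm, fun h r => (congrFun h r).symm⟩
  | cons r rs ih => exact and_congr_right fun _ => ih _

theorem Steps.append {I : MRMPGP V R} {p q : List R} {σ σ' σ'' : R → ℕ}
    (h : I.Steps σ p σ') (h' : I.Steps σ' q σ'') : I.Steps σ (p ++ q) σ'' := by
  induction p generalizing σ with
  | nil => cases h; exact h'
  | cons r rs ih => exact ⟨h.1, ih h.2⟩

theorem CanMoveTo.step {I : MRMPGP V R} {σ : R → ℕ} {r : R} {j : ℕ} (h : I.CanMoveTo σ r j)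
    (hlt : σ r < j) : I.CanMoveTo (Function.update σ r (σ r + 1)) r j := by
  refine ⟨by simpa using hlt, h.2.1, fun r' hr' i hi hij => ?_⟩
  have := h.2.2 r' hr' i (by simp at hi; omega) hij
  simpa [pos, hr'] using this

theorem CanMoveTo.steps {I : MRMPGP V R} {σ : R → ℕ} {r : R} {j : ℕ} (h : I.CanMoveTo σ r j) :
    I.Steps σ (List.replicate (j - σ r) r) (Function.update σ r j) := by
  induction hd : j - σ r generalizing σ with
  | zero =>
    have : j = σ r := by have := h.1; omega
    subst this
    simp [Steps]
  | succ d ih =>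
    have hlt : σ r < j := by omega
    refine ⟨h.legal hlt, ?_⟩
    have := ih (h.step hlt) (by simp; omega)
    simpa using this

/-- A sequence of macro moves: an entry `(r, j)` stands for moving `r` to the vertex number `j` of
its path. -/
def MacroSteps (I : MRMPGP V R) : (R → ℕ) → List (R × ℕ) → (R → ℕ) → Prop
  | σ, [], σ' => σ' = σ
  | σ, a :: l, σ' => I.CanMoveTo σ a.1 a.2 ∧ MacroSteps I (Function.update σ a.1 a.2) l σ'

theorem MacroSteps.append_iff {I : MRMPGP V R} {p q : List (R × ℕ)} {σ σ'' : R → ℕ} :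
    I.MacroSteps σ (p ++ q) σ'' ↔ ∃ σ', I.MacroSteps σ p σ' ∧ I.MacroSteps σ' q σ'' := by
  induction p generalizing σ with
  | nil => simp [MacroSteps]
  | cons a l ih => simp [MacroSteps, ih, and_assoc]

theorem MacroSteps.exists_steps {I : MRMPGP V R} {l : List (R × ℕ)} {σ σ' : R → ℕ}
    (h : I.MacroSteps σ l σ') : ∃ plan, I.Steps σ plan σ' := by
  induction l generalizing σ with
  | nil => exact ⟨[], h⟩
  | cons a l ih =>
    obtain ⟨plan, hp⟩ := ih h.2
    exact ⟨_, h.1.steps.append hp⟩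

/-- Robots at their targets do not matter: a plan remains one if some robots are put at their
targets and their moves are deleted. -/
theorem exists_plan_of_finished {I : MRMPGP V R} (hN : I.NonBlockingTargets) (S : R → Prop)
    {plan : List R} {σ : R → ℕ} (h : I.Steps σ plan I.len) (hle : ∀ r, σ r ≤ I.len r)
    {τ : R → ℕ} (hS : ∀ r, S r → τ r = I.len r) (hS' : ∀ r, ¬ S r → τ r = σ r) :
    ∃ plan', I.Steps τ plan' I.len := by
  induction plan generalizing σ τ with
  | nil =>
    refine ⟨[], ?_⟩
    cases h
    funext r
    by_cases hr : S r
    · exact (hS r hr).symm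
    · exact (hS' r hr).symm
  | cons r₀ rs ih =>
    have hle' : ∀ r, Function.update σ r₀ (σ r₀ + 1) r ≤ I.len r := by
      intro r
      by_cases hr : r = r₀
      · subst hr; simpa using h.1.1
      · simpa [hr] using hle r
    by_cases hr₀ : S r₀
    · refine ih h.2 hle' hS fun r hr => ?_
      have : r ≠ r₀ := fun e => hr (e ▸ hr₀)
      simp [this, hS' r hr]
    · obtain ⟨plan', hp⟩ := ih h.2 hle' (τ := Function.update τ r₀ (τ r₀ + 1)) (fun r hr => by
        have : r ≠ r₀ := fun e => hr₀ (e ▸ hr)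
        simp [this, hS r hr]) (fun r hr => by
        by_cases e : r = r₀
        · subst e; simp [hS' _ hr]
        · simp [e, hS' r hr])
      refine ⟨r₀ :: plan', ⟨?_, fun r' hr' => ?_⟩, hp⟩
      · rw [hS' _ hr₀]; exact h.1.1
      · rw [hS' _ hr₀]
        by_cases hs : S r'
        · rw [pos, hS r' hs, vert_len]
          intro e
          exact hN r₀ r' hr'.symm (e ▸ I.onPath_vert h.1.1)
        · rw [pos, hS' r' hs]
          exact h.1.2 r' hr'

end MRMPGP

/-! ### Rings of blocked robots and the schedule that dissolves them -/

namespace MRMPGP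

variable {V R : Type*}

/-- The lexicographic order of positions; a position `(i, a)` is the vertex number `a` on the path
of the `i`-th robot of a ring. -/
def Before (p q : ℕ × ℕ) : Prop := p.1 < q.1 ∨ p.1 = q.1 ∧ p.2 < q.2

/-- Robots `ρ 0, …, ρ (h - 1)`, continued periodically, such that the path of every one leads from
its source through the source of the next, which is its vertex number `f`. -/
structure IsRing (I : MRMPGP V R) (h : ℕ) (ρ : ℕ → R) (f : R → ℕ) : Prop where
  pos : 0 < h
  inj : ∀ i j, i < h → j < h → ρ i = ρ j → i = j
  per : ∀ i, ρ (i + h) = ρ i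
  hit : ∀ i, I.vert (ρ i) (f (ρ i)) = I.src (ρ (i + 1))
  fpos : ∀ i, 0 < f (ρ i)
  flt : ∀ i, f (ρ i) < I.len (ρ i)

/-- The position `p` lies strictly between the ends of a cycle path of the ring. -/
def Inner (h : ℕ) (ρ : ℕ → R) (f : R → ℕ) (p : ℕ × ℕ) : Prop :=
  p.1 < h ∧ 0 < p.2 ∧ p.2 < f (ρ p.1)

/-- The vertex at a position. -/
def letter (I : MRMPGP V R) (ρ : ℕ → R) (p : ℕ × ℕ) : V := I.vert (ρ p.1) p.2

/-- Positions `p ≤ y ≤ q` that allow to dissolve the ring. Either `p`, `y`, `q` are one and the same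
position, whose vertex is on no other cycle path, or the vertices `v` of `p` and `q` and `w` of `y`
appear in the order `v`, `w`, `v` without a further `w` before the second `v`. -/
structure GoodTriple (I : MRMPGP V R) (h : ℕ) (ρ : ℕ → R) (f : R → ℕ) (p y q : ℕ × ℕ) :
    Prop where
  hp : Inner h ρ f p
  hy : Inner h ρ f y
  hq : Inner h ρ f q
  hpy : p = y ∨ Before p y
  hyq : y = q ∨ Before y q
  eq : I.letter ρ p = I.letter ρ q
  first : ∀ z, Inner h ρ f z → I.letter ρ z = I.letter ρ p → z = p ∨ z = q
  second : ∀ z, Inner h ρ f z → I.letter ρ z = I.letter ρ y → z = y ∨ Before q z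

namespace IsRing

variable {I : MRMPGP V R} {h : ℕ} {ρ : ℕ → R} {f : R → ℕ} (H : I.IsRing h ρ f)
include H

theorem mod (i : ℕ) : ρ (i % h) = ρ i := by
  conv_rhs => rw [← Nat.mod_add_div i h]
  generalize i % h = a
  generalize i / h = b
  induction b with
  | zero => simp
  | succ b ih => rw [ih, Nat.mul_succ, ← Nat.add_assoc, H.per]

theorem eq_iff (i j : ℕ) : ρ i = ρ j ↔ i % h = j % h := by
  constructor
  · intro e
    rw [← H.mod i, ← H.mod j] at e
    exact H.inj _ _ (Nat.mod_lt _ H.pos) (Nat.mod_lt _ H.pos) e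
  · intro e
    rw [← H.mod i, ← H.mod j, e]

theorem succ_eq {i j : ℕ} (e : ρ i = ρ j) : ρ (i + 1) = ρ (j + 1) := by
  rw [H.eq_iff] at e ⊢
  rw [Nat.add_mod, e, ← Nat.add_mod]

theorem succ_cancel {i j : ℕ} (e : ρ (i + 1) = ρ (j + 1)) : ρ i = ρ j := by
  rw [H.eq_iff] at e ⊢
  exact Nat.ModEq.add_right_cancel' 1 e

theorem succ_ne (i : ℕ) : ρ (i + 1) ≠ ρ i := by
  intro e
  have h1 := H.hit i
  rw [e, ← I.vert_zero] at h1
  have := I.vert_inj (H.flt i).le (Nat.zero_le _) h1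
  have := H.fpos i
  omega

theorem exists_lt (i : ℕ) : ∃ j < h, ρ j = ρ i := ⟨i % h, Nat.mod_lt _ H.pos, H.mod i⟩

theorem succ_eq_zero_iff {i : ℕ} (hi : i < h) : ρ (i + 1) = ρ 0 ↔ i + 1 = h := by
  rw [H.eq_iff, Nat.zero_mod]
  constructor
  · intro e
    exact Nat.le_antisymm hi (Nat.le_of_dvd (by omega) (Nat.dvd_of_mod_eq_zero e))
  · rintro rfl
    exact Nat.mod_self _

/-- The sources of a ring are met by the cycle paths at their ends only. -/
theorem src_eq (hM : I.AtMostTwo) {i j t : ℕ} (ht : t ≤ I.len (ρ i))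
    (e : I.src (ρ j) = I.vert (ρ i) t) :
    (ρ j = ρ i ∧ t = 0) ∨ (ρ j = ρ (i + 1) ∧ t = f (ρ i)) := by
  obtain ⟨j', hj'⟩ : ∃ j', ρ (j' + 1) = ρ j := ⟨j + h - 1, by
    rw [Nat.sub_add_cancel (by have := H.pos; omega), H.per]⟩
  have h1 : I.OnPath (ρ i) (I.src (ρ j)) := e ▸ I.onPath_vert ht
  have h2 : I.OnPath (ρ j') (I.src (ρ j)) := by
    rw [← hj', ← H.hit]; exact I.onPath_vert (H.flt _).le
  have h3 := I.onPath_src (ρ j)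
  rcases hM _ _ _ _ h1 h2 h3 with h4 | h4 | h4
  · right
    have h5 := H.succ_eq h4
    refine ⟨by rw [h5, hj'], I.vert_inj ht (H.flt _).le ?_⟩
    rw [H.hit, h5, hj', e]
  · left
    refine ⟨h4.symm, I.vert_inj ht (Nat.zero_le _) ?_⟩
    rw [← e, ← h4, I.vert_zero]
  · exact absurd (hj'.trans h4.symm) (H.succ_ne _)

/-- A vertex has at most two inner positions. -/
theorem letter_two (hM : I.AtMostTwo) {x y z : ℕ × ℕ} (hx : Inner h ρ f x) (hy : Inner h ρ f y)
    (hz : Inner h ρ f z) (hxy : I.letter ρ x = I.letter ρ y) (hxz : I.letter ρ x = I.letter ρ z) :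
    x = y ∨ x = z ∨ y = z := by
  have on : ∀ u, Inner h ρ f u → I.OnPath (ρ u.1) (I.letter ρ u) := fun u hu =>
    I.onPath_vert (hu.2.2.le.trans (H.flt _).le)
  have key : ∀ u v, Inner h ρ f u → Inner h ρ f v → I.letter ρ u = I.letter ρ v → ρ u.1 = ρ v.1 →
      u = v := by
    intro u v hu hv e e'
    have e1 := H.inj _ _ hu.1 hv.1 e'
    refine Prod.ext e1 ?_
    have e2 := hu.2.2
    unfold letter at e
    rw [e'] at e e2
    exact I.vert_inj (e2.le.trans (H.flt _).le) (hv.2.2.le.trans (H.flt _).le) e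
  rcases hM (I.letter ρ x) _ _ _ (on x hx) (hxy ▸ on y hy) (hxz ▸ on z hz) with e | e | e
  · exact Or.inl (key _ _ hx hy hxy e)
  · exact Or.inr (Or.inl (key _ _ hx hz hxz e))
  · exact Or.inr (Or.inr (key _ _ hy hz (hxy.symm.trans hxz) e))

/-- Different positions of a vertex belong to different robots. -/
theorem fst_ne {x y : ℕ × ℕ} (hx : Inner h ρ f x) (hy : Inner h ρ f y)
    (e : I.letter ρ x = I.letter ρ y) (hne : x ≠ y) : x.1 ≠ y.1 := by
  intro e1
  refine hne (Prod.ext e1 ?_)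
  have e2 := hx.2.2
  unfold letter at e
  rw [e1] at e e2
  exact I.vert_inj (e2.le.trans (H.flt _).le) (hy.2.2.le.trans (H.flt _).le) e

end IsRing

/-- The robots number `lo + m - 1, …, lo`, in this order, complete their cycle paths. -/
def finishDown (ρ : ℕ → R) (f : R → ℕ) (lo : ℕ) : ℕ → List (R × ℕ)
  | 0 => []
  | m + 1 => (ρ (lo + m), f (ρ (lo + m))) :: finishDown ρ f lo m

/-- The robots number `i, …, i + m - 1` go to their targets. -/
def toTargets (I : MRMPGP V R) (ρ : ℕ → R) : ℕ → ℕ → List (R × ℕ)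
  | _, 0 => []
  | i, m + 1 => (ρ i, I.len (ρ i)) :: toTargets I ρ (i + 1) m

/-- The schedule that rotates the ring by one robot. The robot of `p` halts at its position, so that
the robots behind it, up to the one following the robot of `q`, can complete their cycle paths.
Then the robot of `y` halts at its position, those behind it up to the robot of `p` complete their
cycle paths, which gives way to the robot of `q`, and so forth. -/
def rotation (h : ℕ) (ρ : ℕ → R) (f : R → ℕ) (p y q : ℕ × ℕ) : List (R × ℕ) :=
  [(ρ p.1, p.2)] ++ finishDown ρ f (q.1 + 1) (p.1 + h - q.1 - 1) ++ [(ρ y.1, y.2)] ++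
  finishDown ρ f p.1 (y.1 - p.1) ++ [(ρ q.1, q.2)] ++ finishDown ρ f y.1 (q.1 - y.1) ++
  [(ρ q.1, f (ρ q.1))]

section Schedule

variable {I : MRMPGP V R} {h : ℕ} {ρ : ℕ → R} {f : R → ℕ}

/-- A configuration in which the robots of the ring are on their cycle paths and no other robot is
on a path of the ring. -/
structure OnRing (I : MRMPGP V R) (h : ℕ) (ρ : ℕ → R) (f : R → ℕ) (τ : R → ℕ) : Prop where
  le : ∀ i, τ (ρ i) ≤ f (ρ i)
  out : ∀ r, (∀ i, ρ i ≠ r) → ∀ i t, t ≤ I.len (ρ i) → I.pos τ r ≠ I.vert (ρ i) t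

theorem OnRing.update [DecidableEq R] {τ : R → ℕ} (hτ : I.OnRing h ρ f τ) {i j : ℕ}
    (hj : j ≤ f (ρ i)) :
    I.OnRing h ρ f (Function.update τ (ρ i) j) := by
  refine ⟨fun i' => ?_, fun r hr i' t ht => ?_⟩
  · by_cases e : ρ i' = ρ i
    · rw [e]; simpa using hj
    · simpa [e] using hτ.le i'
  · have : r ≠ ρ i := fun e => hr i e.symm
    have h1 := hτ.out r hr i' t ht
    simpa [pos, this] using h1

/-- On the cycle paths, only a source that has not been left and robots halted at inner positions
can be in the way. -/
theorem IsRing.canMoveTo (H : I.IsRing h ρ f) (hM : I.AtMostTwo) {τ : R → ℕ}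
    (hτ : I.OnRing h ρ f τ) {i j : ℕ} (hij : τ (ρ i) ≤ j) (hj : j ≤ f (ρ i))
    (hsrc : j = f (ρ i) → 0 < τ (ρ (i + 1)))
    (hmid : ∀ k < h, ∀ t, 0 < τ (ρ k) → τ (ρ k) < f (ρ k) → ρ k ≠ ρ i → τ (ρ i) < t → t ≤ j →
      t < f (ρ i) → I.vert (ρ k) (τ (ρ k)) ≠ I.vert (ρ i) t) :
    I.CanMoveTo τ (ρ i) j := by
  refine ⟨hij, hj.trans (H.flt i).le, fun r' hr' t ht htj e => ?_⟩
  have htl : t ≤ I.len (ρ i) := (htj.trans hj).trans (H.flt i).le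
  by_cases hr : ∀ k, ρ k ≠ r'
  · exact hτ.out r' hr i t htl e
  · push Not at hr
    obtain ⟨k', rfl⟩ := hr
    obtain ⟨k, hk, hkk⟩ := H.exists_lt k'
    rw [← hkk] at e hr'
    unfold MRMPGP.pos at e
    rcases Nat.eq_zero_or_pos (τ (ρ k)) with h0 | h0
    · rw [h0, I.vert_zero] at e
      rcases H.src_eq hM htl e with ⟨-, h1⟩ | ⟨h1, h2⟩
      · omega
      · have := hsrc (by omega)
        rw [← h1] at this; omega
    · rcases (hτ.le k).lt_or_eq with hlt | heq
      · by_cases htf : t < f (ρ i)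
        · exact hmid k hk t h0 hlt hr' ht htj htf e
        · have : t = f (ρ i) := by omega
          subst this
          rw [H.hit] at e
          rcases H.src_eq hM (hlt.le.trans (H.flt k).le) e.symm with ⟨h1, h2⟩ | ⟨h1, h2⟩ <;> omega
      · rw [heq, H.hit] at e
        rcases H.src_eq hM htl e with ⟨h1, h2⟩ | ⟨h1, h2⟩
        · omega
        · exact hr' (H.succ_cancel h1)

/-- The configuration `τ` after completion of the cycle paths number `lo, …, lo + m - 1`. -/
noncomputable def finished (ρ : ℕ → R) (f : R → ℕ) (lo m : ℕ) (τ : R → ℕ) : R → ℕ :=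
  open Classical in fun r => if ∃ i, lo ≤ i ∧ i < lo + m ∧ ρ i = r then f r else τ r

theorem finished_zero (ρ : ℕ → R) (f : R → ℕ) (lo : ℕ) (τ : R → ℕ) : finished ρ f lo 0 τ = τ := by
  funext r
  unfold finished
  rw [if_neg]
  rintro ⟨i, h1, h2, -⟩
  omega

theorem IsRing.macroSteps_finishDown [DecidableEq R] (H : I.IsRing h ρ f) (hM : I.AtMostTwo)
    (lo m : ℕ) {τ : R → ℕ} (hτ : I.OnRing h ρ f τ) (hsrc : 0 < τ (ρ (lo + m)))
    (hmid : ∀ i, lo ≤ i → i < lo + m → ∀ k < h, ∀ t, 0 < τ (ρ k) → τ (ρ k) < f (ρ k) → ρ k ≠ ρ i →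
      τ (ρ i) < t → t < f (ρ i) → I.vert (ρ k) (τ (ρ k)) ≠ I.vert (ρ i) t) :
    I.MacroSteps τ (finishDown ρ f lo m) (finished ρ f lo m τ) := by
  induction m generalizing τ with
  | zero =>
    exact finished_zero _ _ _ _
  | succ m ih =>
    have hc : I.CanMoveTo τ (ρ (lo + m)) (f (ρ (lo + m))) := by
      refine H.canMoveTo hM hτ (hτ.le _) le_rfl (fun _ => hsrc) ?_
      intro k hk t h1 h2 h3 h4 _ h5
      exact hmid _ (by omega) (by omega) k hk t h1 h2 h3 h4 h5
    refine ⟨hc, ?_⟩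
    have := ih (hτ.update le_rfl) (by simpa using H.fpos _) (τ :=
      Function.update τ (ρ (lo + m)) (f (ρ (lo + m)))) ?_
    · convert this using 1
      funext r
      simp only [finished]
      by_cases h1 : ∃ i, lo ≤ i ∧ i < lo + m ∧ ρ i = r
      · rw [if_pos h1, if_pos]
        obtain ⟨i, a, b, c⟩ := h1
        exact ⟨i, a, by omega, c⟩
      · rw [if_neg h1]
        by_cases h2 : ρ (lo + m) = r
        · rw [if_pos ⟨_, by omega, by omega, h2⟩]
          subst h2; simp
        · rw [if_neg, Function.update_of_ne (Ne.symm h2)]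
          rintro ⟨i, a, b, c⟩
          rcases Nat.lt_succ_iff_lt_or_eq.1 b with b | b
          · exact h1 ⟨i, a, b, c⟩
          · exact h2 (by rw [← c, b]; rfl)
    · intro i h1 h2 k hkh t h3 h4 h5 h6 h7
      by_cases hk : ρ k = ρ (lo + m)
      · rw [hk] at h4; simp at h4
      · rw [Function.update_of_ne hk] at h3 h4 ⊢
        by_cases hi : ρ i = ρ (lo + m)
        · rw [hi] at h6 h7
          simp at h6; omega
        · rw [Function.update_of_ne hi] at h6
          exact hmid i h1 (by omega) k hkh t h3 h4 h5 h6 h7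

theorem IsRing.finished_apply (H : I.IsRing h ρ f) {lo m k : ℕ} (hk : k < h) (hlo : lo + m ≤ h)
    (τ : R → ℕ) :
    finished ρ f lo m τ (ρ k) = if lo ≤ k ∧ k < lo + m then f (ρ k) else τ (ρ k) := by
  simp only [finished]
  congr 1
  rw [eq_iff_iff]
  constructor
  · rintro ⟨i, h1, h2, h3⟩
    obtain rfl := H.inj i k (by omega) hk h3
    exact ⟨h1, h2⟩
  · rintro ⟨h1, h2⟩
    exact ⟨k, h1, h2, rfl⟩

theorem IsRing.finished_apply_wrap (H : I.IsRing h ρ f) {a c k : ℕ} (hk : k < h) (hac : a ≤ c)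
    (hc : c < h) (τ : R → ℕ) :
    finished ρ f (c + 1) (a + h - c - 1) τ (ρ k) =
      if c < k ∨ k < a then f (ρ k) else τ (ρ k) := by
  simp only [finished]
  congr 1
  rw [eq_iff_iff]
  constructor
  · rintro ⟨i, h1, h2, h3⟩
    rcases lt_or_ge i h with h4 | h4
    · have := H.inj i k h4 hk h3
      omega
    · obtain ⟨j, rfl⟩ := Nat.exists_eq_add_of_le' h4
      rw [H.per] at h3
      obtain rfl := H.inj j k (by omega) hk h3
      omega
  · rintro (h1 | h1)
    · exact ⟨k, by omega, by omega, rfl⟩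
    · exact ⟨k + h, by omega, by omega, H.per k⟩

theorem OnRing.finished {τ : R → ℕ} (hτ : I.OnRing h ρ f τ) (lo m : ℕ) :
    I.OnRing h ρ f (finished ρ f lo m τ) := by
  refine ⟨fun i => ?_, fun r hr i t ht => ?_⟩
  · unfold MRMPGP.finished
    split
    · exact le_rfl
    · exact hτ.le i
  · have h1 := hτ.out r hr i t ht
    unfold pos MRMPGP.finished
    rwa [if_neg]
    rintro ⟨i, -, -, e⟩
    exact hr i e

theorem IsRing.update_apply [DecidableEq R] (H : I.IsRing h ρ f) {a k : ℕ} (ha : a < h)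
    (hk : k < h) (τ : R → ℕ) (x : ℕ) :
    Function.update τ (ρ a) x (ρ k) = if k = a then x else τ (ρ k) := by
  by_cases e : k = a
  · simp [e]
  · have : ρ k ≠ ρ a := fun e' => e (H.inj _ _ hk ha e')
    simp [e, this]

/-- A rotation is legal: the robots that halt at inner positions are not in the way of the others,
because the vertex of `p` and `q` has no further position, and the vertex of `y` has none before `q`
other than `y`. -/
theorem IsRing.macroSteps_rotation [DecidableEq R] (H : I.IsRing h ρ f) (hM : I.AtMostTwo)
    {p y q : ℕ × ℕ} (g : I.GoodTriple h ρ f p y q) {τ : R → ℕ} (hτ : I.OnRing h ρ f τ)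
    (h0 : ∀ i, τ (ρ i) = 0) :
    I.MacroSteps τ (rotation h ρ f p y q) (finished ρ f 0 h τ) := by
  obtain ⟨a, x⟩ := p
  obtain ⟨b, y⟩ := y
  obtain ⟨c, z⟩ := q
  obtain ⟨⟨ha, hx0, hxf⟩, ⟨hb, hy0, hyf⟩, ⟨hc, hz0, hzf⟩, hpy, hyq, heq, first, second⟩ := g
  simp only [Before, Prod.ext_iff] at hpy hyq first second ha hx0 hxf hb hy0 hyf hc hz0 hzf
  have first' : ∀ i t, i < h → 0 < t → t < f (ρ i) → I.vert (ρ a) x = I.vert (ρ i) t →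
      i = a ∧ t = x ∨ i = c ∧ t = z := fun i t h1 h2 h3 h4 => first (i, t) ⟨h1, h2, h3⟩ h4.symm
  have second' : ∀ i t, i < h → 0 < t → t < f (ρ i) → I.vert (ρ b) y = I.vert (ρ i) t →
      i = b ∧ t = y ∨ c < i ∨ c = i ∧ z < t :=
    fun i t h1 h2 h3 h4 => second (i, t) ⟨h1, h2, h3⟩ h4.symm
  -- The second occurrence of `w` cannot be the second `v`.
  have hbc : b = c → y = z → a = b ∧ x = y := by
    rintro rfl rfl
    have := second' a x ha hx0 hxf heq.symm
    omega
  clear first second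
  have hpos := H.pos
  set τ1 := Function.update τ (ρ a) x with hτ1
  set τ2 := MRMPGP.finished ρ f (c + 1) (a + h - c - 1) τ1 with hτ2
  set τ3 := Function.update τ2 (ρ b) y with hτ3
  set τ4 := MRMPGP.finished ρ f a (b - a) τ3 with hτ4
  set τ5 := Function.update τ4 (ρ c) z with hτ5
  set τ6 := MRMPGP.finished ρ f b (c - b) τ5 with hτ6
  have hac : a ≤ c := by omega
  have v1 : ∀ k < h, τ1 (ρ k) = if k = a then x else 0 := fun k hk => by
    rw [hτ1, H.update_apply ha hk, h0]
  have v2 : ∀ k < h, τ2 (ρ k) = if c < k ∨ k < a then f (ρ k) else if k = a then x else 0 :=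
    fun k hk => by rw [hτ2, H.finished_apply_wrap hk hac hc, v1 k hk]
  have v3 : ∀ k < h, τ3 (ρ k) = if k = b then y else if c < k ∨ k < a then f (ρ k) else
      if k = a then x else 0 := fun k hk => by rw [hτ3, H.update_apply hb hk, v2 k hk]
  have v4 : ∀ k < h, τ4 (ρ k) = if a ≤ k ∧ k < b then f (ρ k) else if k = b then y else
      if c < k ∨ k < a then f (ρ k) else if k = a then x else 0 := fun k hk => by
    rw [hτ4, H.finished_apply hk (by omega), v3 k hk]
    congr 1
    rw [eq_iff_iff]; omega
  have v5 : ∀ k < h, τ5 (ρ k) = if k = c then z else if a ≤ k ∧ k < b then f (ρ k) else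
      if k = b then y else if c < k ∨ k < a then f (ρ k) else if k = a then x else 0 :=
    fun k hk => by rw [hτ5, H.update_apply hc hk, v4 k hk]
  have v6 : ∀ k < h, τ6 (ρ k) = if k = c then z else f (ρ k) := fun k hk => by
    rw [hτ6, H.finished_apply hk (by omega), v5 k hk]
    split_ifs <;> omega
  have R1 : I.OnRing h ρ f τ1 := hτ.update hxf.le
  have R2 : I.OnRing h ρ f τ2 := R1.finished _ _
  have R3 : I.OnRing h ρ f τ3 := R2.update hyf.le
  have R4 : I.OnRing h ρ f τ4 := R3.finished _ _
  have R5 : I.OnRing h ρ f τ5 := R4.update hzf.le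
  have R6 : I.OnRing h ρ f τ6 := R5.finished _ _
  have S1 : I.CanMoveTo τ (ρ a) x := by
    refine H.canMoveTo hM hτ (by simp [h0]) hxf.le (by omega) fun k hk t h1 => ?_
    simp [h0] at h1
  have S2 : I.MacroSteps τ1 (finishDown ρ f (c + 1) (a + h - c - 1)) τ2 := by
    refine H.macroSteps_finishDown hM _ _ R1 ?_ ?_
    · rw [show c + 1 + (a + h - c - 1) = a + h by omega, H.per, v1 a ha]; simpa using hx0
    · intro i' h1 h2 k hk t h3 h4 h5 h6 h7 e
      obtain ⟨i, hi, hii, hir⟩ : ∃ i < h, ρ i = ρ i' ∧ (c < i ∨ i < a) := by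
        rcases lt_or_ge i' h with h8 | h8
        · exact ⟨i', h8, rfl, by omega⟩
        · obtain ⟨j, rfl⟩ := Nat.exists_eq_add_of_le' h8
          exact ⟨j, by omega, (H.per j).symm, by omega⟩
      rw [← hii] at h5 h6 h7 e
      rw [v1 k hk] at h3 h4 e
      split_ifs at h3 h4 e with h8
      · subst h8
        have := first' i t hi (by omega) h7 e
        omega
      · omega
  have S3 : I.CanMoveTo τ2 (ρ b) y := by
    refine H.canMoveTo hM R2 ?_ hyf.le (by omega) fun k hk t h1 h2 h3 h4 h5 h6 e => ?_
    · rw [v2 b hb]; split_ifs <;> omega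
    · have h7 : k ≠ b := fun h => h3 (by rw [h])
      rw [v2 k hk] at h1 h2 e
      split_ifs at h1 h2 e with h8 h9
      · omega
      · subst h9
        have := first' b t hb (by omega) h6 e
        omega
      · omega
  have S4 : I.MacroSteps τ3 (finishDown ρ f a (b - a)) τ4 := by
    rcases Nat.eq_zero_or_pos (b - a) with hba | hba
    · rw [hτ4, hba]
      exact finished_zero _ _ _ _
    refine H.macroSteps_finishDown hM _ _ R3 ?_ ?_
    · rw [show a + (b - a) = b by omega, v3 b hb]; simpa using hy0
    · intro i h1 h2 k hk t h3 h4 h5 h6 h7 e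
      have hi : i < h := by omega
      rw [v3 k hk] at h3 h4 e
      rw [v3 i hi] at h6
      have h8 : k ≠ i := fun h => h5 (by rw [h])
      split_ifs at h3 h4 e with h9 h10 h11
      · subst h9
        have := second' i t hi (by omega) h7 e
        omega
      · omega
      · subst h11
        have := first' i t hi (by omega) h7 e
        omega
      · omega
  have S5 : I.CanMoveTo τ4 (ρ c) z := by
    refine H.canMoveTo hM R4 ?_ hzf.le (by omega) fun k hk t h1 h2 h3 h4 h5 h6 e => ?_
    · rw [v4 c hc]; split_ifs <;> omega
    · have h7 : k ≠ c := fun h => h3 (by rw [h])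
      rw [v4 k hk] at h1 h2 e
      split_ifs at h1 h2 e with h8 h9 h10 h11
      · omega
      · subst h9
        have := second' c t hc (by omega) h6 e
        omega
      · omega
      · omega
      · omega
  have S6 : I.MacroSteps τ5 (finishDown ρ f b (c - b)) τ6 := by
    rcases Nat.eq_zero_or_pos (c - b) with hba | hba
    · rw [hτ6, hba]
      exact finished_zero _ _ _ _
    refine H.macroSteps_finishDown hM _ _ R5 ?_ ?_
    · rw [show b + (c - b) = c by omega, v5 c hc]; simpa using hz0
    · intro i h1 h2 k hk t h3 h4 h5 h6 h7 e
      have hi : i < h := by omega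
      rw [v5 k hk] at h3 h4 e
      rw [v5 i hi] at h6
      have h8 : k ≠ i := fun h => h5 (by rw [h])
      split_ifs at h3 h4 e with h9 h10 h11 h12 h13
      · subst h9
        have := first' i t hi (by omega) h7 (by
          have : I.vert (ρ a) x = I.vert (ρ k) z := heq
          rw [this, e])
        split_ifs at h6 <;> omega
      · omega
      · subst h11
        have := second' i t hi (by omega) h7 e
        omega
      · omega
      · omega
      · omega
  have S7 : I.CanMoveTo τ6 (ρ c) (f (ρ c)) := by
    refine H.canMoveTo hM R6 ?_ le_rfl (fun _ => ?_) fun k hk t h1 h2 h3 h4 h5 h6 e => ?_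
    · exact R6.le c
    · obtain ⟨k, hk, hkc⟩ := H.exists_lt (c + 1)
      rw [← hkc, v6 k hk]
      split_ifs
      · exact hz0
      · exact H.fpos k
    · have h7 : k ≠ c := fun h => h3 (by rw [h])
      rw [v6 k hk, if_neg h7] at h2
      omega
  have S8 : MRMPGP.finished ρ f 0 h τ = Function.update τ6 (ρ c) (f (ρ c)) := by
    funext r
    by_cases hr : ∃ i, ρ i = r
    · obtain ⟨i, rfl⟩ := hr
      obtain ⟨k, hk, hkc⟩ := H.exists_lt i
      rw [← hkc, H.finished_apply hk (by omega), H.update_apply hc hk, v6 k hk,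
        if_pos ⟨Nat.zero_le _, by omega⟩]
      split_ifs with h1
      · rw [h1]
      · rfl
    · have hr' : ∀ i, r ≠ ρ i := fun i e => hr ⟨i, e.symm⟩
      have hn : ∀ lo m, ¬ ∃ i, lo ≤ i ∧ i < lo + m ∧ ρ i = r :=
        fun lo m ⟨i, _, _, e⟩ => hr ⟨i, e⟩
      simp only [hτ6, hτ5, hτ4, hτ3, hτ2, hτ1, MRMPGP.finished, hn, if_false,
        Function.update_of_ne (hr' _)]
  unfold rotation
  simp only [MacroSteps.append_iff]
  refine ⟨τ6, ⟨τ5, ⟨τ4, ⟨τ3, ⟨τ2, ⟨τ1, ⟨S1, rfl⟩, S2⟩, ⟨S3, rfl⟩⟩, S4⟩, ⟨S5, rfl⟩⟩, S6⟩, ⟨S7, S8⟩⟩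

/-- Once all robots of a ring have completed their cycle paths, they can go to their targets in any
order. -/
theorem IsRing.macroSteps_toTargets [DecidableEq R] (H : I.IsRing h ρ f) (hM : I.AtMostTwo)
    (hN : I.NonBlockingTargets) (i m : ℕ) {τ : R → ℕ}
    (hτ : ∀ i, τ (ρ i) = f (ρ i) ∨ τ (ρ i) = I.len (ρ i))
    (out : ∀ r, (∀ i, ρ i ≠ r) → ∀ i t, t ≤ I.len (ρ i) → I.pos τ r ≠ I.vert (ρ i) t) :
    I.MacroSteps τ (toTargets I ρ i m) (finished ρ I.len i m τ) := by
  induction m generalizing τ i with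
  | zero => exact finished_zero _ _ _ _
  | succ m ih =>
    refine ⟨⟨?_, le_rfl, fun r' hr' t ht htl e => ?_⟩, ?_⟩
    · rcases hτ i with h1 | h1 <;> rw [h1]
      exact (H.flt i).le
    · by_cases hr : ∀ k, ρ k ≠ r'
      · exact out r' hr i t htl e
      · push Not at hr
        obtain ⟨k, rfl⟩ := hr
        unfold MRMPGP.pos at e
        rcases hτ k with h1 | h1
        · rw [h1, H.hit] at e
          rcases H.src_eq hM htl e with ⟨-, h2⟩ | ⟨h2, -⟩
          · omega
          · exact hr' (H.succ_cancel h2)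
        · rw [h1] at e
          exact ne_len_of_vert_eq hN hr'.symm htl e.symm rfl
    · have := ih (i + 1) (τ := Function.update τ (ρ i) (I.len (ρ i))) ?_ ?_
      · convert this using 1
        funext r
        simp only [MRMPGP.finished]
        by_cases h1 : ∃ j, i + 1 ≤ j ∧ j < i + 1 + m ∧ ρ j = r
        · rw [if_pos h1, if_pos]
          obtain ⟨j, a, b, c⟩ := h1
          exact ⟨j, by omega, by omega, c⟩
        · rw [if_neg h1]
          by_cases h2 : ρ i = r
          · rw [if_pos ⟨_, by omega, by omega, h2⟩]
            subst h2; simp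
          · rw [if_neg, Function.update_of_ne (Ne.symm h2)]
            rintro ⟨j, a, b, c⟩
            rcases a.lt_or_eq with a | a
            · exact h1 ⟨j, a, by omega, c⟩
            · exact h2 (by rw [← c, a])
      · intro k
        by_cases e : ρ k = ρ i
        · right; simp [e]
        · simpa [e] using hτ k
      · intro r hr k t ht
        have h1 := out r hr k t ht
        have h2 : r ≠ ρ i := fun e => hr i e.symm
        rwa [MRMPGP.pos, Function.update_of_ne h2]

/-- The schedule by which all robots of a ring get to their targets. -/
def schedule (I : MRMPGP V R) (h : ℕ) (ρ : ℕ → R) (f : R → ℕ) (p y q : ℕ × ℕ) : List (R × ℕ) :=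
  rotation h ρ f p y q ++ toTargets I ρ 0 h

theorem IsRing.macroSteps_schedule [DecidableEq R] (H : I.IsRing h ρ f) (hM : I.AtMostTwo)
    (hN : I.NonBlockingTargets) {p y q : ℕ × ℕ} (g : I.GoodTriple h ρ f p y q) {τ : R → ℕ}
    (h0 : ∀ i, τ (ρ i) = 0)
    (out : ∀ r, (∀ i, ρ i ≠ r) → ∀ i t, t ≤ I.len (ρ i) → I.pos τ r ≠ I.vert (ρ i) t) :
    I.MacroSteps τ (schedule I h ρ f p y q) (MRMPGP.finished ρ I.len 0 h τ) := by
  have hτ : I.OnRing h ρ f τ := ⟨fun i => by rw [h0]; exact Nat.zero_le _, out⟩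
  refine MacroSteps.append_iff.2 ⟨_, H.macroSteps_rotation hM g hτ h0, ?_⟩
  have hin : ∀ k, ∃ i, 0 ≤ i ∧ i < 0 + h ∧ ρ i = ρ k := fun k => by
    obtain ⟨i, hi, e⟩ := H.exists_lt k
    exact ⟨i, by omega, by omega, e⟩
  have hR := hτ.finished 0 h
  have := H.macroSteps_toTargets hM hN 0 h (τ := MRMPGP.finished ρ f 0 h τ) (fun k => Or.inl ?_)
    hR.out
  · convert this using 1
    funext r
    simp only [MRMPGP.finished]
    split_ifs <;> rfl
  · simp only [MRMPGP.finished]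
    rw [if_pos (hin k)]

end Schedule

end MRMPGP

/-! ### Balanced rings are deadlocked -/

namespace MRMPGP

variable {V R : Type*}

/-- Every plan gives rise to times `e r a` at which the robot `r` arrives at the vertex number `a`
of its path. They are positive except at initially reached vertices; only one robot moves at a time;
and a robot arrives at a vertex only after any earlier visitor has left it. -/
theorem exists_arrival_times [DecidableEq R] {I : MRMPGP V R} {plan : List R} {σ : R → ℕ}
    (h : I.Steps σ plan I.len) : ∃ e : R → ℕ → ℕ,
      (∀ r a, a ≤ σ r → e r a = 0) ∧
      (∀ r a, σ r < a → a ≤ I.len r → 0 < e r a) ∧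
      (∀ r r' a a', r ≠ r' → σ r < a → a ≤ I.len r → σ r' < a' → a' ≤ I.len r' →
        e r a ≠ e r' a') ∧
      (∀ r r' a a', r ≠ r' → I.vert r a = I.vert r' a' → σ r < a → a ≤ I.len r → σ r' ≤ a' →
        a' < I.len r' → e r' a' < e r a → e r' (a' + 1) < e r a) := by
  induction plan generalizing σ with
  | nil =>
    cases h
    exact ⟨fun _ _ => 0, fun _ _ _ => rfl, fun _ _ _ _ => by omega, fun _ _ _ _ _ _ _ => by omega,
      fun _ _ _ _ _ _ _ _ => by omega⟩
  | cons r₀ rs ih =>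
    obtain ⟨hl, hs⟩ := h
    obtain ⟨e, h1, h2, h3, h4⟩ := ih hs
    set σ' := Function.update σ r₀ (σ r₀ + 1) with hσ'
    have hσ : ∀ r, (r = r₀ ∧ σ' r = σ r + 1) ∨ (r ≠ r₀ ∧ σ' r = σ r) := by
      intro r
      by_cases e : r = r₀
      · left; subst e; simp [hσ']
      · right; simp [hσ', e]
    refine ⟨fun r a => if a ≤ σ r then 0 else e r a + 1, ?_, ?_, ?_, ?_⟩
    · intro r a ha
      simp [ha]
    · intro r a ha _
      simp [show ¬ a ≤ σ r by omega]
    · intro r r' a a' hne ha hal ha' hal'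
      simp only [show ¬ a ≤ σ r by omega, show ¬ a' ≤ σ r' by omega, if_false]
      rcases hσ r with ⟨e1, e2⟩ | ⟨e1, e2⟩ <;> rcases hσ r' with ⟨e1', e2'⟩ | ⟨e1', e2'⟩
      · exact absurd (e1.trans e1'.symm) hne
      · have := h2 r' a' (by omega) hal'
        by_cases h5 : a ≤ σ' r
        · have := h1 r a h5; omega
        · have := h3 r r' a a' hne (by omega) hal (by omega) hal'; omega
      · have := h2 r a (by omega) hal
        by_cases h5 : a' ≤ σ' r'
        · have := h1 r' a' h5; omega
        · have := h3 r r' a a' hne (by omega) hal (by omega) hal'; omega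
      · have := h3 r r' a a' hne (by omega) hal (by omega) hal'; omega
    · intro r r' a a' hne hv ha hal ha' hal'
      simp only [show ¬ a ≤ σ r by omega, show ¬ a' + 1 ≤ σ r' by omega, if_false]
      intro hlt
      by_cases h5 : a ≤ σ' r
      · -- The first move is the one by which `r` arrives.
        obtain ⟨e1, e2⟩ : r = r₀ ∧ σ' r = σ r + 1 := by
          rcases hσ r with h6 | h6
          · exact h6
          · omega
        have h6 := h1 r a h5
        have h7 : a' ≤ σ r' := by
          by_contra h7
          rw [if_neg h7] at hlt
          omega
        have h8 : a' = σ r' := by omega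
        have h9 : a = σ r + 1 := by omega
        subst h8 h9 e1
        exact absurd hv.symm (hl.2 r' hne.symm)
      · have h6 := h2 r a (by omega) hal
        by_cases h7 : σ' r' ≤ a'
        · have h8 : e r' a' < e r a := by
            by_cases h9 : a' ≤ σ r'
            · rw [h1 r' a' (by rcases hσ r' with h | h <;> omega)]; exact h6
            · rw [if_neg h9] at hlt; omega
          have := h4 r r' a a' hne hv (by omega) hal h7 hal' h8
          omega
        · have := h1 r' (a' + 1) (by omega)
          omega

/-- In a ring without scout whose positions are matched without crossing: every inner position has
a partner with the same vertex, and positions between partners have their partners between them. -/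
structure Balanced (I : MRMPGP V R) (h : ℕ) (ρ : ℕ → R) (f : R → ℕ) : Prop where
  partner : ∀ y, Inner h ρ f y → ∃ y', Inner h ρ f y' ∧ y' ≠ y ∧ I.letter ρ y' = I.letter ρ y
  nested : ∀ p q y, Inner h ρ f p → Inner h ρ f q → Inner h ρ f y → I.letter ρ p = I.letter ρ q →
    Before p y → Before y q →
    ∃ y', Inner h ρ f y' ∧ y' ≠ y ∧ I.letter ρ y' = I.letter ρ y ∧ Before p y' ∧ Before y' q

section

variable {I : MRMPGP V R} {h : ℕ} {ρ : ℕ → R} {f : R → ℕ}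

theorem Before.trichotomy (p q : ℕ × ℕ) : Before p q ∨ p = q ∨ Before q p := by
  simp only [Before, Prod.ext_iff]
  omega

/-- A ring in which every inner position has a partner is balanced unless two vertices cross. -/
theorem IsRing.balanced_or_goodTriple (H : I.IsRing h ρ f) (hM : I.AtMostTwo)
    (hP : ∀ y, Inner h ρ f y → ∃ y', Inner h ρ f y' ∧ y' ≠ y ∧ I.letter ρ y' = I.letter ρ y) :
    I.Balanced h ρ f ∨ ∃ p y q y', I.GoodTriple h ρ f p y q ∧ Before p y ∧ Before y q ∧
      Inner h ρ f y' ∧ Before q y' ∧ I.letter ρ y = I.letter ρ y' := by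
  by_cases hB : ∀ p q y, Inner h ρ f p → Inner h ρ f q → Inner h ρ f y →
      I.letter ρ p = I.letter ρ q → Before p y → Before y q →
      ∃ y', Inner h ρ f y' ∧ y' ≠ y ∧ I.letter ρ y' = I.letter ρ y ∧ Before p y' ∧ Before y' q
  · exact Or.inl ⟨hP, hB⟩
  right
  push Not at hB
  obtain ⟨p, q, y, hp, hq, hy, e, hpy, hyq, hno⟩ := hB
  obtain ⟨y', hy', hne, e'⟩ := hP y hy
  have main : ∀ p y q y', Inner h ρ f p → Inner h ρ f y → Inner h ρ f q → Inner h ρ f y' →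
      Before p y → Before y q → Before q y' → I.letter ρ p = I.letter ρ q →
      I.letter ρ y = I.letter ρ y' → I.GoodTriple h ρ f p y q := by
    intro p y q y' hp hy hq hy' h1 h2 h3 e1 e2
    refine ⟨hp, hy, hq, Or.inr h1, Or.inr h2, e1, fun z hz ez => ?_, fun z hz ez => ?_⟩
    · rcases H.letter_two hM hz hp hq ez (ez.trans e1) with h4 | h4 | h4
      · exact Or.inl h4
      · exact Or.inr h4
      · exfalso; subst h4; simp only [Before] at h1 h2; omega
    · rcases H.letter_two hM hz hy hy' ez (ez.trans e2) with h4 | h4 | h4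
      · exact Or.inl h4
      · exact Or.inr (h4 ▸ h3)
      · exfalso; subst h4; simp only [Before] at h2 h3; omega
  rcases Before.trichotomy q y' with h1 | h1 | h1
  · exact ⟨p, y, q, y', main p y q y' hp hy hq hy' hpy hyq h1 e e'.symm, hpy, hyq, hy', h1, e'.symm⟩
  · exfalso
    subst h1
    rcases H.letter_two hM hp hy hy' (e.trans e') e with h4 | h4 | h4
    · subst h4; simp only [Before] at hpy; omega
    · subst h4; simp only [Before] at hpy hyq; omega
    · exact hne h4.symm
  rcases Before.trichotomy y' p with h2 | h2 | h2
  · exact ⟨y', p, y, q, main y' p y q hy' hp hy hq h2 hpy hyq e' e, h2, hpy, hq, hyq, e⟩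
  · exfalso
    subst h2
    rcases H.letter_two hM hy hy' hq e'.symm (e'.symm.trans e) with h4 | h4 | h4
    · exact hne h4.symm
    · subst h4; simp only [Before] at hyq; omega
    · subst h4; simp only [Before] at hpy hyq; omega
  · exact absurd h1 (hno y' hy' hne e' h2)

/-- A set `T` of moves of which none can be the first to be made: it contains, with the move from
a position, the next move of the robot that must have left the vertex moved to. -/
theorem IsRing.no_first_move (H : I.IsRing h ρ f) {e : R → ℕ → ℕ}
    (he0 : ∀ i, e (ρ i) 0 = 0) (hpos : ∀ i a, 0 < a → a ≤ I.len (ρ i) → 0 < e (ρ i) a)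
    (hexit : ∀ i j a b, ρ i ≠ ρ j → I.vert (ρ i) a = I.vert (ρ j) b → 0 < a →
      a ≤ I.len (ρ i) → b < I.len (ρ j) → e (ρ j) b < e (ρ i) a → e (ρ j) (b + 1) < e (ρ i) a)
    (T : ℕ × ℕ → Prop) (hT : ∀ i a, T (i, a) → a < f (ρ i))
    (hsrc : ∀ i a, T (i, a) → a + 1 = f (ρ i) → ∃ j, ρ j = ρ (i + 1) ∧ T (j, 0))
    (hinn : ∀ i a, T (i, a) → a + 1 < f (ρ i) → ∃ j b, T (j, b) ∧ ρ i ≠ ρ j ∧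
      I.vert (ρ i) (a + 1) = I.vert (ρ j) b ∧ e (ρ j) b < e (ρ i) (a + 1)) (i a : ℕ) :
    ¬ T (i, a) := by
  induction hn : e (ρ i) (a + 1) using Nat.strong_induction_on generalizing i a with
  | _ n ih =>
    intro hia
    have h1 := hT i a hia
    have h2 := H.flt i
    by_cases h3 : a + 1 = f (ρ i)
    · obtain ⟨j, hj, hTj⟩ := hsrc i a hia h3
      have h5 : ρ i ≠ ρ j := by rw [hj]; exact (H.succ_ne i).symm
      have h4 := hexit i j (a + 1) 0 h5 (by rw [h3, H.hit, hj, I.vert_zero]) (by omega)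
        (by omega) (by have := H.flt j; omega) (by rw [he0]; exact hpos i _ (by omega) (by omega))
      exact ih _ (hn ▸ h4) j 0 rfl hTj
    · obtain ⟨j, b, hTj, h5, h6, h7⟩ := hinn i a hia (by omega)
      have h4 := hexit i j (a + 1) b h5 h6 (by omega) (by omega)
        (by have := H.flt j; have := hT j b hTj; omega) h7
      exact ih _ (hn ▸ h4) j b rfl hTj

theorem Before.wf : WellFounded Before := by
  have : Before = Prod.Lex (· < ·) (· < ·) := by
    funext p q
    rw [Prod.lex_def]
    rfl
  rw [this]
  exact (Nat.lt_wfRel.wf).prod_lex (Nat.lt_wfRel.wf)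

/-- The robots of a balanced ring never reach their targets. -/
theorem IsRing.no_plan_of_balanced [DecidableEq R] (H : I.IsRing h ρ f) (hM : I.AtMostTwo)
    (hB : I.Balanced h ρ f) {σ : R → ℕ} (h0 : ∀ i, σ (ρ i) = 0) (plan : List R) :
    ¬ I.Steps σ plan I.len := by
  intro hplan
  obtain ⟨e, e1, e2, e3, e4⟩ := exists_arrival_times hplan
  have he0 : ∀ i, e (ρ i) 0 = 0 := fun i => e1 _ _ (Nat.zero_le _)
  have hpos : ∀ i a, 0 < a → a ≤ I.len (ρ i) → 0 < e (ρ i) a :=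
    fun i a h1 h2 => e2 _ _ (by rw [h0]; exact h1) h2
  have hexit : ∀ i j a b, ρ i ≠ ρ j → I.vert (ρ i) a = I.vert (ρ j) b → 0 < a →
      a ≤ I.len (ρ i) → b < I.len (ρ j) → e (ρ j) b < e (ρ i) a → e (ρ j) (b + 1) < e (ρ i) a :=
    fun i j a b h1 h2 h3 h4 h5 h6 =>
      e4 _ _ _ _ h1 h2 (by rw [h0]; exact h3) h4 (by rw [h0]; exact Nat.zero_le _) h5 h6
  set E : ℕ × ℕ → ℕ := fun p => e (ρ p.1) p.2 with hE
  have hEne : ∀ a b, Inner h ρ f a → Inner h ρ f b → I.letter ρ a = I.letter ρ b → Before a b →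
      E a ≠ E b := by
    intro a b ha hb hab hlt
    refine e3 _ _ _ _ (fun h1 => ?_) (by rw [h0]; exact ha.2.1) (ha.2.2.le.trans (H.flt _).le)
      (by rw [h0]; exact hb.2.1) (hb.2.2.le.trans (H.flt _).le)
    have h2 : a ≠ b := by rintro rfl; simp only [Before] at hlt; omega
    exact H.fst_ne ha hb hab h2 (H.inj _ _ ha.1 hb.1 h1)
  -- Let `p`, `q` be partners reached in this order, or the ends of the ring, while partners before
  -- `q` are reached in the opposite order. Consider the moves from positions from `p` up to `q` that
  -- are not enclosed by partners in between: none of them can be the first one.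
  have core : ∀ p q, (Inner h ρ f p ∧ Inner h ρ f q ∧ I.letter ρ p = I.letter ρ q ∧ Before p q ∧
        E p < E q ∨ p = (0, 0) ∧ q = (h, 0)) →
      (∀ a b, Inner h ρ f a → Inner h ρ f b → I.letter ρ a = I.letter ρ b → Before a b →
        Before b q → E b < E a) → False := by
    intro p q hpq hout
    have hin : ∀ y, Inner h ρ f y → Before p y → Before y q → ∃ y', Inner h ρ f y' ∧ y' ≠ y ∧
        I.letter ρ y' = I.letter ρ y ∧ Before p y' ∧ Before y' q := by
      intro y hy h1 h2
      rcases hpq with ⟨hp, hq, hl, -, -⟩ | ⟨rfl, rfl⟩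
      · exact hB.nested p q y hp hq hy hl h1 h2
      · obtain ⟨y', hy', h3, h4⟩ := hB.partner y hy
        refine ⟨y', hy', h3, h4, ?_, ?_⟩
        · simp only [Before]; have := hy'.2.1; omega
        · exact Or.inl hy'.1
    set T : ℕ × ℕ → Prop := fun j => j.1 < h ∧ j.2 < f (ρ j.1) ∧ (p = j ∨ Before p j) ∧
      Before j q ∧ ∀ a b, Inner h ρ f a → Inner h ρ f b → I.letter ρ a = I.letter ρ b →
        Before p a → Before b q → (a = j ∨ Before a j) → ¬ Before j b with hTdef
    have hTp : T p := by
      rcases hpq with ⟨hp, hq, hl, hlt, -⟩ | ⟨rfl, rfl⟩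
      · refine ⟨hp.1, hp.2.2, Or.inl rfl, hlt, fun a b _ _ _ h1 _ h2 => ?_⟩
        exfalso
        simp only [Before, Prod.ext_iff] at h1 h2
        omega
      · refine ⟨H.pos, H.fpos 0, Or.inl rfl, Or.inl H.pos, fun a b _ _ _ h1 _ h2 => ?_⟩
        exfalso
        simp only [Before, Prod.ext_iff] at h1 h2
        omega
    refine H.no_first_move he0 hpos hexit T (fun i a hT => hT.2.1) ?_ ?_ p.1 p.2 hTp
    · rintro i a ⟨hi, ha, hpj, hjq, hnest⟩ haf
      simp only at hi ha
      have hnext : i + 1 < h → Before (i + 1, 0) q → ∃ j, ρ j = ρ (i + 1) ∧ T (j, 0) := by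
        intro h1 h2
        refine ⟨i + 1, rfl, h1, H.fpos _, Or.inr ?_, h2, fun c d hc hd hcd h3 h4 h5 h6 => ?_⟩
        · simp only [Before, Prod.ext_iff] at hpj ⊢
          omega
        · have hc0 := hc.2.1
          have hcf := hc.2.2
          refine hnest c d hc hd hcd h3 h4 ?_ ?_
          · by_cases h7 : c.1 = i
            · rw [h7] at hcf
              simp only [Before, Prod.ext_iff] at h5 ⊢
              omega
            · simp only [Before, Prod.ext_iff] at h5 ⊢
              omega
          · simp only [Before] at h6 ⊢
            omega
      rcases hpq with ⟨hp, hq, -, -, -⟩ | ⟨rfl, rfl⟩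
      · have hqf := hq.2.2
        have hq1 := hq.1
        have hiq : i < q.1 := by
          by_contra h1
          have h2 : q.1 = i := by simp only [Before] at hjq; omega
          rw [h2] at hqf
          simp only [Before] at hjq
          omega
        refine hnext (by omega) ?_
        simp only [Before]
        have := hq.2.1
        omega
      · rcases (show i + 1 ≤ h from hi).lt_or_eq with h1 | h1
        · exact hnext h1 (Or.inl h1)
        · refine ⟨0, ?_, hTp⟩
          rw [h1, ← H.per 0, Nat.zero_add]
    · rintro i a ⟨hi, ha, hpj, hjq, hnest⟩ haf
      simp only at hi ha
      have hs : Inner h ρ f (i, a + 1) := ⟨hi, Nat.succ_pos _, haf⟩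
      by_cases hsq : (i, a + 1) = q
      · rcases hpq with ⟨hp, hq, hl, hlt, hEpq⟩ | ⟨rfl, rfl⟩
        · refine ⟨p.1, p.2, hTp, ?_, ?_, ?_⟩
          · intro h1
            have h2 := H.inj _ _ hi hp.1 h1
            refine H.fst_ne hp hq hl ?_ ?_
            · intro h3
              rw [h3] at hEpq
              exact lt_irrefl _ hEpq
            · rw [← hsq, ← h2]
          · rw [← hsq] at hl; exact hl.symm
          · rw [← hsq] at hEpq; exact hEpq
        · simp at hsq
      have hs1 : Before p (i, a + 1) := by
        simp only [Before, Prod.ext_iff] at hpj ⊢; omega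
      have hs2 : Before (i, a + 1) q := by
        simp only [Before, Prod.ext_iff] at hjq hsq ⊢; omega
      obtain ⟨s, hsI, hne, hl, hps, hsq'⟩ := hin _ hs hs1 hs2
      have hij : ρ i ≠ ρ s.1 := fun h1 =>
        H.fst_ne hsI hs hl hne (H.inj _ _ hi hsI.1 h1).symm
      rcases Before.trichotomy s (i, a + 1) with h1 | h1 | h1
      · exfalso
        refine hnest s (i, a + 1) hsI hs hl hps hs2 ?_ ?_
        · simp only [Before, Prod.ext_iff] at h1 ⊢; omega
        · exact Or.inr ⟨rfl, Nat.lt_succ_self a⟩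
      · exact absurd h1 hne
      · refine ⟨s.1, s.2, ⟨hsI.1, hsI.2.2, Or.inr hps, hsq', fun c d hc hd hcd h3 h4 h5 h6 => ?_⟩,
          hij, hl.symm, hout _ _ hs hsI hl.symm h1 hsq'⟩
        -- A pair around `s` is also one around its partner, hence around `(i, a)`.
        have hcs : c ≠ s := by
          rintro rfl
          rcases H.letter_two hM hc hd hs hcd hl with h7 | h7 | h7
          · subst h7; simp only [Before] at h6; omega
          · exact hne h7
          · subst h7; simp only [Before] at h1 h6; omega
        have h7 : Before c s := by
          rcases h5 with h5 | h5
          · exact absurd h5 hcs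
          · exact h5
        obtain ⟨s', hs', hne', hl', hcs', hsd'⟩ := hB.nested c d s hc hd hsI hcd h7 h6
        have h8 : s' = (i, a + 1) := by
          rcases H.letter_two hM hs' hsI hs hl' (hl'.trans hl) with h9 | h9 | h9
          · exact absurd h9 hne'
          · exact h9
          · exact absurd h9 hne
        subst h8
        refine hnest c d hc hd hcd h3 h4 ?_ ?_
        · simp only [Before, Prod.ext_iff] at hcs' ⊢; omega
        · simp only [Before] at hsd' ⊢; omega
  -- Of two partners, the later one is reached first.
  have noInward : ∀ q p, Inner h ρ f p → Inner h ρ f q → I.letter ρ p = I.letter ρ q →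
      Before p q → E q < E p := by
    intro q
    induction q using Before.wf.induction with
    | _ q ih =>
      intro p hp hq hl hlt
      by_contra h1
      have h2 := hEne p q hp hq hl hlt
      exact core p q (Or.inl ⟨hp, hq, hl, hlt, by omega⟩)
        fun a b ha hb hab h3 h4 => ih b h4 a ha hb hab h3
  exact core (0, 0) (h, 0) (Or.inr ⟨rfl, rfl⟩)
    fun a b ha hb hab h3 _ => noInward b a ha hb hab h3

end

end MRMPGP

/-! ### Jams: configurations in which no robot has a clear path -/

namespace MRMPGP

variable {V R : Type*}

theorem canMoveTo_of_hasClearPath {I : MRMPGP V R} {σ : R → ℕ} {r : R} (h : I.HasClearPath σ r)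
    (hle : σ r ≤ I.len r) : I.CanMoveTo σ r (I.len r) :=
  ⟨hle, le_rfl, fun r' hr' i hi hil => h r' hr' i hi.le hil⟩

/-- The configuration in which the robots in `U` are at their sources and all others at their
targets. -/
def waiting [DecidableEq R] (I : MRMPGP V R) (U : Finset R) : R → ℕ :=
  fun r => if r ∈ U then 0 else I.len r

/-- Every robot in `U` is blocked by the robot `nx r` in `U` at the vertex number `f r` of its
path, when all robots in `U` are at their sources. -/
structure Jam (I : MRMPGP V R) (U : Finset R) (nx : R → R) (f : R → ℕ) : Prop where
  mem : ∀ r ∈ U, nx r ∈ U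
  fpos : ∀ r ∈ U, 0 < f r
  flt : ∀ r ∈ U, f r < I.len r
  hit : ∀ r ∈ U, I.vert r (f r) = I.src (nx r)

/-- The robots met from `r₀` by following the blocking relation. -/
def orbit (nx : R → R) (r₀ : R) (i : ℕ) : R := nx^[i] r₀

theorem orbit_succ (nx : R → R) (r₀ : R) (i : ℕ) : orbit nx r₀ (i + 1) = nx (orbit nx r₀ i) :=
  Function.iterate_succ_apply' _ _ _

/-- `U` without the orbit of `r₀`. -/
noncomputable def removeOrbit (U : Finset R) (nx : R → R) (r₀ : R) : Finset R :=
  open Classical in U.filter fun r => ∀ i, orbit nx r₀ i ≠ r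

theorem mem_removeOrbit {U : Finset R} {nx : R → R} {r₀ r : R} :
    r ∈ removeOrbit U nx r₀ ↔ r ∈ U ∧ ∀ i, orbit nx r₀ i ≠ r := by
  simp [removeOrbit]

namespace Jam

variable {I : MRMPGP V R} {U : Finset R} {nx : R → R} {f : R → ℕ} (J : I.Jam U nx f)
include J

theorem nx_ne {r : R} (hr : r ∈ U) : nx r ≠ r := by
  intro e
  have h1 := J.hit r hr
  rw [e, ← I.vert_zero] at h1
  have := I.vert_inj (J.flt r hr).le (Nat.zero_le _) h1
  have := J.fpos r hr
  omega

theorem onPath_src_nx {r : R} (hr : r ∈ U) : I.OnPath r (I.src (nx r)) := by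
  rw [← J.hit r hr]; exact I.onPath_vert (J.flt r hr).le

theorem injOn (hM : I.AtMostTwo) {r r' : R} (hr : r ∈ U) (hr' : r' ∈ U) (e : nx r = nx r') :
    r = r' := by
  rcases hM _ _ _ _ (J.onPath_src_nx hr) (e ▸ J.onPath_src_nx hr') (I.onPath_src (nx r)) with
    h | h | h
  · exact h
  · exact absurd h.symm (J.nx_ne hr)
  · exact absurd (h.trans e).symm (J.nx_ne hr')

theorem orbit_mem {r₀ : R} (h₀ : r₀ ∈ U) (i : ℕ) : orbit nx r₀ i ∈ U := by
  induction i with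
  | zero => exact h₀
  | succ i ih => rw [orbit_succ]; exact J.mem _ ih

theorem minimalPeriod_pos (hM : I.AtMostTwo) {r₀ : R} (h₀ : r₀ ∈ U) :
    0 < Function.minimalPeriod nx r₀ := by
  set g : U → U := fun r => ⟨nx r.1, J.mem r.1 r.2⟩ with hg
  have hinj : Function.Injective g := fun a b e =>
    Subtype.ext (J.injOn hM a.2 b.2 (congrArg Subtype.val e))
  obtain ⟨n, hn, hp⟩ := hinj.mem_periodicPts ⟨r₀, h₀⟩
  have hval : ∀ n, (g^[n] ⟨r₀, h₀⟩).1 = nx^[n] r₀ := by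
    intro n
    induction n with
    | zero => rfl
    | succ n ih => rw [Function.iterate_succ_apply', Function.iterate_succ_apply', ← ih]
  refine Function.IsPeriodicPt.minimalPeriod_pos hn (?_ : nx^[n] r₀ = r₀)
  rw [← hval, hp]

theorem isRing (hM : I.AtMostTwo) {r₀ : R} (h₀ : r₀ ∈ U) :
    I.IsRing (Function.minimalPeriod nx r₀) (orbit nx r₀) f where
  pos := J.minimalPeriod_pos hM h₀
  inj _ _ hi hj e := Function.iterate_injOn_Iio_minimalPeriod hi hj e
  per _ := Function.iterate_add_minimalPeriod_eq
  hit i := by rw [J.hit _ (J.orbit_mem h₀ i), orbit_succ]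
  fpos i := J.fpos _ (J.orbit_mem h₀ i)
  flt i := J.flt _ (J.orbit_mem h₀ i)

theorem exists_nx_eq (hM : I.AtMostTwo) {r : R} (hr : r ∈ U) : ∃ r' ∈ U, nx r' = r := by
  have h1 := J.minimalPeriod_pos hM hr
  refine ⟨orbit nx r (Function.minimalPeriod nx r - 1), J.orbit_mem hr _, ?_⟩
  rw [← orbit_succ nx r, Nat.sub_add_cancel h1]
  exact Function.iterate_minimalPeriod

/-- A waiting robot blocks only its predecessor. -/
theorem src_eq (hM : I.AtMostTwo) {r r' : R} (hr' : r' ∈ U) {t : ℕ}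
    (ht : t ≤ I.len r) (e : I.src r' = I.vert r t) :
    (r' = r ∧ t = 0) ∨ (r ∈ U ∧ r' = nx r ∧ t = f r) := by
  obtain ⟨r'', h1, rfl⟩ := J.exists_nx_eq hM hr'
  have h2 : I.OnPath r (I.src (nx r'')) := e ▸ I.onPath_vert ht
  rcases hM _ _ _ _ h2 (J.onPath_src_nx h1) (I.onPath_src _) with h | h | h
  · subst h
    exact Or.inr ⟨h1, rfl, I.vert_inj ht (J.flt _ h1).le (by rw [← e, J.hit _ h1])⟩
  · subst h
    exact Or.inl ⟨rfl, I.vert_inj ht (Nat.zero_le _) (by rw [← e, I.vert_zero])⟩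
  · exact absurd h.symm (J.nx_ne h1)

theorem remove (hM : I.AtMostTwo) {r₀ : R} (h₀ : r₀ ∈ U) :
    I.Jam (removeOrbit U nx r₀) nx f := by
  have sub : ∀ r ∈ removeOrbit U nx r₀, r ∈ U := fun r h => (mem_removeOrbit.1 h).1
  refine ⟨fun r hr => mem_removeOrbit.2 ⟨J.mem _ (sub r hr), fun i e => ?_⟩,
    fun r hr => J.fpos _ (sub r hr), fun r hr => J.flt _ (sub r hr), fun r hr => J.hit _ (sub r hr)⟩
  have H := J.isRing hM h₀
  have h1 := H.pos
  have h2 : orbit nx r₀ (i + Function.minimalPeriod nx r₀ - 1 + 1) = orbit nx r₀ i := by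
    rw [Nat.sub_add_cancel (by omega), H.per]
  rw [orbit_succ] at h2
  have h3 := J.injOn hM (J.orbit_mem h₀ _) (sub r hr) (h2.trans e)
  exact (mem_removeOrbit.1 hr).2 _ h3

variable [DecidableEq R]

/-- Robots outside a ring are not in its way. -/
theorem outside (hM : I.AtMostTwo) (hN : I.NonBlockingTargets) {r₀ r : R}
    (hr : ∀ i, orbit nx r₀ i ≠ r) (i t : ℕ) (ht : t ≤ I.len (orbit nx r₀ i)) :
    I.pos (I.waiting U) r ≠ I.vert (orbit nx r₀ i) t := by
  intro e
  rw [pos, waiting] at e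
  split_ifs at e with h1
  · rw [I.vert_zero] at e
    rcases J.src_eq hM h1 ht e with ⟨h2, -⟩ | ⟨-, h2, -⟩
    · exact hr i h2.symm
    · exact hr (i + 1) (by rw [orbit_succ, h2])
  · rw [I.vert_len] at e
    exact hN _ _ (hr i) (e ▸ I.onPath_vert ht)

theorem finished_waiting (hM : I.AtMostTwo) {r₀ : R} (h₀ : r₀ ∈ U) :
    finished (orbit nx r₀) I.len 0 (Function.minimalPeriod nx r₀) (I.waiting U) =
      I.waiting (removeOrbit U nx r₀) := by
  funext r
  have H := J.isRing hM h₀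
  unfold finished waiting
  by_cases h : ∃ i, orbit nx r₀ i = r
  · obtain ⟨i, rfl⟩ := h
    obtain ⟨j, hj, e⟩ := H.exists_lt i
    rw [if_pos ⟨j, by omega, by omega, e⟩, if_neg (fun h => (mem_removeOrbit.1 h).2 i rfl)]
  · rw [if_neg (fun ⟨i, _, _, e⟩ => h ⟨i, e⟩)]
    push Not at h
    have : r ∈ removeOrbit U nx r₀ ↔ r ∈ U := by simp [mem_removeOrbit, h]
    simp [this]

theorem macroSteps (hM : I.AtMostTwo) (hN : I.NonBlockingTargets) {r₀ : R} (h₀ : r₀ ∈ U)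
    {p y q : ℕ × ℕ} (g : I.GoodTriple (Function.minimalPeriod nx r₀) (orbit nx r₀) f p y q) :
    I.MacroSteps (I.waiting U)
      (schedule I (Function.minimalPeriod nx r₀) (orbit nx r₀) f p y q)
      (I.waiting (removeOrbit U nx r₀)) := by
  have := (J.isRing hM h₀).macroSteps_schedule hM hN g (τ := I.waiting U)
    (fun i => by simp [waiting, J.orbit_mem h₀ i]) (fun r hr => J.outside hM hN hr)
  rwa [J.finished_waiting hM h₀] at this

/-- If every ring has a good triple, then the rings can be dissolved one after the other. -/
theorem exists_plan (hM : I.AtMostTwo) (hN : I.NonBlockingTargets)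
    (hg : ∀ r₀ ∈ U, ∃ p y q,
      I.GoodTriple (Function.minimalPeriod nx r₀) (orbit nx r₀) f p y q) :
    ∃ plan, I.Steps (I.waiting U) plan I.len := by
  induction hn : U.card using Nat.strong_induction_on generalizing U with
  | _ n ih =>
    rcases U.eq_empty_or_nonempty with rfl | ⟨r₀, h₀⟩
    · exact ⟨[], by funext r; simp [waiting]⟩
    · obtain ⟨p, y, q, g⟩ := hg r₀ h₀
      obtain ⟨l, hl⟩ := (J.macroSteps hM hN h₀ g).exists_steps
      have hsub : removeOrbit U nx r₀ ⊂ U := by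
        refine Finset.ssubset_iff_subset_ne.2 ⟨fun r h => (mem_removeOrbit.1 h).1, fun e => ?_⟩
        rw [← e] at h₀
        exact (mem_removeOrbit.1 h₀).2 0 rfl
      obtain ⟨l', hl'⟩ := ih _ (hn ▸ Finset.card_lt_card hsub) (J.remove hM h₀)
        (fun r hr => hg r (mem_removeOrbit.1 hr).1) rfl
      exact ⟨l ++ l', hl.append hl'⟩

/-- If some ring is balanced, there is no plan. -/
theorem no_plan (hM : I.AtMostTwo) {r₀ : R} (h₀ : r₀ ∈ U)
    (hB : I.Balanced (Function.minimalPeriod nx r₀) (orbit nx r₀) f) (plan : List R) :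
    ¬ I.Steps (I.waiting U) plan I.len :=
  (J.isRing hM h₀).no_plan_of_balanced hM hB
    (fun i => by simp [waiting, J.orbit_mem h₀ i]) plan

end Jam

section

variable [DecidableEq R] {I : MRMPGP V R}

theorem steps_waiting_of_solvable (hN : I.NonBlockingTargets) (U : Finset R) (h : I.Solvable) :
    ∃ plan, I.Steps (I.waiting U) plan I.len := by
  obtain ⟨plan, hp⟩ := h
  refine exists_plan_of_finished hN (fun r => r ∉ U) ((I.isPlanFrom_iff_steps _ _).1 hp)
    (fun _ => Nat.zero_le _) (fun r hr => ?_) (fun r hr => ?_)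
  · simp [waiting, hr]
  · simp only [not_not] at hr
    simp [waiting, hr]

theorem solvable_of_steps {σ : R → ℕ} {plan plan' : List R} (h : I.Steps (fun _ => 0) plan σ)
    (h' : I.Steps σ plan' I.len) : I.Solvable :=
  ⟨_, (I.isPlanFrom_iff_steps _ _).2 (h.append h')⟩

/-- If no robot in `U` has a clear path while the others are at their targets, there is a jam. -/
theorem exists_jam (hN : I.NonBlockingTargets) {U : Finset R}
    (hU : ∀ r ∈ U, ¬ I.HasClearPath (I.waiting U) r) : ∃ nx f, I.Jam U nx f := by
  have key : ∀ r, ∃ r' i, r ∈ U → r' ∈ U ∧ 0 < i ∧ i < I.len r ∧ I.vert r i = I.src r' := by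
    intro r
    by_cases hr : r ∈ U
    · have h1 := hU r hr
      simp only [HasClearPath] at h1
      push Not at h1
      obtain ⟨r', hne, i, hi, hil, e⟩ := h1
      have hr' : r' ∈ U := by
        by_contra h2
        rw [pos, waiting, if_neg h2, I.vert_len] at e
        exact hN r r' hne.symm (e ▸ I.onPath_vert hil)
      rw [pos, waiting, if_pos hr', I.vert_zero] at e
      refine ⟨r', i, fun _ => ⟨hr', Nat.pos_of_ne_zero ?_, hil.lt_of_ne ?_, e.symm⟩⟩
      · rintro rfl
        rw [I.vert_zero] at e
        exact hne (I.src_injective e)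
      · rintro rfl
        rw [I.vert_len] at e
        exact hN r' r hne (e ▸ I.onPath_src r')
    · exact ⟨r, 0, fun h => absurd h hr⟩
  choose nx f h using key
  exact ⟨nx, f, fun r hr => (h r hr).1, fun r hr => (h r hr).2.1, fun r hr => (h r hr).2.2.1,
    fun r hr => (h r hr).2.2.2⟩

theorem ClearedTo.exists_jam [Fintype R] (hN : I.NonBlockingTargets) {σ : R → ℕ}
    (h : I.ClearedTo σ) : ∃ U nx f, I.Jam U nx f ∧ σ = I.waiting U ∧
      ∃ plan, I.Steps (fun _ => 0) plan σ := by
  obtain ⟨h1, h2⟩ := h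
  have h3 : (∀ r, σ r = 0 ∨ σ r = I.len r) ∧ ∃ plan, I.Steps (fun _ => 0) plan σ := by
    clear h2
    induction h1 with
    | refl => exact ⟨fun _ => Or.inl rfl, [], rfl⟩
    | tail _ hs ih =>
      obtain ⟨r, hlt, hc, rfl⟩ := hs
      obtain ⟨h4, plan, hp⟩ := ih
      refine ⟨fun r' => ?_, _, hp.append (canMoveTo_of_hasClearPath hc hlt.le).steps⟩
      by_cases e : r' = r
      · right; subst e; simp
      · simpa [e] using h4 r'
  obtain ⟨h3, hp⟩ := h3
  have hσ : σ = I.waiting (Finset.univ.filter fun r => σ r < I.len r) := by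
    funext r
    simp only [waiting, Finset.mem_filter, Finset.mem_univ, true_and]
    have := h3 r
    split_ifs <;> omega
  obtain ⟨nx, f, J⟩ := MRMPGP.exists_jam hN (U := Finset.univ.filter fun r => σ r < I.len r) (by
    intro r hr hc
    rw [← hσ] at hc
    exact h2 ⟨_, r, (Finset.mem_filter.1 hr).2, hc, rfl⟩)
  exact ⟨_, nx, f, J, hσ, hp⟩

theorem exists_clearedTo [Fintype R] (I : MRMPGP V R) : ∃ σ, I.ClearedTo σ := by
  have key : ∀ n σ, (Finset.univ.filter fun r => σ r < I.len r).card = n →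
      Relation.ReflTransGen I.ClearStep (fun _ => 0) σ → ∃ σ, I.ClearedTo σ := by
    intro n
    induction n using Nat.strong_induction_on with
    | _ n ih =>
      intro σ hn hσ
      by_cases h : ∃ σ', I.ClearStep σ σ'
      · obtain ⟨σ', r, hlt, hc, rfl⟩ := h
        refine ih _ ?_ _ rfl (hσ.tail ⟨r, hlt, hc, rfl⟩)
        rw [← hn]
        refine Finset.card_lt_card (Finset.ssubset_iff_subset_ne.2 ⟨fun r' h' => ?_, fun e => ?_⟩)
        · simp only [Finset.mem_filter, Finset.mem_univ, true_and] at h' ⊢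
          by_cases e : r' = r
          · subst e; exact hlt
          · simpa [e] using h'
        · have : r ∈ Finset.univ.filter fun r => σ r < I.len r := by simp [hlt]
          rw [← e] at this
          simp at this
      · exact ⟨σ, hσ, h⟩
  exact key _ _ rfl Relation.ReflTransGen.refl

end

end MRMPGP

/-! ### Untangling the graph of a ring -/

namespace MRMPGP

variable {V R : Type*}

/-- The graph of a ring after removal of the vertices in `D`: its edges lead from a remaining vertex
of a cycle path to the next remaining one. -/
def ringGraph (I : MRMPGP V R) (ρ : ℕ → R) (f : R → ℕ) (D : Set V) : LabeledDigraph V R where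
  verts := {v | v ∉ D ∧ ∃ i a, a ≤ f (ρ i) ∧ v = I.vert (ρ i) a}
  edge r u v := ∃ i a b, r = ρ i ∧ a < b ∧ b ≤ f (ρ i) ∧ u = I.vert (ρ i) a ∧ v = I.vert (ρ i) b ∧
    u ∉ D ∧ v ∉ D ∧ ∀ c, a < c → c < b → I.vert (ρ i) c ∈ D

/-- `D` consists of vertices at inner positions. -/
def InnerSet (I : MRMPGP V R) (h : ℕ) (ρ : ℕ → R) (f : R → ℕ) (D : Set V) : Prop :=
  ∀ v ∈ D, ∃ z, Inner h ρ f z ∧ I.letter ρ z = v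

/-- The vertex `v` appears on the cycle paths number `i` and `i + m`, and on the way from its first
to its second appearance there are only vertices in `D` and sources. -/
structure Loop (I : MRMPGP V R) (h : ℕ) (ρ : ℕ → R) (f : R → ℕ) (D : Set V) (v : V) (i m a b : ℕ) :
    Prop where
  mpos : 0 < m
  mle : m ≤ h
  ne : ρ i ≠ ρ (i + m)
  apos : 0 < a
  alt : a < f (ρ i)
  bpos : 0 < b
  blt : b < f (ρ (i + m))
  va : I.vert (ρ i) a = v
  vb : I.vert (ρ (i + m)) b = v
  head : ∀ c, a < c → c < f (ρ i) → I.vert (ρ i) c ∈ D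
  body : ∀ t c, 0 < t → t < m → 0 < c → c < f (ρ (i + t)) → I.vert (ρ (i + t)) c ∈ D
  tail : ∀ c, 0 < c → c < b → I.vert (ρ (i + m)) c ∈ D

namespace IsRing

variable {I : MRMPGP V R} {h : ℕ} {ρ : ℕ → R} {f : R → ℕ} (H : I.IsRing h ρ f)
  (hM : I.AtMostTwo) {D : Set V} (hD : I.InnerSet h ρ f D)
include H

theorem inj_vert {i a b : ℕ} (ha : a ≤ f (ρ i)) (hb : b ≤ f (ρ i))
    (e : I.vert (ρ i) a = I.vert (ρ i) b) : a = b :=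
  I.vert_inj (ha.trans (H.flt i).le) (hb.trans (H.flt i).le) e

theorem edge_in_unique {r : R} {u u' v : V} (h1 : (I.ringGraph ρ f D).edge r u v)
    (h2 : (I.ringGraph ρ f D).edge r u' v) : u = u' := by
  obtain ⟨i, a, b, rfl, hab, hb, rfl, rfl, hu, hv, hc⟩ := h1
  obtain ⟨i', a', b', e, hab', hb', rfl, e', hu', -, hc'⟩ := h2
  rw [← e] at e' hc' hu' hb' ⊢
  obtain rfl := H.inj_vert hb hb' e'
  rcases lt_trichotomy a a' with h | h | h
  · exact absurd (hc a' h hab') hu'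
  · rw [h]
  · exact absurd (hc' a h hab) hu

theorem edge_out_unique {r : R} {u v v' : V} (h1 : (I.ringGraph ρ f D).edge r u v)
    (h2 : (I.ringGraph ρ f D).edge r u v') : v = v' := by
  obtain ⟨i, a, b, rfl, hab, hb, rfl, rfl, hu, hv, hc⟩ := h1
  obtain ⟨i', a', b', e, hab', hb', e', rfl, -, hv', hc'⟩ := h2
  rw [← e] at e' hc' hv' hb' ⊢
  obtain rfl := H.inj_vert (by omega) (by omega) e'
  rcases lt_trichotomy b b' with h | h | h
  · exact absurd (hc' b hab h) hv
  · rw [h]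
  · exact absurd (hc b' hab' h) hv'

theorem edge_ne {r : R} {u v : V} (h1 : (I.ringGraph ρ f D).edge r u v) : u ≠ v := by
  obtain ⟨i, a, b, rfl, hab, hb, rfl, rfl, -⟩ := h1
  intro e
  have := H.inj_vert (by omega) hb e
  omega

include hM

/-- Bypassing a vertex removes it: no third cycle path goes through it. -/
theorem bypass_eq {r r' : R} {v₀ u v₁ z w : V} (hr : r ≠ r')
    (h1 : (I.ringGraph ρ f D).edge r u v₀) (h2 : (I.ringGraph ρ f D).edge r v₀ v₁)
    (h3 : (I.ringGraph ρ f D).edge r' z v₀) (h4 : (I.ringGraph ρ f D).edge r' v₀ w) :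
    (I.ringGraph ρ f D).bypass v₀ r u v₁ r' z w = I.ringGraph ρ f (insert v₀ D) := by
  have comp : ∀ r u v, (I.ringGraph ρ f D).edge r u v₀ → (I.ringGraph ρ f D).edge r v₀ v →
      (I.ringGraph ρ f (insert v₀ D)).edge r u v := by
    rintro r u v k1 k2
    have n1 := H.edge_ne k1
    have n2 := H.edge_ne k2
    obtain ⟨i, a, b, rfl, hab, hb, rfl, rfl, hu, hv, hc⟩ := k1
    obtain ⟨i', a', b', e, hab', hb', e', rfl, -, hv', hc'⟩ := k2
    rw [← e] at e' hc' hv' hb' n2 ⊢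
    obtain rfl := H.inj_vert (by omega) (by omega) e'
    refine ⟨i, a, b', rfl, by omega, hb', rfl, rfl, ?_, ?_, fun c h5 h6 => ?_⟩
    · simp [hu, n1]
    · simp [hv', n2.symm]
    · rcases lt_trichotomy c b with h7 | h7 | h7
      · exact Or.inr (hc c h5 h7)
      · rw [h7]; exact Or.inl rfl
      · exact Or.inr (hc' c h7 h6)
  have on : ∀ r u v, (I.ringGraph ρ f D).edge r u v → I.OnPath r v := by
    rintro r u v ⟨i, a, b, rfl, hab, hb, rfl, rfl, -⟩
    exact I.onPath_vert (hb.trans (H.flt i).le)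
  unfold LabeledDigraph.bypass
  have hverts : (I.ringGraph ρ f D).verts \ {v₀} = (I.ringGraph ρ f (insert v₀ D)).verts := by
    ext v
    simp only [ringGraph, Set.mem_sdiff, Set.mem_ofPred_eq, Set.mem_singleton_iff, Set.mem_insert_iff,
      not_or]
    tauto
  have hedge : (fun ρ₁ a b => ((I.ringGraph ρ f D).edge ρ₁ a b ∧ a ≠ v₀ ∧ b ≠ v₀) ∨
      (ρ₁ = r ∧ a = u ∧ b = v₁) ∨ (ρ₁ = r' ∧ a = z ∧ b = w)) =
      (I.ringGraph ρ f (insert v₀ D)).edge := by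
    funext r₁ x y
    rw [eq_iff_iff]
    constructor
    · rintro (⟨⟨i, a, b, rfl, hab, hb, rfl, rfl, hu, hv, hc⟩, n1, n2⟩ | ⟨rfl, rfl, rfl⟩ |
        ⟨rfl, rfl, rfl⟩)
      · exact ⟨i, a, b, rfl, hab, hb, rfl, rfl, by simp [hu, n1], by simp [hv, n2],
          fun c h5 h6 => Or.inr (hc c h5 h6)⟩
      · exact comp _ _ _ h1 h2
      · exact comp _ _ _ h3 h4
    · rintro ⟨i, a, b, rfl, hab, hb, rfl, rfl, hu, hv, hc⟩
      simp only [Set.mem_insert_iff, not_or] at hu hv hc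
      by_cases hex : ∃ c, a < c ∧ c < b ∧ I.vert (ρ i) c = v₀
      · obtain ⟨c, hac, hcb, hcv⟩ := hex
        have hv₀ : v₀ ∉ D := by
          obtain ⟨_, _, _, _, _, _, _, _, _, h, _⟩ := h1
          exact h
        have k1 : (I.ringGraph ρ f D).edge (ρ i) (I.vert (ρ i) a) v₀ :=
          ⟨i, a, c, rfl, hac, by omega, rfl, hcv.symm, hu.2, hv₀, fun d h5 h6 =>
            (hc d h5 (by omega)).resolve_left fun e => by
              have := H.inj_vert (by omega) (by omega) (e.trans hcv.symm)
              omega⟩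
        have k2 : (I.ringGraph ρ f D).edge (ρ i) v₀ (I.vert (ρ i) b) :=
          ⟨i, c, b, rfl, hcb, hb, hcv.symm, rfl, hv₀, hv.2, fun d h5 h6 =>
            (hc d (by omega) h6).resolve_left fun e => by
              have := H.inj_vert (by omega) (by omega) (e.trans hcv.symm)
              omega⟩
        right
        rcases hM v₀ _ _ _ (on _ _ _ k1) (on _ _ _ h1) (on _ _ _ h3) with e | e | e
        · left
          rw [e] at k1 k2 ⊢
          exact ⟨rfl, H.edge_in_unique k1 h1, H.edge_out_unique k2 h2⟩
        · right
          rw [e] at k1 k2 ⊢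
          exact ⟨rfl, H.edge_in_unique k1 h3, H.edge_out_unique k2 h4⟩
        · exact absurd e hr
      · push Not at hex
        exact Or.inl ⟨⟨i, a, b, rfl, hab, hb, rfl, rfl, hu.2, hv.2, fun c h5 h6 =>
          (hc c h5 h6).resolve_left (hex c h5 h6)⟩, hu.1, hv.1⟩
  rw [hverts, hedge]

theorem src_unique {i j t : ℕ} (ht : t ≤ f (ρ i)) (e : I.src (ρ j) = I.vert (ρ i) t) :
    (ρ j = ρ i ∧ t = 0) ∨ (ρ j = ρ (i + 1) ∧ t = f (ρ i)) :=
  H.src_eq hM (ht.trans (H.flt i).le) e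

/-- The edge that leaves a source. -/
theorem edge_src {r : R} {i : ℕ} {v : V} (he : (I.ringGraph ρ f D).edge r (I.src (ρ i)) v) :
    r = ρ i ∧ ∃ b, 0 < b ∧ b ≤ f (ρ i) ∧ v = I.vert (ρ i) b ∧ ∀ c, 0 < c → c < b →
      I.vert (ρ i) c ∈ D := by
  obtain ⟨j, a, b, rfl, hab, hb, h1, rfl, -, -, hc⟩ := he
  rcases H.src_unique hM (by omega) h1 with ⟨h2, rfl⟩ | ⟨-, h2⟩
  · rw [h2]
    exact ⟨rfl, b, hab, hb, rfl, hc⟩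
  · omega

theorem edge_src_src {r : R} {i j : ℕ}
    (he : (I.ringGraph ρ f D).edge r (I.src (ρ i)) (I.src (ρ j))) :
    ρ j = ρ (i + 1) ∧ ∀ c, 0 < c → c < f (ρ i) → I.vert (ρ i) c ∈ D := by
  obtain ⟨rfl, b, h1, h2, h3, h4⟩ := H.edge_src hM he
  rcases H.src_unique hM h2 h3 with ⟨-, h5⟩ | ⟨h5, rfl⟩
  · omega
  · exact ⟨h5, h4⟩

include hD

theorem src_notMem (i : ℕ) : I.src (ρ i) ∉ D := by
  intro hi
  obtain ⟨z, ⟨h1, h2, h3⟩, hz⟩ := hD _ hi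
  rcases H.src_unique hM h3.le hz.symm with ⟨-, h4⟩ | ⟨-, h4⟩ <;> omega

theorem exists_prev {i a : ℕ} (ha : 0 < a) :
    ∃ c < a, I.vert (ρ i) c ∉ D ∧ ∀ d, c < d → d < a → I.vert (ρ i) d ∈ D := by
  induction a with
  | zero => omega
  | succ a ih =>
    by_cases h1 : I.vert (ρ i) a ∈ D
    · have h2 : 0 < a := by
        rcases Nat.eq_zero_or_pos a with rfl | h2
        · rw [I.vert_zero] at h1
          exact absurd h1 (H.src_notMem hM hD i)
        · exact h2
      obtain ⟨c, hc, h3, h4⟩ := ih h2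
      refine ⟨c, by omega, h3, fun d h5 h6 => ?_⟩
      rcases (Nat.lt_succ_iff.1 h6).lt_or_eq with h7 | h7
      · exact h4 d h5 h7
      · rw [h7]; exact h1
    · exact ⟨a, Nat.lt_succ_self a, h1, fun d _ _ => by omega⟩

theorem exists_next {i a : ℕ} (ha : a < f (ρ i)) :
    ∃ c, a < c ∧ c ≤ f (ρ i) ∧ I.vert (ρ i) c ∉ D ∧ ∀ d, a < d → d < c → I.vert (ρ i) d ∈ D := by
  have hf : I.vert (ρ i) (f (ρ i)) ∉ D := by
    rw [H.hit]; exact H.src_notMem hM hD _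
  induction hn : f (ρ i) - a generalizing a with
  | zero => omega
  | succ n ih =>
    by_cases h1 : I.vert (ρ i) (a + 1) ∈ D
    · have h2 : a + 1 < f (ρ i) := by
        refine lt_of_le_of_ne ha fun e => hf ?_
        rwa [← e]
      obtain ⟨c, hc, h3, h4, h5⟩ := ih h2 (by omega)
      refine ⟨c, by omega, h3, h4, fun d h6 h7 => ?_⟩
      rcases (Nat.succ_le_iff.2 h6).lt_or_eq with h8 | h8
      · exact h5 d h8 h7
      · rw [← h8]; exact h1
    · exact ⟨a + 1, Nat.lt_succ_self a, ha, h1, fun d _ _ => by omega⟩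

theorem isStart_iff (v : V) : (I.ringGraph ρ f D).IsStart v ↔ ∃ i, v = I.src (ρ i) := by
  constructor
  · rintro ⟨r, ⟨w, i, a, b, rfl, hab, hb, rfl, rfl, hu, hv, hc⟩, hno⟩
    rcases Nat.eq_zero_or_pos a with rfl | ha
    · exact ⟨i, I.vert_zero _⟩
    · obtain ⟨c, hca, hcD, hcd⟩ := H.exists_prev hM hD (i := i) ha
      exact absurd ⟨i, c, a, rfl, hca, by omega, rfl, rfl, hcD, hu, hcd⟩ (hno _)
  · rintro ⟨i, rfl⟩
    refine ⟨ρ i, ?_, ?_⟩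
    · obtain ⟨c, h1, h2, h3, h4⟩ := H.exists_next hM hD (H.fpos i)
      exact ⟨_, i, 0, c, rfl, h1, h2, (I.vert_zero _).symm, rfl, H.src_notMem hM hD i, h3, h4⟩
    · rintro u ⟨j, a, b, e, hab, hb, rfl, h1, -⟩
      rcases H.src_unique hM hb h1 with ⟨-, h2⟩ | ⟨h2, -⟩
      · omega
      · rw [e] at h2
        exact H.succ_ne j h2.symm

/-- Untangling removes a vertex whose appearances are the ends of a loop. -/
theorem untangle {G : LabeledDigraph V R} (hU : (I.ringGraph ρ f D).Untangle G) :
    ∃ v₀ i m a b, v₀ ∉ D ∧ Loop I h ρ f D v₀ i m a b ∧ G = I.ringGraph ρ f (insert v₀ D) := by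
  obtain ⟨k, c, r, r', u, w, hcyc, hns, hst, hr, h1, h2, h3, h4, rfl⟩ := hU
  have hstart : ∀ t : Fin (k + 1), t ≠ 0 → ∃ i, c t = I.src (ρ i) :=
    fun t ht => (H.isStart_iff hM hD _).1 (hst t ht)
  have hk : 0 < k := by
    rcases Nat.eq_zero_or_pos k with rfl | hk
    · have : (0 : Fin (0 + 1)) + 1 = 0 := rfl
      rw [this] at h2
      exact absurd rfl (H.edge_ne h2)
    · exact hk
  have hv : c 0 ∉ D := (hcyc.2 0).1.1
  refine ⟨c 0, ?_⟩
  have h1' := h1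
  obtain ⟨i, a', a, rfl, haa, haf, -, hca, -, -, -⟩ := h1'
  have hne : ∀ j, c 0 ≠ I.src (ρ j) := fun j e => hns ((H.isStart_iff hM hD _).2 ⟨j, e⟩)
  have haf' : a < f (ρ i) := by
    refine haf.lt_of_ne fun e => hne (i + 1) ?_
    rw [hca, e, H.hit]
  have hone : ∀ t (ht : t < k + 1) (ht' : t + 1 < k + 1), (⟨t, ht⟩ : Fin (k + 1)) + 1 = ⟨t + 1, ht'⟩ :=
    fun t ht ht' => by
      apply Fin.ext
      simp only [Fin.val_add, Fin.val_one']
      rw [Nat.mod_eq_of_lt (a := 1) (by omega), Nat.mod_eq_of_lt ht']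
  have hzero : (0 : Fin (k + 1)) = ⟨0, by omega⟩ := rfl
  -- The edge `(v₀, v₁)` is the last one of its path.
  have hfirst : c ⟨1, by omega⟩ = I.src (ρ (i + 1)) ∧
      ∀ d, a < d → d < f (ρ i) → I.vert (ρ i) d ∈ D := by
    rw [hzero, hone 0 (by omega) (by omega)] at h2
    obtain ⟨j, hj⟩ := hstart ⟨1, by omega⟩ (by simp [Fin.ext_iff])
    obtain ⟨i', b, b', e, hb, hbf, e1, e2, -, -, hd⟩ := h2
    simp only [zero_add] at e2
    rw [← e] at hbf e1 e2 hd
    have e3 : a = b := H.inj_vert haf (by omega) (hca.symm.trans e1)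
    subst e3
    rw [hj] at e2
    rcases H.src_unique hM hbf e2 with ⟨-, e4⟩ | ⟨e4, rfl⟩
    · omega
    · exact ⟨by rw [hj, e4], hd⟩
  have hall : ∀ t (ht : t < k + 1), 0 < t → c ⟨t, ht⟩ = I.src (ρ (i + t)) ∧
      ∀ t', 0 < t' → t' < t → ∀ d, 0 < d → d < f (ρ (i + t')) → I.vert (ρ (i + t')) d ∈ D := by
    intro t
    induction t with
    | zero => intro _ h; omega
    | succ t ih =>
      intro ht _
      rcases Nat.eq_zero_or_pos t with rfl | ht0
      · exact ⟨hfirst.1, fun t' _ _ => by omega⟩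
      · obtain ⟨e1, e2⟩ := ih (by omega) ht0
        obtain ⟨r₁, hr₁⟩ := (hcyc.2 ⟨t, by omega⟩).2
        obtain ⟨j, hj⟩ := hstart ⟨t + 1, ht⟩ (by simp [Fin.ext_iff])
        rw [hone t (by omega) ht, e1, hj] at hr₁
        obtain ⟨e3, e4⟩ := H.edge_src_src hM hr₁
        refine ⟨by rw [hj, e3, Nat.add_assoc], fun t' h5 h6 => ?_⟩
        rcases (Nat.lt_succ_iff.1 h6).lt_or_eq with h7 | h7
        · exact e2 t' h5 h7
        · rw [h7]; exact e4
  obtain ⟨e1, e2⟩ := hall k (by omega) hk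
  have h3' := h3
  rw [show Fin.last k = ⟨k, by omega⟩ from rfl, e1] at h3'
  obtain ⟨rfl, b, hb0, hbf, hb, hbD⟩ := H.edge_src hM h3'
  refine ⟨i, k, a, b, hv, ⟨hk, ?_, hr, by omega, haf', hb0, ?_, hca.symm, hb.symm, hfirst.2,
    fun t c ht ht' => e2 t ht ht' c, hbD⟩, H.bypass_eq hM hr h1 h2 h3 h4⟩
  · by_contra hlt
    have e5 := (hall 1 (by omega) (by omega)).1
    have e6 := (hall (1 + h) (by omega) (by omega)).1
    rw [← Nat.add_assoc, H.per, ← e5] at e6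
    have e7 : 1 + h = 1 := congrArg Fin.val (hcyc.1 e6)
    have := H.pos
    omega
  · refine hbf.lt_of_ne fun e => hne (i + k + 1) ?_
    rw [hb, e, H.hit]

omit hD in
/-- A vertex crossed by another remaining vertex is not the end of a loop, since every loop between
its two appearances passes the other vertex. -/
theorem not_loop_of_crossing {v₀ : V} {i m a b : ℕ} (hl : Loop I h ρ f D v₀ i m a b)
    {p q z z' : ℕ × ℕ} (hp : Inner h ρ f p) (hq : Inner h ρ f q) (hz : Inner h ρ f z)
    (hz' : Inner h ρ f z') (hpz : Before p z) (hzq : Before z q)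
    (ho : Before z' p ∨ Before q z') (hzD : I.letter ρ z ∉ D) (hzD' : I.letter ρ z' ∉ D)
    (hpq : I.letter ρ p = I.letter ρ q) : v₀ ≠ I.letter ρ p := by
  rintro rfl
  obtain ⟨mpos, mle, ne, apos, alt, bpos, blt, va, vb, head, body, tail⟩ := hl
  obtain ⟨i₀, hi₀, hii⟩ := H.exists_lt i
  have shift : ∀ t, ρ (i + t) = ρ (i₀ + t) := by
    intro t
    induction t with
    | zero => exact hii.symm
    | succ t ih => exact H.succ_eq ih
  simp only [shift] at ne blt vb body tail
  rw [← hii] at ne alt va head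
  have hA : Inner h ρ f (i₀, a) := ⟨hi₀, apos, alt⟩
  obtain ⟨j, hj, hjj, hjm⟩ : ∃ j < h, ρ j = ρ (i₀ + m) ∧ (j = i₀ + m ∨ j + h = i₀ + m) := by
    rcases lt_or_ge (i₀ + m) h with h8 | h8
    · exact ⟨_, h8, rfl, Or.inl rfl⟩
    · obtain ⟨j, hj⟩ := Nat.exists_eq_add_of_le' h8
      refine ⟨j, by omega, by rw [hj, H.per], Or.inr hj.symm⟩
  have hB : Inner h ρ f (j, b) := ⟨hj, bpos, by rw [hjj]; exact blt⟩
  have hAv : I.letter ρ (i₀, a) = I.letter ρ p := va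
  have hBv : I.letter ρ (j, b) = I.letter ρ p := by
    rw [← vb, ← hjj]; rfl
  have hAB : (i₀, a) ≠ (j, b) := by
    intro e
    rw [Prod.ext_iff] at e
    simp only at e
    exact ne ((congrArg ρ e.1).trans hjj)
  have hpqne : p ≠ q := by
    rintro rfl
    simp only [Before] at hpz hzq
    omega
  have hcase : ((i₀, a) = p ∧ (j, b) = q) ∨ ((i₀, a) = q ∧ (j, b) = p) := by
    rcases H.letter_two hM hA hp hq hAv (hAv.trans hpq) with e | e | e
    · rcases H.letter_two hM hB hp hq hBv (hBv.trans hpq) with e' | e' | e'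
      · exact absurd (e.trans e'.symm) hAB
      · exact Or.inl ⟨e, e'⟩
      · exact absurd e' hpqne
    · rcases H.letter_two hM hB hp hq hBv (hBv.trans hpq) with e' | e' | e'
      · exact Or.inr ⟨e, e'⟩
      · exact absurd (e.trans e'.symm) hAB
      · exact absurd e' hpqne
    · exact absurd e hpqne
  obtain ⟨z1, z2⟩ := z
  obtain ⟨z1', z2'⟩ := z'
  obtain ⟨hz1, hz2, hz3⟩ := hz
  obtain ⟨hz1', hz2', hz3'⟩ := hz'
  simp only [letter] at hz1 hz2 hz3 hz1' hz2' hz3' hzD hzD'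
  -- The loop passes all positions between its ends.
  have way : ∀ z1 z2, z1 < h → 0 < z2 → z2 < f (ρ z1) →
      (z1 = i₀ ∧ a < z2 ∨ i₀ < z1 ∧ z1 < i₀ + m ∨ z1 = i₀ + m ∧ z2 < b ∨ z1 + h < i₀ + m ∨
        z1 + h = i₀ + m ∧ z2 < b) → i₀ ≠ j → I.vert (ρ z1) z2 ∈ D := by
    rintro z1 z2 k1 k2 k3 (⟨rfl, k4⟩ | ⟨k4, k5⟩ | ⟨k4, k5⟩ | k4 | ⟨k4, k5⟩) k6
    · exact head _ k4 k3
    · obtain ⟨t, rfl⟩ := Nat.exists_eq_add_of_lt k4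
      exact body (t + 1) z2 (by omega) (by omega) k2 k3
    · rw [k4]; exact tail z2 k2 k5
    · have e : ρ z1 = ρ (i₀ + (z1 + h - i₀)) := by
        rw [show i₀ + (z1 + h - i₀) = z1 + h by omega, H.per]
      rw [e] at k3 ⊢
      exact body _ z2 (by omega) (by omega) k2 k3
    · have e : ρ z1 = ρ (i₀ + m) := by rw [← k4, H.per]
      rw [e]; exact tail z2 k2 k5
  have hij : i₀ ≠ j := by
    rintro rfl
    exact ne hjj
  rcases hcase with ⟨rfl, rfl⟩ | ⟨rfl, rfl⟩
  · refine hzD (way z1 z2 hz1 hz2 hz3 ?_ hij)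
    simp only [Before] at hpz hzq
    omega
  · refine hzD' (way z1' z2' hz1' hz2' hz3' ?_ hij)
    simp only [Before] at hpz hzq ho
    omega

/-- A cycle of start vertices runs through the whole ring, so all inner vertices are removed. -/
theorem mem_of_hasStartCycle (hS : (I.ringGraph ρ f D).HasStartCycle) (z : ℕ × ℕ)
    (hz : Inner h ρ f z) : I.letter ρ z ∈ D := by
  obtain ⟨k, c, hcyc, hst⟩ := hS
  obtain ⟨i, hi⟩ := (H.isStart_iff hM hD _).1 (hst 0)
  have key : ∀ t, c (Fin.ofNat (k + 1) t) = I.src (ρ (i + t)) ∧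
      ∀ d, 0 < d → d < f (ρ (i + t)) → I.vert (ρ (i + t)) d ∈ D := by
    have hnext : ∀ t, c (Fin.ofNat (k + 1) t) = I.src (ρ (i + t)) →
        c (Fin.ofNat (k + 1) (t + 1)) = I.src (ρ (i + t + 1)) ∧
        ∀ d, 0 < d → d < f (ρ (i + t)) → I.vert (ρ (i + t)) d ∈ D := by
      intro t ht
      obtain ⟨r, hr⟩ := (hcyc.2 (Fin.ofNat (k + 1) t)).2
      obtain ⟨j, hj⟩ := (H.isStart_iff hM hD _).1 (hst (Fin.ofNat (k + 1) t + 1))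
      rw [ht, hj] at hr
      obtain ⟨e1, e2⟩ := H.edge_src_src hM hr
      refine ⟨?_, e2⟩
      rw [← e1, ← hj]
      congr 1
      apply Fin.ext
      simp [Fin.val_add]
    have h1 : ∀ t, c (Fin.ofNat (k + 1) t) = I.src (ρ (i + t)) := by
      intro t
      induction t with
      | zero => exact hi
      | succ t ih => exact (hnext t ih).1
    exact fun t => ⟨h1 t, (hnext t (h1 t)).2⟩
  have h1 := H.pos
  have h2 : i ≤ h * i := Nat.le_mul_of_pos_left i h1
  have e : ρ (i + (z.1 + h * i - i)) = ρ z.1 := by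
    rw [show i + (z.1 + h * i - i) = z.1 + h * i by omega, H.eq_iff, Nat.add_mul_mod_self_left]
  have := (key (z.1 + h * i - i)).2 z.2 hz.2.1 (by rw [e]; exact hz.2.2)
  rwa [e] at this

end IsRing

end MRMPGP

namespace MRMPGP

variable {V R : Type*}

namespace IsRing

variable {I : MRMPGP V R} {h : ℕ} {ρ : ℕ → R} {f : R → ℕ} (H : I.IsRing h ρ f)
  (hM : I.AtMostTwo)
include H

theorem fin_add_one (t : Fin (h - 1 + 1)) : ρ ((t + 1 : Fin (h - 1 + 1)) : ℕ) = ρ (t + 1) := by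
  have := H.pos
  rw [H.eq_iff, Fin.val_add, Fin.val_one']
  generalize (t : ℕ) = a
  rw [Nat.sub_add_cancel this]
  simp

theorem untangle_innerSet {D : Set V} (hD : I.InnerSet h ρ f D) {v : V} {i m a b : ℕ}
    (hl : Loop I h ρ f D v i m a b) : I.InnerSet h ρ f (insert v D) := by
  rintro w (rfl | hw)
  · obtain ⟨j, hj, e⟩ := H.exists_lt i
    refine ⟨(j, a), ⟨hj, hl.apos, ?_⟩, ?_⟩
    · simp only [e]; exact hl.alt
    · rw [letter, e]; exact hl.va
  · exact hD w hw

include hM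

/-- Whatever arises by untangling is again given by a set of removed vertices. -/
theorem exists_of_reflTransGen {G : LabeledDigraph V R}
    (hG : Relation.ReflTransGen LabeledDigraph.Untangle (I.ringGraph ρ f ∅) G) :
    ∃ D, I.InnerSet h ρ f D ∧ G = I.ringGraph ρ f D := by
  induction hG with
  | refl => exact ⟨∅, fun v hv => hv.elim, rfl⟩
  | tail _ hs ih =>
    obtain ⟨D, hD, rfl⟩ := ih
    obtain ⟨v, i, m, a, b, -, hl, rfl⟩ := H.untangle hM hD hs
    exact ⟨_, H.untangle_innerSet hD hl, rfl⟩

/-- Vertices that cross are never removed, hence no cycle of start vertices appears. -/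
theorem not_hasStartCycle_of_crossing {p y q y' : ℕ × ℕ} (hp : Inner h ρ f p)
    (hy : Inner h ρ f y) (hq : Inner h ρ f q) (hy' : Inner h ρ f y') (h1 : Before p y)
    (h2 : Before y q) (h3 : Before q y') (e1 : I.letter ρ p = I.letter ρ q)
    (e2 : I.letter ρ y = I.letter ρ y') {G : LabeledDigraph V R}
    (hG : Relation.ReflTransGen LabeledDigraph.Untangle (I.ringGraph ρ f ∅) G) :
    ¬ G.HasStartCycle := by
  have key : ∃ D, I.InnerSet h ρ f D ∧ G = I.ringGraph ρ f D ∧ I.letter ρ p ∉ D ∧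
      I.letter ρ y ∉ D := by
    induction hG with
    | refl => exact ⟨∅, fun v hv => hv.elim, rfl, fun hv => hv, fun hv => hv⟩
    | tail _ hs ih =>
      obtain ⟨D, hD, rfl, hpD, hyD⟩ := ih
      obtain ⟨v, i, m, a, b, -, hl, rfl⟩ := H.untangle hM hD hs
      have n1 := H.not_loop_of_crossing hM hl hp hq hy hy' h1 h2 (Or.inr h3) hyD (e2 ▸ hyD) e1
      have n2 := H.not_loop_of_crossing hM hl hy hy' hq hp h2 h3 (Or.inl h1) (e1 ▸ hpD) hpD e2
      exact ⟨_, H.untangle_innerSet hD hl, rfl, by simp [n1.symm, hpD], by simp [n2.symm, hyD]⟩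
  obtain ⟨D, hD, rfl, hpD, -⟩ := key
  exact fun hS => hpD (H.mem_of_hasStartCycle hM hD hS p hp)

/-- Untangling comes to an end. -/
theorem exists_untanglesTo [Finite V] : ∃ G, (I.ringGraph ρ f ∅).UntanglesTo G := by
  have key : ∀ n D, I.InnerSet h ρ f D → Dᶜ.ncard = n →
      Relation.ReflTransGen LabeledDigraph.Untangle (I.ringGraph ρ f ∅) (I.ringGraph ρ f D) →
      ∃ G, (I.ringGraph ρ f ∅).UntanglesTo G := by
    intro n
    induction n using Nat.strong_induction_on with
    | _ n ih =>
      intro D hD hn hG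
      by_cases hex : ∃ G, (I.ringGraph ρ f D).Untangle G
      · obtain ⟨G, hs⟩ := hex
        obtain ⟨v, i, m, a, b, hv, hl, rfl⟩ := H.untangle hM hD hs
        refine ih _ ?_ _ (H.untangle_innerSet hD hl) rfl (hG.tail hs)
        rw [← hn]
        refine Set.ncard_lt_ncard ⟨Set.compl_subset_compl.2 (Set.subset_insert _ _), fun hsub => ?_⟩
          (Set.toFinite _)
        exact hsub hv (Set.mem_insert _ _)
      · exact ⟨_, hG, hex⟩
  exact key _ ∅ (fun v hv => hv.elim) rfl Relation.ReflTransGen.refl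

/-- The graph of a balanced ring is untangled completely: as long as inner vertices are left, an
innermost pair of partners gives a cycle that can be untangled. -/
theorem hasStartCycle_of_balanced (hB : I.Balanced h ρ f) {G : LabeledDigraph V R}
    (hG : (I.ringGraph ρ f ∅).UntanglesTo G) : G.HasStartCycle := by
  obtain ⟨D, hD, rfl⟩ := H.exists_of_reflTransGen hM hG.1
  have hend := hG.2
  have hpos := H.pos
  by_cases hall : ∀ z, Inner h ρ f z → I.letter ρ z ∈ D
  · refine ⟨h - 1, fun t => I.src (ρ t), ⟨fun s t e => ?_, fun t => ⟨⟨H.src_notMem hM hD _, t, 0,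
      Nat.zero_le _, (I.vert_zero _).symm⟩, ρ t, t, 0, f (ρ t), rfl, H.fpos t, le_rfl,
      (I.vert_zero _).symm, ?_, H.src_notMem hM hD _, H.src_notMem hM hD _, fun c hc hcf => ?_⟩⟩,
      fun t => (H.isStart_iff hM hD _).2 ⟨t, rfl⟩⟩
    · exact Fin.ext (H.inj _ _ (by omega) (by omega) (I.src_injective e))
    · rw [H.hit]
      exact congrArg I.src (H.fin_add_one t)
    · exact hall (t, c) ⟨by omega, hc, hcf⟩
  exfalso
  refine hend ?_
  push Not at hall
  obtain ⟨z, hz, hzD⟩ := hall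
  -- Choose partners with no remaining vertex in between.
  obtain ⟨q, ⟨hq, hqD, p, hp, hpq, he⟩, hmin⟩ := Before.wf.has_min
    {q | Inner h ρ f q ∧ I.letter ρ q ∉ D ∧ ∃ p, Inner h ρ f p ∧ Before p q ∧
      I.letter ρ p = I.letter ρ q} (by
    obtain ⟨z', hz', hne, e⟩ := hB.partner z hz
    rcases Before.trichotomy z z' with h1 | h1 | h1
    · exact ⟨z', hz', by rwa [e], z, hz, h1, e.symm⟩
    · exact absurd h1.symm hne
    · exact ⟨z, hz, hzD, z', hz', h1, e⟩)
  have hbetween : ∀ y, Inner h ρ f y → Before p y → Before y q → I.letter ρ y ∈ D := by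
    intro y hy h1 h2
    by_contra hyD
    obtain ⟨y', hy', hne, e, h3, h4⟩ := hB.nested p q y hp hq hy he h1 h2
    rcases Before.trichotomy y y' with h5 | h5 | h5
    · exact hmin y' ⟨hy', by rwa [e], y, hy, h5, e.symm⟩ h4
    · exact hne h5.symm
    · exact hmin y ⟨hy, hyD, y', hy', h5, e⟩ h2
  have hpqne : p ≠ q := by
    rintro rfl
    simp only [Before] at hpq
    omega
  have hfst := H.fst_ne hp hq he hpqne
  obtain ⟨i, a⟩ := p
  obtain ⟨j, b⟩ := q
  obtain ⟨hi, ha, haf⟩ := hp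
  obtain ⟨hj, hb, hbf⟩ := hq
  simp only [Before] at hpq
  simp only at hi ha haf hj hb hbf hfst
  have hij : i < j := by omega
  have hv : I.vert (ρ i) a = I.vert (ρ j) b := he
  have hvD : I.vert (ρ i) a ∉ D := by rw [hv]; exact hqD
  have hhead : ∀ c, a < c → c < f (ρ i) → I.vert (ρ i) c ∈ D := fun c h1 h2 =>
    hbetween (i, c) ⟨hi, by simp only; omega, h2⟩ (Or.inr ⟨rfl, h1⟩) (Or.inl hij)
  have hbody : ∀ t c, i < t → t < j → 0 < c → c < f (ρ t) → I.vert (ρ t) c ∈ D :=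
    fun t c h1 h2 h3 h4 => hbetween (t, c) ⟨by simp only; omega, h3, h4⟩ (Or.inl h1) (Or.inl h2)
  have htail : ∀ c, 0 < c → c < b → I.vert (ρ j) c ∈ D := fun c h1 h2 =>
    hbetween (j, c) ⟨hj, h1, h2.trans hbf⟩ (Or.inl hij) (Or.inr ⟨rfl, h2⟩)
  have hns : ∀ k, I.vert (ρ i) a ≠ I.src (ρ k) := by
    intro k e
    rcases H.src_unique hM haf.le e.symm with ⟨-, h1⟩ | ⟨-, h1⟩ <;> omega
  have hsD := fun k => H.src_notMem hM hD k
  obtain ⟨a', ha', haD', hpre⟩ := H.exists_prev hM hD (i := i) ha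
  obtain ⟨b', hbb', hbf', hbD', hpost⟩ := H.exists_next hM hD hbf
  -- The edges between successive sources, where nothing is left in between.
  have hE : ∀ k, i < k → k < j →
      (I.ringGraph ρ f D).edge (ρ k) (I.src (ρ k)) (I.src (ρ (k + 1))) := fun k h1 h2 =>
    ⟨k, 0, f (ρ k), rfl, H.fpos k, le_rfl, (I.vert_zero _).symm, (H.hit k).symm, hsD _, hsD _,
      fun c h3 h4 => hbody k c h1 h2 h3 h4⟩
  have hE0 : (I.ringGraph ρ f D).edge (ρ i) (I.vert (ρ i) a) (I.src (ρ (i + 1))) :=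
    ⟨i, a, f (ρ i), rfl, haf, le_rfl, rfl, (H.hit i).symm, hvD, hsD _, hhead⟩
  have hEl : (I.ringGraph ρ f D).edge (ρ j) (I.src (ρ j)) (I.vert (ρ i) a) :=
    ⟨j, 0, b, rfl, hb, hbf.le, (I.vert_zero _).symm, hv, hsD _, hvD, htail⟩
  set m := j - i with hm
  set c : Fin (m + 1) → V := fun t => if t = 0 then I.vert (ρ i) a else I.src (ρ (i + t)) with hc
  have hc0 : c 0 = I.vert (ρ i) a := by simp [hc]
  have hcs : ∀ t : Fin (m + 1), t ≠ 0 → c t = I.src (ρ (i + t)) := fun t ht => by simp [hc, ht]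
  have hlast : Fin.last m ≠ 0 := by simp [Fin.ext_iff]; omega
  have hcl : c (Fin.last m) = I.src (ρ j) := by
    rw [hcs _ hlast]
    congr 2
    simp only [Fin.val_last]; omega
  have hsucc : ∀ t : Fin (m + 1), t ≠ Fin.last m → ((t + 1 : Fin (m + 1)) : ℕ) = t + 1 := by
    intro t ht
    exact Fin.val_add_one_of_lt (Fin.lt_last_iff_ne_last.2 ht)
  have hcn : ∀ t : Fin (m + 1), t ≠ Fin.last m → c (t + 1) = I.src (ρ (i + t + 1)) := by
    intro t ht
    have h1 := hsucc t ht
    rw [hcs, h1, Nat.add_assoc]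
    intro h2
    rw [h2] at h1
    simp at h1
  have hz : (0 : Fin (m + 1)) ≠ Fin.last m := hlast.symm
  have hc1 : c (0 + 1) = I.src (ρ (i + 1)) := by rw [hcn 0 hz]; simp
  refine ⟨_, m, c, ρ i, ρ j, I.vert (ρ i) a', I.vert (ρ j) b', ⟨?_, fun t => ⟨?_, ?_⟩⟩, ?_, ?_, ?_,
    ?_, ?_, ?_, ?_, rfl⟩
  · intro s t e
    by_cases hs : s = 0 <;> by_cases ht : t = 0
    · rw [hs, ht]
    · rw [hs, hc0, hcs t ht] at e
      exact absurd e (hns _)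
    · rw [ht, hc0, hcs s hs] at e
      exact absurd e.symm (hns _)
    · rw [hcs s hs, hcs t ht] at e
      have := H.inj _ _ (by omega) (by omega) (I.src_injective e)
      exact Fin.ext (by omega)
  · by_cases ht : t = 0
    · rw [ht, hc0]
      exact ⟨hvD, i, a, haf.le, rfl⟩
    · rw [hcs t ht]
      exact ⟨hsD _, i + t, 0, Nat.zero_le _, (I.vert_zero _).symm⟩
  · by_cases hl : t = Fin.last m
    · refine ⟨ρ j, ?_⟩
      rw [hl, hcl, Fin.last_add_one, hc0]
      exact hEl
    · by_cases ht : t = 0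
      · subst ht
        rw [hc0, hc1]
        exact ⟨_, hE0⟩
      · rw [hcs t ht, hcn t hl]
        have h1 : (t : ℕ) ≠ 0 := fun h => ht (Fin.ext h)
        have h2 : (t : ℕ) ≠ m := fun h => hl (Fin.ext h)
        exact ⟨_, hE _ (by omega) (by omega)⟩
  · rw [hc0, H.isStart_iff hM hD]
    exact fun ⟨k, hk⟩ => hns k hk
  · intro t ht
    rw [hcs t ht, H.isStart_iff hM hD]
    exact ⟨_, rfl⟩
  · exact fun e => hij.ne (H.inj _ _ hi hj e)
  · rw [hc0]
    exact ⟨i, a', a, rfl, ha', haf.le, rfl, rfl, haD', hvD, hpre⟩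
  · rw [hc0, hc1]; exact hE0
  · rw [hcl, hc0]; exact hEl
  · rw [hc0]
    exact ⟨j, b, b', rfl, hbb', hbf', hv, rfl, hvD, hbD', hpost⟩

end IsRing

/-! ### Blocking cycles -/

namespace Jam

variable [DecidableEq R] {I : MRMPGP V R} {U : Finset R} {nx : R → R} {f : R → ℕ}
  (J : I.Jam U nx f) (hM : I.AtMostTwo) (hN : I.NonBlockingTargets)
include J hM hN

theorem blockedBy_iff {r r' : R} : I.BlockedBy (I.waiting U) r r' ↔ r ∈ U ∧ r' = nx r := by
  constructor
  · rintro ⟨hne, i, hi, hil, e⟩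
    have hr' : r' ∈ U := by
      by_contra h1
      rw [pos, waiting, if_neg h1, I.vert_len] at e
      exact hN r r' hne.symm (e ▸ I.onPath_vert hil)
    rw [pos, waiting, if_pos hr', I.vert_zero] at e
    rcases J.src_eq hM hr' hil e with ⟨h1, -⟩ | ⟨h1, h2, -⟩
    · exact absurd h1 hne
    · exact ⟨h1, h2⟩
  · rintro ⟨hr, rfl⟩
    refine ⟨J.nx_ne hr, f r, ?_, (J.flt r hr).le, ?_⟩
    · simp [waiting, hr]
    · simp [pos, waiting, J.mem r hr, J.hit r hr, I.vert_zero]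

theorem robot_mem (C : I.BlockingCycle (I.waiting U)) (i : Fin (C.k + 1)) : C.robot i ∈ U :=
  ((J.blockedBy_iff hM hN).1 (C.blocked i)).1

theorem robot_succ (C : I.BlockingCycle (I.waiting U)) (i : Fin (C.k + 1)) :
    C.robot (i + 1) = nx (C.robot i) :=
  ((J.blockedBy_iff hM hN).1 (C.blocked i)).2

theorem orbit_eq_robot (C : I.BlockingCycle (I.waiting U)) (i : ℕ) :
    orbit nx (C.robot 0) i = C.robot (Fin.ofNat (C.k + 1) i) := by
  induction i with
  | zero => rfl
  | succ i ih =>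
    rw [orbit_succ, ih, ← J.robot_succ hM hN C]
    congr 1
    apply Fin.ext
    simp [Fin.val_add]

theorem orbit_val (C : I.BlockingCycle (I.waiting U)) (i : Fin (C.k + 1)) :
    orbit nx (C.robot 0) i = C.robot i := by
  rw [J.orbit_eq_robot hM hN]
  congr 1
  exact Fin.ext (Nat.mod_eq_of_lt i.2)

theorem minimalPeriod_eq (C : I.BlockingCycle (I.waiting U)) :
    Function.minimalPeriod nx (C.robot 0) = C.k + 1 := by
  have h1 : Function.IsPeriodicPt nx (C.k + 1) (C.robot 0) := by
    have := J.orbit_eq_robot hM hN C (C.k + 1)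
    rw [show Fin.ofNat (C.k + 1) (C.k + 1) = 0 from Fin.ext (by simp)] at this
    exact this
  refine le_antisymm (h1.minimalPeriod_le (Nat.succ_pos _)) (not_lt.1 fun hlt => ?_)
  have h2 := h1.minimalPeriod_pos (Nat.succ_pos _)
  have h3 := J.orbit_val hM hN C ⟨_, hlt⟩
  have h4 : orbit nx (C.robot 0) (Function.minimalPeriod nx (C.robot 0)) = C.robot 0 :=
    Function.iterate_minimalPeriod
  have h5 := congrArg Fin.val (C.injective (h4.symm.trans h3))
  simp only [Fin.val_zero] at h5
  omega

/-- The blocking cycle that contains a waiting robot. -/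
theorem exists_blockingCycle {r₀ : R} (h₀ : r₀ ∈ U) :
    ∃ C : I.BlockingCycle (I.waiting U), C.robot 0 = r₀ := by
  have H := J.isRing hM h₀
  have hpos := H.pos
  refine ⟨⟨Function.minimalPeriod nx r₀ - 1, fun i => orbit nx r₀ i, fun i j e => ?_, fun i => ?_⟩,
    rfl⟩
  · exact Fin.ext (H.inj _ _ (by omega) (by omega) e)
  · refine (J.blockedBy_iff hM hN).2 ⟨J.orbit_mem h₀ _, ?_⟩
    rw [← orbit_succ nx r₀]
    exact H.fin_add_one i

theorem isRing_of_cycle (C : I.BlockingCycle (I.waiting U)) :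
    I.IsRing (C.k + 1) (orbit nx (C.robot 0)) f := by
  have h := J.isRing hM (J.robot_mem hM hN C 0)
  rwa [J.minimalPeriod_eq hM hN C] at h

theorem hits_iff (C : I.BlockingCycle (I.waiting U)) (i : Fin (C.k + 1)) (b : ℕ) :
    b ≤ I.len (C.robot i) ∧ I.vert (C.robot i) b = I.pos (I.waiting U) (C.robot (i + 1)) ↔
      b = f (C.robot i) := by
  have h1 := J.robot_mem hM hN C i
  have h2 := J.robot_mem hM hN C (i + 1)
  rw [pos, waiting, if_pos h2, I.vert_zero, J.robot_succ hM hN C, ← J.hit _ h1]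
  constructor
  · rintro ⟨h3, h4⟩
    exact I.vert_inj h3 (J.flt _ h1).le h4
  · rintro rfl
    exact ⟨(J.flt _ h1).le, rfl⟩

theorem onCyclePath_iff (C : I.BlockingCycle (I.waiting U)) (i : Fin (C.k + 1)) (v : V) :
    C.OnCyclePath i v ↔ ∃ a ≤ f (C.robot i), v = I.vert (C.robot i) a := by
  constructor
  · rintro ⟨a, b, -, hab, hb, e, rfl⟩
    rw [(J.hits_iff hM hN C i b).1 ⟨hb, e⟩] at hab
    exact ⟨a, hab, rfl⟩
  · rintro ⟨a, ha, rfl⟩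
    have := (J.hits_iff hM hN C i _).2 rfl
    exact ⟨a, _, by simp [waiting, J.robot_mem hM hN C i], ha, this.1, this.2, rfl⟩

theorem graph_eq (C : I.BlockingCycle (I.waiting U)) :
    C.graph = I.ringGraph (orbit nx (C.robot 0)) f ∅ := by
  unfold BlockingCycle.graph ringGraph
  congr 1
  · ext v
    simp only [Set.mem_ofPred_eq, Set.mem_empty_iff_false, not_false_eq_true, true_and,
      J.onCyclePath_iff hM hN]
    constructor
    · rintro ⟨i, a, ha, rfl⟩
      rw [← J.orbit_val hM hN C i] at ha ⊢
      exact ⟨i, a, ha, rfl⟩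
    · rintro ⟨i, a, ha, rfl⟩
      rw [J.orbit_eq_robot hM hN] at ha ⊢
      exact ⟨_, a, ha, rfl⟩
  · funext r u v
    rw [eq_iff_iff]
    constructor
    · rintro ⟨i, rfl, a, b, -, hab, hb, e, rfl, rfl⟩
      rw [(J.hits_iff hM hN C i b).1 ⟨hb, e⟩] at hab
      rw [← J.orbit_val hM hN C i] at hab ⊢
      exact ⟨i, a, a + 1, rfl, Nat.lt_succ_self a, hab, rfl, rfl, fun h => h, fun h => h,
        fun c _ _ => by omega⟩
    · rintro ⟨i, a, b, rfl, hab, hb, rfl, rfl, -, -, hc⟩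
      have hb1 : b = a + 1 := by
        by_contra h1
        exact hc (a + 1) (Nat.lt_succ_self a) (by omega)
      subst hb1
      rw [J.orbit_eq_robot hM hN] at hb ⊢
      have := (J.hits_iff hM hN C (Fin.ofNat (C.k + 1) i) _).2 rfl
      exact ⟨_, rfl, a, _, by simp [waiting, J.robot_mem hM hN C], hb, this.1, this.2, rfl, rfl⟩

/-- A scout forms a good triple by itself. -/
theorem goodTriple_of_isScout (C : I.BlockingCycle (I.waiting U)) {i : Fin (C.k + 1)}
    (hi : C.IsScout i) :
    ∃ p, I.GoodTriple (C.k + 1) (orbit nx (C.robot 0)) f p p p := by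
  have H := J.isRing_of_cycle hM hN C
  obtain ⟨v, hv, hno⟩ := hi
  rw [J.onCyclePath_iff hM hN] at hv
  obtain ⟨a, ha, rfl⟩ := hv
  have hval := J.orbit_val hM hN C i
  simp only [J.onCyclePath_iff hM hN] at hno
  have hne : i + 1 ≠ i := by
    intro e
    have h1 := J.robot_succ hM hN C i
    rw [e] at h1
    exact J.nx_ne (J.robot_mem hM hN C i) h1.symm
  have h0 : 0 < a := by
    rcases Nat.eq_zero_or_pos a with rfl | h0
    · exfalso
      refine hno (i - 1) (fun e => hne ?_) ⟨_, le_rfl, ?_⟩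
      · conv_lhs => rw [← e]
        rw [sub_add_cancel]
      · rw [J.hit _ (J.robot_mem hM hN C _), ← J.robot_succ hM hN C, sub_add_cancel, I.vert_zero]
    · exact h0
  have hf : a < f (C.robot i) := by
    refine ha.lt_of_ne fun e => hno (i + 1) hne ⟨0, Nat.zero_le _, ?_⟩
    rw [e, J.hit _ (J.robot_mem hM hN C _), ← J.robot_succ hM hN C, I.vert_zero]
  have hin : Inner (C.k + 1) (orbit nx (C.robot 0)) f ((i : ℕ), a) := ⟨i.2, h0, by simpa [hval] using hf⟩
  have huniq : ∀ z, Inner (C.k + 1) (orbit nx (C.robot 0)) f z →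
      I.letter (orbit nx (C.robot 0)) z = I.letter (orbit nx (C.robot 0)) ((i : ℕ), a) →
      z = ((i : ℕ), a) := by
    intro z hz e
    by_contra hzne
    have h1 := H.fst_ne hz hin e hzne
    have hz' : orbit nx (C.robot 0) z.1 = C.robot ⟨z.1, hz.1⟩ := J.orbit_val hM hN C ⟨z.1, hz.1⟩
    refine hno ⟨z.1, hz.1⟩ (fun e' => h1 (congrArg Fin.val e')) ⟨z.2, ?_, ?_⟩
    · rw [← hz']; exact hz.2.2.le
    · rw [← hz']
      simp only [letter, hval] at e
      exact e.symm
  exact ⟨((i : ℕ), a), hin, hin, hin, Or.inl rfl, Or.inl rfl, rfl, fun z hz e => Or.inl (huniq z hz e),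
    fun z hz e => Or.inl (huniq z hz e)⟩

theorem partner_of_no_scout (C : I.BlockingCycle (I.waiting U)) (hC : ∀ i, ¬ C.IsScout i)
    (y : ℕ × ℕ) (hy : Inner (C.k + 1) (orbit nx (C.robot 0)) f y) :
    ∃ y', Inner (C.k + 1) (orbit nx (C.robot 0)) f y' ∧ y' ≠ y ∧
      I.letter (orbit nx (C.robot 0)) y' = I.letter (orbit nx (C.robot 0)) y := by
  have H := J.isRing_of_cycle hM hN C
  have hy' := J.orbit_val hM hN C ⟨y.1, hy.1⟩
  simp only at hy'
  have h1 := hC ⟨y.1, hy.1⟩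
  simp only [BlockingCycle.IsScout, J.onCyclePath_iff hM hN] at h1
  push Not at h1
  obtain ⟨j, hj, b, hb, e⟩ := h1 (I.letter (orbit nx (C.robot 0)) y)
    ⟨y.2, by rw [← hy']; exact hy.2.2.le, by rw [← hy']; rfl⟩
  have hjj := J.orbit_val hM hN C j
  rw [← hjj] at hb e
  have hsrc : ∀ i, I.letter (orbit nx (C.robot 0)) y ≠ I.src (orbit nx (C.robot 0) i) := by
    intro i e'
    rcases H.src_unique hM hy.2.2.le e'.symm with ⟨-, h2⟩ | ⟨-, h2⟩
    · exact absurd h2 hy.2.1.ne'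
    · exact absurd h2 hy.2.2.ne
  refine ⟨(j, b), ⟨j.2, Nat.pos_of_ne_zero ?_, hb.lt_of_ne ?_⟩, ?_, e.symm⟩
  · rintro rfl
    exact hsrc j (by rw [e, I.vert_zero])
  · rintro rfl
    exact hsrc (j + 1) (by rw [e, H.hit])
  · rintro rfl
    exact hj rfl

end Jam

/-- The characterization of solvability by blocking cycles. -/
theorem solvable_iff_of_clearedTo [Fintype V] [Fintype R] [DecidableEq R] {I : MRMPGP V R}
    (hN : I.NonBlockingTargets) (hmult : I.vertexMultiplicity ≤ 2) {σ : R → ℕ}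
    (hσ : I.ClearedTo σ) :
    (∀ C : I.BlockingCycle σ, (∀ i, ¬ C.IsScout i) → ∃ G, C.graph.UntanglesTo G) ∧
    (I.Solvable ↔ ∀ C : I.BlockingCycle σ, (∀ i, ¬ C.IsScout i) →
      ∀ G, C.graph.UntanglesTo G → ¬ G.HasStartCycle) ∧
    (I.Solvable ↔ ∀ C : I.BlockingCycle σ, (∀ i, ¬ C.IsScout i) →
      ∃ G, C.graph.UntanglesTo G ∧ ¬ G.HasStartCycle) := by
  have hM : I.AtMostTwo := atMostTwo_of_vertexMultiplicity_le hmult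
  obtain ⟨U, nx, f, J, rfl, plan, hplan⟩ := hσ.exists_jam hN
  have hex : ∀ C : I.BlockingCycle (I.waiting U), (∀ i, ¬ C.IsScout i) →
      ∃ G, C.graph.UntanglesTo G := by
    intro C _
    rw [J.graph_eq hM hN]
    exact (J.isRing_of_cycle hM hN C).exists_untanglesTo hM
  have hnec : I.Solvable → ∀ C : I.BlockingCycle (I.waiting U), (∀ i, ¬ C.IsScout i) →
      ∀ G, C.graph.UntanglesTo G → ¬ G.HasStartCycle := by
    intro hs C hC G hG
    have H := J.isRing_of_cycle hM hN C
    rw [J.graph_eq hM hN] at hG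
    rcases H.balanced_or_goodTriple hM (J.partner_of_no_scout hM hN C hC) with hB |
      ⟨p, y, q, y', g, h1, h2, h3, h4, h5⟩
    · obtain ⟨plan', hp'⟩ := steps_waiting_of_solvable hN U hs
      exact absurd hp' (J.no_plan hM (J.robot_mem hM hN C 0)
        (by rw [J.minimalPeriod_eq hM hN C]; exact hB) plan')
    · exact H.not_hasStartCycle_of_crossing hM g.hp g.hy g.hq h3 h1 h2 h4 g.eq h5 hG.1
  have hsuf : (∀ C : I.BlockingCycle (I.waiting U), (∀ i, ¬ C.IsScout i) →
      ∃ G, C.graph.UntanglesTo G ∧ ¬ G.HasStartCycle) → I.Solvable := by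
    intro hall
    obtain ⟨plan', hp'⟩ := J.exists_plan hM hN (by
      intro r₀ h₀
      obtain ⟨C, rfl⟩ := J.exists_blockingCycle hM hN h₀
      rw [J.minimalPeriod_eq hM hN C]
      have H := J.isRing_of_cycle hM hN C
      by_cases hC : ∀ i, ¬ C.IsScout i
      · rcases H.balanced_or_goodTriple hM (J.partner_of_no_scout hM hN C hC) with hB |
          ⟨p, y, q, y', g, -⟩
        · obtain ⟨G, hG, hS⟩ := hall C hC
          rw [J.graph_eq hM hN] at hG
          exact absurd (H.hasStartCycle_of_balanced hM hB hG) hS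
        · exact ⟨p, y, q, g⟩
      · push Not at hC
        obtain ⟨i, hi⟩ := hC
        obtain ⟨p, g⟩ := J.goodTriple_of_isScout hM hN C hi
        exact ⟨p, p, p, g⟩)
    exact solvable_of_steps hplan hp'
  refine ⟨hex, ⟨hnec, fun hall => hsuf fun C hC => ?_⟩, ⟨fun hs C hC => ?_, hsuf⟩⟩
  · obtain ⟨G, hG⟩ := hex C hC
    exact ⟨G, hG, hall C hC G hG⟩
  · obtain ⟨G, hG⟩ := hex C hC
    exact ⟨G, hG, hnec hs C hC G hG⟩

end MRMPGP

/-! ### Reasoning about programs -/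

namespace RAM

/-- Started in `s`, the program `p` halts with a final memory and a running time that satisfy
`Q`. -/
def Runs (p : Program) (s : Memory) (Q : Memory → ℕ → Prop) : Prop :=
  ∃ s' t, Exec p s s' t ∧ Q s' t

variable {p q : Program} {s : Memory} {Q Q' : Memory → ℕ → Prop} {b : Test}

theorem Runs.mono (h : Runs p s Q) (hQ : ∀ s' t, Q s' t → Q' s' t) : Runs p s Q' :=
  let ⟨s', t, he, hq⟩ := h
  ⟨s', t, he, hQ _ _ hq⟩

theorem runs_skip : Runs .skip s Q ↔ Q s 1 := by
  constructor
  · rintro ⟨s', t, he, hq⟩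
    cases he
    exact hq
  · exact fun h => ⟨_, _, .skip s, h⟩

theorem runs_assign {a : ℕ} {i e : Expr} :
    Runs (.assign a i e) s Q ↔ Q (s.write a (i.eval s) (e.eval s)) (i.cost + e.cost + 1) := by
  constructor
  · rintro ⟨s', t, he, hq⟩
    cases he
    exact hq
  · exact fun h => ⟨_, _, .assign a i e s, h⟩

theorem runs_seq :
    Runs (.seq p q) s Q ↔ Runs p s fun s' t => Runs q s' fun s'' t' => Q s'' (t + t') := by
  constructor
  · rintro ⟨s', t, he, hq⟩
    cases he with
    | seq h1 h2 => exact ⟨_, _, h1, _, _, h2, hq⟩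
  · rintro ⟨s', t, h1, s'', t', h2, hq⟩
    exact ⟨_, _, .seq h1 h2, hq⟩

theorem runs_ite :
    Runs (.ite b p q) s Q ↔ (b.Holds s → Runs p s fun s' t => Q s' (b.cost + t)) ∧
      (¬ b.Holds s → Runs q s fun s' t => Q s' (b.cost + t)) := by
  constructor
  · rintro ⟨s', t, he, hq⟩
    cases he with
    | ite_true hb h => exact ⟨fun _ => ⟨_, _, h, hq⟩, fun hn => absurd hb hn⟩
    | ite_false hb h => exact ⟨fun hn => absurd hn hb, fun _ => ⟨_, _, h, hq⟩⟩
  · rintro ⟨h1, h2⟩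
    by_cases hb : b.Holds s
    · obtain ⟨s', t, he, hq⟩ := h1 hb
      exact ⟨_, _, .ite_true hb he, hq⟩
    · obtain ⟨s', t, he, hq⟩ := h2 hb
      exact ⟨_, _, .ite_false hb he, hq⟩

/-- Loops are treated by an invariant with a ghost parameter `g` and a potential `φ` of the ghost
parameter that pays for the running time. -/
theorem runs_loop {G : Type*} (Inv : G → Memory → Prop) (φ : G → ℕ)
    (hstep : ∀ g s, Inv g s → b.Holds s →
      Runs p s fun s' t => ∃ g', Inv g' s' ∧ b.cost + t + φ g' ≤ φ g)
    (g : G) (hs : Inv g s) :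
    Runs (.loop b p) s fun s' t => ∃ g', Inv g' s' ∧ ¬ b.Holds s' ∧ t + φ g' ≤ φ g + b.cost := by
  induction hn : φ g using Nat.strong_induction_on generalizing g s with
  | _ n ih =>
    by_cases hb : b.Holds s
    · obtain ⟨s', t, he, g', hg', ht⟩ := hstep g s hs hb
      have hpos : 0 < b.cost := by cases b <;> simp [Test.cost]
      obtain ⟨s'', t', he', g'', hg'', hb'', ht'⟩ := ih (φ g') (by omega) g' hg' rfl
      exact ⟨_, _, .loop_true hb he he', g'', hg'', hb'', by omega⟩
    · exact ⟨_, _, .loop_false hb, g, hs, hb, by omega⟩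

theorem Memory.write_apply (s : Memory) (a i x b : ℕ) :
    s.write a i x b = if b = a then Function.update (s a) i x else s b := by
  simp only [Memory.write, Function.update_apply]

/-- The memories differ at most in the listed arrays. -/
def SameExcept (X : List ℕ) (s s' : Memory) : Prop := ∀ b, b ∉ X → s' b = s b

theorem SameExcept.trans {X Y Z : List ℕ} {s s' s'' : Memory} (h : SameExcept X s s')
    (h' : SameExcept Y s' s'') (hX : X ⊆ Z) (hY : Y ⊆ Z) : SameExcept Z s s'' :=
  fun b hb => (h' b fun hm => hb (hY hm)).trans (h b fun hm => hb (hX hm))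

/-- The variable with number `a`: the cell `0` of the array `a`. -/
abbrev var (a : ℕ) : Expr := .cell a (.lit 0)

/-- Assignment to a variable. -/
abbrev set (a : ℕ) (e : Expr) : Program := .assign a (.lit 0) e

end RAM

/-! ### The input of the program -/

namespace MRMPGP

theorem getD_flatMap {α β : Type*} (g : α → List β) (d : β) (l : List α) (i a : ℕ)
    (hi : i < l.length) (ha : a < (g l[i]).length) :
    (l.flatMap g).getD (((l.take i).map fun x => (g x).length).sum + a) d = (g l[i]).getD a d := by
  induction l generalizing i with
  | nil => simp at hi
  | cons x l ih =>
    cases i with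
    | zero =>
      simp only [List.flatMap_cons, List.take_zero, List.map_nil, List.sum_nil, Nat.zero_add,
        List.getElem_cons_zero] at ha ⊢
      rw [List.getD_append _ _ _ _ ha]
    | succ i =>
      simp only [List.flatMap_cons, List.take_succ_cons, List.map_cons, List.sum_cons,
        List.getElem_cons_succ] at ha ⊢
      rw [List.getD_append_right _ _ _ _ (by omega), ← ih i (by simpa using hi) ha]
      congr 1
      omega

variable {m n : ℕ} (I : MRMPGP (Fin m) (Fin n))

theorem length_support_eq (r : Fin n) : (I.path r).1.support.length = I.len r + 1 := by
  rw [SimpleGraph.Walk.length_support, len]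

theorem offset_succ (r : Fin n) : I.offset (r + 1) = I.offset r + I.len r + 1 := by
  have h : (Finset.univ.filter fun r' : Fin n => r'.val < r + 1) =
      insert r (Finset.univ.filter fun r' : Fin n => r'.val < r) := by
    ext r'
    simp only [Finset.mem_filter, Finset.mem_univ, true_and, Finset.mem_insert, Fin.ext_iff]
    omega
  rw [offset, h, Finset.sum_insert (by simp), length_support_eq, offset]
  omega

theorem offset_eq_sum_take (j : ℕ) (hj : j ≤ n) :
    I.offset j = (((List.finRange n).take j).map fun r =>
      ((I.path r).1.support.map Fin.val).length).sum := by
  induction j with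
  | zero => simp [offset]
  | succ j ih =>
    have hlt : j < (List.finRange n).length := by simpa using hj
    rw [List.take_succ_eq_append_getElem hlt, List.map_append, List.sum_append, ← ih (by omega)]
    have := I.offset_succ ⟨j, hj⟩
    simp only at this
    rw [this]
    simp [len, Nat.add_assoc]

theorem getD_pathData {r : Fin n} {a : ℕ} (ha : a ≤ I.len r) :
    I.pathData.getD (I.offset r + a) 0 = I.vert r a := by
  have hr : r.val < (List.finRange n).length := by simp
  have hget : (List.finRange n)[r.val] = r := by simp
  have h := getD_flatMap (fun r => (I.path r).1.support.map Fin.val) 0 (List.finRange n) r a hr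
  rw [hget] at h
  have hl : a < ((I.path r).1.support.map Fin.val).length := by
    rw [List.length_map, length_support_eq]; omega
  rw [I.offset_eq_sum_take r r.2.le, pathData, h hl, List.getD_eq_getElem _ _ hl, List.getElem_map,
    vert, SimpleGraph.Walk.getVert_eq_support_getElem _ ha]

theorem totalLength_eq : I.totalLength = ∑ r, (I.len r + 1) := by
  simp only [totalLength, length_support_eq]

end MRMPGP

/-! ### The program: moving robots -/

/-! The program uses the following arrays besides those for input and output (`0` to `4`).
Indexed by robots: `6` current places, `7` places reached by scanning the paths, `8` blocking robots,
`9` blocked robots plus one. Here a place is an index of the array `2`. Indexed by vertices: `5`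
waiting robots plus one, `32` marks, `33` and `34` robots and places of the first occurrences.
The arrays `30` and `31` hold a stack of robots and places.

All others hold a variable each: `10` the robot in the main loops, `11` the robot whose path is
scanned plus one, or `0`, `12` the robot under consideration, `13` and `14` the robot to be moved and
the place it goes to, `15` a flag for loops, `16` failure, `17` the height of the stack, `18` success,
`19` and `20` a place and its vertex, `21` to `26` robots and places of a good triple, `27` the robot
where a loop ends. -/

namespace RAM

attribute [simp] Expr.eval Expr.cost Test.Holds Test.cost runs_skip runs_assign runs_seq runs_ite
  Memory.write_apply

/-- Moves the robot `13` to the place `14`. -/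
def advance : Program :=
  .loop (.lt (.cell 6 (var 13)) (var 14))
    (.seq (.assign 4 (.cell 3 (.lit 1)) (var 13))
      (.seq (.assign 3 (.lit 1) (.succ (.cell 3 (.lit 1))))
        (.assign 6 (var 13) (.succ (.cell 6 (var 13))))))

/-- Moves the robot given by `r` to the place given by `j`. -/
def moveTo (r j : Expr) : Program := .seq (set 13 r) (.seq (set 14 j) advance)

/-- Moves the predecessors of the robot `12` to the ends of their cycle paths, one after the other,
until the robot `27` has been moved. -/
def moveBack : Program :=
  .seq (set 15 (.lit 1))
    (.loop (.lt (.lit 0) (var 15))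
      (.ite (.eq (var 12) (var 27)) (set 15 (.lit 0))
        (.seq (set 12 (.pred (.cell 9 (var 12)))) (moveTo (var 12) (.cell 7 (var 12))))))

end RAM

namespace MRMPGP

open RAM

variable {m n : ℕ} {I : MRMPGP (Fin m) (Fin n)}

/-- The memory has recorded a legal sequence of moves from the initial configuration to `σ`. -/
structure Records (I : MRMPGP (Fin m) (Fin n)) (s : Memory) (σ : Fin n → ℕ) : Prop where
  flag : s 3 0 = 0
  cur : ∀ r : Fin n, s 6 r = I.offset r + σ r
  plan : ∃ plan, I.Steps (fun _ => 0) plan σ ∧ s 3 1 = plan.length ∧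
    ∀ j (h : j < plan.length), s 4 j = (plan[j]).val

theorem Steps.snoc {p : List (Fin n)} {σ σ' : Fin n → ℕ} (h : I.Steps σ p σ') {r : Fin n}
    (hr : I.Legal σ' r) : I.Steps σ (p ++ [r]) (Function.update σ' r (σ' r + 1)) :=
  h.append ⟨hr, rfl⟩

theorem Records.congr {s s' : Memory} {σ : Fin n → ℕ} (h : I.Records s σ) (h3 : s' 3 = s 3)
    (h4 : s' 4 = s 4) (h6 : s' 6 = s 6) : I.Records s' σ := by
  obtain ⟨a, b, c⟩ := h
  exact ⟨by rw [h3, a], by rw [h6]; exact b, by rw [h3, h4]; exact c⟩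

theorem runs_advance {s : Memory} {σ : Fin n → ℕ} {r : Fin n} {j : ℕ} (hs : I.Records s σ)
    (h13 : s 13 0 = r) (h14 : s 14 0 = I.offset r + j) (hc : I.CanMoveTo σ r j) :
    Runs advance s fun s' t => I.Records s' (Function.update σ r j) ∧ SameExcept [3, 4, 6] s s' ∧
      t ≤ 30 * (j - σ r) + 10 := by
  have := runs_loop (b := .lt (.cell 6 (var 13)) (var 14)) (p :=
      (.seq (.assign 4 (.cell 3 (.lit 1)) (var 13))
      (.seq (.assign 3 (.lit 1) (.succ (.cell 3 (.lit 1))))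
        (.assign 6 (var 13) (.succ (.cell 6 (var 13)))))))
    (fun (a : ℕ) s' => I.Records s' (Function.update σ r a) ∧ SameExcept [3, 4, 6] s s' ∧
      σ r ≤ a ∧ a ≤ j) (fun a => 30 * (j - a)) ?_ (σ r)
    ⟨by rwa [Function.update_eq_self], fun _ _ => rfl, le_rfl, hc.1⟩
  · refine this.mono fun s' t ⟨a, ⟨h1, h2, h3, h4⟩, hb, ht⟩ => ?_
    have e13 : s' 13 0 = r := by rw [h2 13 (by simp), h13]
    have e14 : s' 14 0 = I.offset r + j := by rw [h2 14 (by simp), h14]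
    have e6 := h1.cur r
    simp [e13, e14, e6] at hb ht
    obtain rfl : a = j := by omega
    exact ⟨h1, h2, by omega⟩
  · rintro a s' ⟨h1, h2, h3, h4⟩ hb
    have e13 : s' 13 0 = r := by rw [h2 13 (by simp), h13]
    have e14 : s' 14 0 = I.offset r + j := by rw [h2 14 (by simp), h14]
    have e6 := h1.cur r
    simp [e13, e14, e6] at hb
    have hc' : I.CanMoveTo (Function.update σ r a) r j := by
      refine ⟨by simp; omega, hc.2.1, fun r' hr' i hi hij => ?_⟩
      have := hc.2.2 r' hr' i (by simp at hi; omega) hij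
      simpa [pos, hr'] using this
    have hl := hc'.legal (by simpa using hb)
    obtain ⟨plan, k1, k2, k3⟩ := h1.plan
    simp [e13, e6]
    refine ⟨a + 1, ⟨⟨?_, ?_, plan ++ [r], ?_, ?_, ?_⟩, ?_, by omega, hb⟩, by omega⟩
    · simp [h1.flag]
    · intro r'
      by_cases e : r' = r
      · subst e; simp [Nat.add_assoc]
      · simp [e, h1.cur r', Fin.val_inj]
    · simpa using k1.snoc hl
    · simp [k2]
    · intro i hi
      simp only [List.length_append, List.length_cons, List.length_nil] at hi
      rcases (Nat.lt_succ_iff.1 hi).lt_or_eq with h5 | h5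
      · have h6 : i ≠ s' 3 1 := by omega
        rw [List.getElem_append_left h5, ← k3 i h5]
        simp [h6]
      · subst h5
        simp [k2]
    · intro b hb
      have := h2 b hb
      simp at hb
      simp [hb, this]

theorem runs_moveTo {s : Memory} {σ : Fin n → ℕ} {er ej : Expr} {r : Fin n} {j : ℕ}
    (hs : I.Records s σ) (hr : er.eval s = r)
    (hj : ej.eval (s.write 13 0 r) = I.offset r + j) (hc : I.CanMoveTo σ r j) :
    Runs (moveTo er ej) s fun s' t => I.Records s' (Function.update σ r j) ∧
      SameExcept [3, 4, 6, 13, 14] s s' ∧ t ≤ 30 * (j - σ r) + 14 + er.cost + ej.cost := by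
  simp only [moveTo, runs_seq, runs_assign, hr, hj, Expr.eval]
  have := runs_advance (s := (s.write 13 0 r).write 14 0 (I.offset r + j)) (r := r) (j := j)
    (hs.congr (by simp) (by simp) (by simp)) (by simp) (by simp) hc
  refine this.mono fun s' t ⟨h1, h2, h3⟩ => ⟨h1, fun b hb => ?_, ?_⟩
  · rw [h2 b (by simp at hb ⊢; omega)]
    simp at hb
    simp [hb]
  · simp only [Expr.cost]; omega

theorem sum_update {σ : Fin n → ℕ} {r : Fin n} {j : ℕ} (h : σ r ≤ j) :
    ∑ r', Function.update σ r j r' = ∑ r', σ r' + (j - σ r) := by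
  have h2 := Finset.sum_update_of_mem (Finset.mem_univ r) σ j
  have h3 := Finset.add_sum_erase Finset.univ σ (Finset.mem_univ r)
  rw [Finset.sdiff_singleton_eq_erase] at h2
  omega

theorem MacroSteps.sum_le {l : List (Fin n × ℕ)} {σ σ' : Fin n → ℕ} (h : I.MacroSteps σ l σ') :
    ∑ r, σ r ≤ ∑ r, σ' r := by
  induction l generalizing σ with
  | nil => cases h; exact le_rfl
  | cons a l ih =>
    have := ih h.2
    rw [sum_update h.1.1] at this
    omega

theorem runs_moveBack {s : Memory} {σ σ' : Fin n → ℕ} {ρ : ℕ → Fin n} {f : Fin n → ℕ} {lo k : ℕ}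
    (hs : I.Records s σ) (hne : ∀ i, 0 < i → i ≤ k → ρ (lo + i) ≠ ρ lo)
    (h9 : ∀ i, s 9 (ρ (i + 1)) = ρ i + 1) (h7 : ∀ i, s 7 (ρ i) = I.offset (ρ i) + f (ρ i))
    (h12 : s 12 0 = ρ (lo + k)) (h27 : s 27 0 = ρ lo)
    (hm : I.MacroSteps σ (finishDown ρ f lo k) σ') :
    Runs moveBack s fun s' t => I.Records s' σ' ∧ SameExcept [3, 4, 6, 12, 13, 14, 15] s s' ∧
      t + 30 * ∑ r, σ r ≤ 30 * ∑ r, σ' r + 60 * k + 60 := by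
  simp only [moveBack, runs_seq, runs_assign, Expr.eval]
  have := runs_loop (b := .lt (.lit 0) (var 15)) (p :=
      .ite (.eq (var 12) (var 27)) (set 15 (.lit 0))
        (.seq (set 12 (.pred (.cell 9 (var 12)))) (moveTo (var 12) (.cell 7 (var 12)))))
    (fun (g : ℕ × ℕ × (Fin n → ℕ)) s' => I.Records s' g.2.2 ∧
      SameExcept [3, 4, 6, 12, 13, 14, 15] s s' ∧ s' 15 0 = g.1 ∧ g.1 ≤ 1 ∧
      (g.1 = 0 → g.2.2 = σ') ∧ (g.1 = 1 → g.2.1 ≤ k ∧ s' 12 0 = ρ (lo + g.2.1) ∧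
        I.MacroSteps g.2.2 (finishDown ρ f lo g.2.1) σ'))
    (fun g => 30 * g.1 + 60 * g.2.1 + 30 * (∑ r, σ' r - ∑ r, g.2.2 r)) ?_ (1, k, σ)
    (s := s.write 15 0 1)
    ⟨hs.congr (by simp) (by simp) (by simp), fun b hb => by
      simp at hb; simp [hb], by simp, le_rfl, by simp, fun _ => ⟨le_rfl, by simp [h12], hm⟩⟩
  · refine this.mono fun s' t ⟨⟨g, i, τ⟩, ⟨h1, h2, h3, h4, h5, _⟩, hb, ht⟩ => ?_
    simp only at h1 h3 h4 h5
    simp [h3] at hb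
    subst hb
    obtain rfl := h5 rfl
    refine ⟨h1, h2, ?_⟩
    have := hm.sum_le
    simp at ht ⊢
    omega
  · rintro ⟨g, i, τ⟩ s' ⟨h1, h2, h3, h4, -, h6⟩ hb
    simp only at h1 h3 h4 h6
    simp [h3] at hb
    obtain rfl : g = 1 := by omega
    obtain ⟨h7', h8, h9'⟩ := h6 rfl
    have e27 : s' 27 0 = ρ lo := by rw [h2 27 (by simp), h27]
    have e9 : ∀ i, s' 9 (ρ (i + 1)) = ρ i + 1 := fun i => by rw [h2 9 (by simp), h9]
    have e7 : ∀ i, s' 7 (ρ i) = I.offset (ρ i) + f (ρ i) := fun i => by rw [h2 7 (by simp), h7]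
    rw [runs_ite]
    constructor
    · intro hc
      simp [h8, e27, Fin.val_inj] at hc
      have hi : i = 0 := by
        by_contra h0
        exact hne i (by omega) h7' hc
      subst hi
      rw [runs_assign]
      refine ⟨(0, 0, τ), ⟨h1.congr (by simp) (by simp) (by simp), fun b hb => ?_, by simp, by simp,
        fun _ => h9'.symm, by simp⟩, ?_⟩
      · have := h2 b hb
        simp at hb
        simp [hb, this]
      · simp
    · intro hc
      simp [h8, e27, Fin.val_inj] at hc
      obtain ⟨i, rfl⟩ : ∃ j, i = j + 1 := ⟨i - 1, by
        rcases Nat.eq_zero_or_pos i with rfl | h0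
        · exact absurd rfl hc
        · omega⟩
      obtain ⟨hcan, hrest⟩ := h9'
      rw [runs_seq, runs_assign]
      have e12 : s' 9 (s' 12 0) - 1 = ρ (lo + i) := by
        rw [h8, ← Nat.add_assoc, e9]; omega
      simp only [Expr.eval, e12]
      refine (runs_moveTo (s := s'.write 12 0 (ρ (lo + i))) (er := var 12) (ej := .cell 7 (var 12))
        (r := ρ (lo + i)) (j := f (ρ (lo + i)))
        (h1.congr (by simp) (by simp) (by simp)) (by simp) (by simp [e7]) hcan).mono
        fun s'' t ⟨k1, k2, k3⟩ => ?_
      refine ⟨(1, i, Function.update τ (ρ (lo + i)) (f (ρ (lo + i)))), ⟨k1, ?_, ?_, le_rfl, by simp, fun _ => ⟨by simp only; omega, ?_, hrest⟩⟩,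
        ?_⟩
      · intro b hb
        rw [k2 b (by simp at hb ⊢; omega), ← h2 b hb]
        simp at hb
        simp [hb]
      · rw [k2 15 (by simp)]; simp [h3]
      · rw [k2 12 (by simp)]; simp
      · have h11 : ∑ r, Function.update τ (ρ (lo + i)) (f (ρ (lo + i))) r ≤ ∑ r, σ' r :=
          hrest.sum_le
        have h10 : ∑ r, Function.update τ (ρ (lo + i)) (f (ρ (lo + i))) r =
          ∑ r, τ r + (f (ρ (lo + i)) - τ (ρ (lo + i))) := sum_update hcan.1
        have h12 : (var 12).cost = 2 := rfl
        have h13 : (Expr.cell 7 (var 12)).cost = 3 := rfl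
        have h14 : (Expr.cell 9 (var 12)).pred.cost = 4 := rfl
        rw [h12, h13] at k3
        simp only [Expr.cost, Test.cost] at k3 h14 ⊢
        generalize ∑ r, Function.update τ (ρ (lo + i)) (f (ρ (lo + i))) r = Z at *
        generalize ∑ r, τ r = T at *
        omega

end MRMPGP

/-! ### The program: clearing -/

namespace RAM

/-- Writes the tables of waiting robots, current places and scanned places. -/
def prepare : Program :=
  .loop (.lt (var 10) (.cell 0 (.lit 0)))
    (.seq (.assign 5 (.cell 2 (.cell 1 (var 10))) (.succ (var 10)))
      (.seq (.assign 6 (var 10) (.cell 1 (var 10)))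
        (.seq (.assign 7 (var 10) (.succ (.cell 1 (var 10))))
          (set 10 (.succ (var 10))))))

/-- Moves the robot `12`, a waiting one, to its target. -/
def retire : Program :=
  .seq (moveTo (var 12) (.pred (.cell 1 (.succ (var 12)))))
    (.assign 5 (.cell 2 (.cell 1 (var 12))) (.lit 0))

/-- One step of the scan of the path of the robot before `11`. If the path turns out to be clear,
then the robot goes to its target, and the robot that it has blocked is considered next. -/
def clearStep : Program :=
  .seq (set 12 (.pred (var 11)))
    (.ite (.eq (.cell 7 (var 12)) (.cell 1 (.succ (var 12))))
      (.seq retire (set 11 (.cell 9 (var 12))))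
      (.ite (.eq (.cell 5 (.cell 2 (.cell 7 (var 12)))) (.lit 0))
        (.assign 7 (var 12) (.succ (.cell 7 (var 12))))
        (.seq (.assign 8 (var 12) (.pred (.cell 5 (.cell 2 (.cell 7 (var 12))))))
          (.seq (.assign 9 (.cell 8 (var 12)) (.succ (var 12)))
            (set 11 (.lit 0))))))

/-- Clears as long as possible. -/
def clear : Program :=
  .loop (.lt (var 10) (.cell 0 (.lit 0)))
    (.seq (set 11 (.succ (var 10)))
      (.seq (.loop (.lt (.lit 0) (var 11)) clearStep)
        (set 10 (.succ (var 10)))))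

end RAM

namespace MRMPGP

open RAM

variable {m n : ℕ} {I : MRMPGP (Fin m) (Fin n)}

/-- The input is still in the memory. -/
structure HasInput (I : MRMPGP (Fin m) (Fin n)) (s : Memory) : Prop where
  zero : s 0 = I.input 0
  one : s 1 = I.input 1
  two : s 2 = I.input 2

namespace HasInput

variable {s s' : Memory} (h : I.HasInput s)
include h

theorem congr {X : List ℕ} (hs : SameExcept X s s') (h0 : 0 ∉ X := by simp)
    (h1 : 1 ∉ X := by simp) (h2 : 2 ∉ X := by simp) : I.HasInput s' :=
  ⟨by rw [hs 0 h0, h.zero], by rw [hs 1 h1, h.one], by rw [hs 2 h2, h.two]⟩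

theorem count : s 0 0 = n := by rw [h.zero]; rfl

theorem off (r : Fin n) : s 1 r = I.offset r := by
  rw [h.one]; simp [input, r.2.le]

theorem off_succ (r : Fin n) : s 1 (r + 1) = I.offset r + I.len r + 1 := by
  rw [h.one, ← I.offset_succ]; simp [input]

theorem vert {r : Fin n} {a : ℕ} (ha : a ≤ I.len r) : s 2 (I.offset r + a) = I.vert r a := by
  rw [h.two, ← I.getD_pathData ha]; rfl

theorem src (r : Fin n) : s 2 (I.offset r) = I.src r := by
  rw [← I.vert_zero]; exact h.vert (Nat.zero_le _)

end HasInput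

theorem hasInput_input (I : MRMPGP (Fin m) (Fin n)) : I.HasInput I.input := ⟨rfl, rfl, rfl⟩

/-- The table of waiting robots lists the robots in `U`. -/
structure Lists (I : MRMPGP (Fin m) (Fin n)) (s : Memory) (U : Finset (Fin n)) : Prop where
  mem : ∀ r ∈ U, s 5 (I.src r) = r + 1
  exists_mem : ∀ v, s 5 v ≠ 0 → ∃ r ∈ U, v = I.src r

theorem Lists.congr {s s' : Memory} {U : Finset (Fin n)} (h : I.Lists s U) (h5 : s' 5 = s 5) :
    I.Lists s' U := ⟨by rw [h5]; exact h.mem, by rw [h5]; exact h.exists_mem⟩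

theorem Lists.erase {s s' : Memory} {U : Finset (Fin n)} (h : I.Lists s U) {r : Fin n}
    (h5 : s' 5 = Function.update (s 5) (I.src r) 0) : I.Lists s' (U.erase r) := by
  constructor
  · intro r' hr'
    have hne : (I.src r').val ≠ I.src r := fun e =>
      (Finset.mem_erase.1 hr').1 (I.src_injective (Fin.ext e))
    rw [h5, Function.update_of_ne hne]
    exact h.mem r' (Finset.mem_of_mem_erase hr')
  · intro v hv
    have hne : v ≠ I.src r := by rintro rfl; simp [h5] at hv
    rw [h5, Function.update_of_ne hne] at hv
    obtain ⟨r', hr', e⟩ := h.exists_mem v hv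
    exact ⟨r', Finset.mem_erase.2 ⟨fun e' => hne (e' ▸ e), hr'⟩, e⟩

theorem Lists.mem_iff {s : Memory} {U : Finset (Fin n)} (h : I.Lists s U) (r : Fin n) :
    s 5 (I.src r) ≠ 0 ↔ r ∈ U := by
  constructor
  · intro hr
    obtain ⟨r', hr', e⟩ := h.exists_mem _ hr
    rwa [I.src_injective (Fin.ext e)]
  · intro hr
    rw [h.mem r hr]; omega

theorem runs_prepare (I : MRMPGP (Fin m) (Fin n)) :
    Runs prepare I.input fun s t => SameExcept [5, 6, 7, 10] I.input s ∧
      I.Lists s Finset.univ ∧ I.Records s (I.waiting Finset.univ) ∧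
      (∀ r : Fin n, s 7 r = I.offset r + 1) ∧ t ≤ 50 * n + 10 := by
  have := runs_loop (b := .lt (var 10) (.cell 0 (.lit 0))) (p :=
    (.seq (.assign 5 (.cell 2 (.cell 1 (var 10))) (.succ (var 10)))
      (.seq (.assign 6 (var 10) (.cell 1 (var 10)))
        (.seq (.assign 7 (var 10) (.succ (.cell 1 (var 10))))
          (set 10 (.succ (var 10)))))))
    (fun (i : ℕ) s => SameExcept [5, 6, 7, 10] I.input s ∧ i ≤ n ∧ s 10 0 = i ∧
      I.Lists s (Finset.univ.filter fun r => r.val < i) ∧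
      ∀ r : Fin n, r.val < i → s 6 r = I.offset r ∧ s 7 r = I.offset r + 1)
    (fun i => 50 * (n - i)) ?_ 0 (s := I.input) ⟨fun _ _ => rfl, Nat.zero_le _, rfl,
      ⟨by simp, fun v hv => absurd rfl hv⟩, by simp⟩
  · refine this.mono fun s t ⟨i, ⟨h1, h2, h3, h4, h5⟩, hb, ht⟩ => ?_
    have hI := I.hasInput_input.congr h1
    simp [hI.count, h3] at hb ht
    obtain rfl : i = n := by omega
    simp at h4
    refine ⟨h1, h4, ⟨by rw [h1 3 (by simp)]; rfl, fun r => by simp [waiting, h5 r r.2], [], ?_, ?_,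
      by simp⟩, fun r => (h5 r r.2).2, by omega⟩
    · funext r; simp [waiting]
    · rw [h1 3 (by simp)]; rfl
  · rintro i s ⟨h1, h2, h3, h4, h5⟩ hb
    have hI := I.hasInput_input.congr h1
    simp [hI.count, h3] at hb
    have e1 := hI.off ⟨i, hb⟩
    have e2 := hI.src ⟨i, hb⟩
    simp only at e1 e2
    simp [h3, e1, e2]
    refine ⟨⟨fun b hb => ?_, hb, ⟨?_, ?_⟩, ?_⟩, by omega⟩
    · have := h1 b hb
      simp at hb
      simp [hb, this]
    · intro r hr
      simp at hr
      by_cases e : r = ⟨i, hb⟩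
      · subst e; simp
      · have hne : (I.src r).val ≠ I.src ⟨i, hb⟩ := fun e' => e (I.src_injective (Fin.ext e'))
        have hlt : r.val < i := by
          exact lt_of_le_of_ne hr fun h => e (Fin.ext h)
        simp [hne, h4.mem r (by simpa using hlt)]
    · intro v hv
      by_cases e : v = I.src ⟨i, hb⟩
      · exact ⟨⟨i, hb⟩, by simp, e⟩
      · simp [e] at hv
        obtain ⟨r, hr, e'⟩ := h4.exists_mem v hv
        simp at hr
        exact ⟨r, by simp; omega, e'⟩
    · intro r hr
      by_cases e : r.val = i
      · subst e; simp
      · simp [e, h5 r (by omega)]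

theorem runs_retire {s : Memory} {σ : Fin n → ℕ} {r : Fin n} (hI : I.HasInput s)
    (hs : I.Records s σ) (h12 : s 12 0 = r) (hc : I.CanMoveTo σ r (I.len r)) :
    Runs retire s fun s' t => I.Records s' (Function.update σ r (I.len r)) ∧
      SameExcept [3, 4, 5, 6, 13, 14] s s' ∧
      s' 5 = Function.update (s 5) (I.src r) 0 ∧ t ≤ 30 * (I.len r - σ r) + 40 := by
  rw [retire, runs_seq]
  refine (runs_moveTo (r := r) (j := I.len r) hs (by simp [h12]) ?_ hc).mono
    fun s' t ⟨h1, h2, h3⟩ => ?_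
  · have := hI.off_succ r
    simp [h12, this]
  · have hI' := hI.congr h2
    have e12 : s' 12 0 = r := by rw [h2 12 (by simp), h12]
    have e1 := hI'.off r
    have e2 := hI'.src r
    simp [e12, e1, e2]
    refine ⟨h1.congr (by simp) (by simp) (by simp), fun b hb => ?_, ?_, ?_⟩
    · have := h2 b (by simp at hb ⊢; omega)
      simp at hb
      simp [hb, this]
    · rw [h2 5 (by simp)]
    · simp at h3; omega

/-- The state of the search for clear paths: the paths of the robots in `U`, which wait at their
sources, have been scanned up to the vertices number `sc r`. The robots in `U` before `i`,
except possibly the robot `q - 1`, are known to be blocked. -/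
structure Clearing (I : MRMPGP (Fin m) (Fin n)) (s : Memory) (U : Finset (Fin n)) (sc : Fin n → ℕ)
    (i q : ℕ) : Prop where
  same : SameExcept [3, 4, 5, 6, 7, 8, 9, 10, 11, 12, 13, 14] I.input s
  lists : I.Lists s U
  records : I.Records s (I.waiting U)
  eq11 : s 11 0 = q
  scan : ∀ r : Fin n, s 7 r = I.offset r + sc r
  pos : ∀ r, 1 ≤ sc r
  le : ∀ r, sc r ≤ I.len r + 1
  free : ∀ r, ∀ a, 1 ≤ a → a < sc r → ∀ r' ∈ U, I.vert r a ≠ I.src r'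
  blocked : ∀ r ∈ U, r.val < i → r.val + 1 ≠ q → ∃ r' ∈ U, sc r ≤ I.len r ∧
    I.vert r (sc r) = I.src r' ∧ s 8 r = r' ∧ s 9 r' = r + 1
  prv : ∀ r' ∈ U, ∀ x, s 9 r' = x + 1 →
    ∃ r ∈ U, r.val = x ∧ r.val < i ∧ r.val + 1 ≠ q ∧ s 8 r = r'
  later : ∀ r : Fin n, i ≤ r → r ∈ U
  cur : ∀ x, q = x + 1 → ∃ r ∈ U, r.val = x ∧ r.val < i

/-- A bound for the time that remains to be spent on clearing: every robot in `U` may have to be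
moved to its target, and the rest of every path may have to be scanned. -/
def clearingPotential (I : MRMPGP (Fin m) (Fin n)) (U : Finset (Fin n)) (sc : Fin n → ℕ) : ℕ :=
  ∑ r ∈ U, (30 * I.len r + 300) + 300 * ∑ r, (I.len r + 1 - sc r)

namespace Clearing

variable {s : Memory} {U : Finset (Fin n)} {sc : Fin n → ℕ} {i q : ℕ}

theorem waiting_erase {r : Fin n} :
    Function.update (I.waiting U) r (I.len r) = I.waiting (U.erase r) := by
  funext r'
  by_cases e : r' = r
  · subst e; simp [waiting]
  · simp [waiting, e]

theorem canMoveTo (h : I.Clearing s U sc i q) (hN : I.NonBlockingTargets) {r : Fin n}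
    (he : sc r = I.len r + 1) : I.CanMoveTo (I.waiting U) r (I.len r) := by
  refine ⟨?_, le_rfl, fun r' hr' a ha hal => ?_⟩
  · rw [waiting]; split_ifs <;> omega
  · rw [MRMPGP.pos, waiting]
    split_ifs with h'
    · rw [I.vert_zero]
      exact (h.free r a (by omega) (by omega) r' h').symm
    · rw [I.vert_len]
      intro e
      exact hN r r' hr'.symm (e ▸ I.onPath_vert hal)

theorem runs_clearStep (h : I.Clearing s U sc i q) (hN : I.NonBlockingTargets)
    (hM : I.AtMostTwo) (hq : q ≠ 0) :
    Runs clearStep s fun s' t => ∃ U' sc' q', I.Clearing s' U' sc' i q' ∧ s' 10 = s 10 ∧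
      t + 10 + (I.clearingPotential U' sc' + if q' = 0 then 0 else 300) ≤
        I.clearingPotential U sc + 300 := by
  obtain ⟨r, hr, hrq, hri⟩ := h.cur (q - 1) (by omega)
  have hI := I.hasInput_input.congr h.same
  obtain rfl : q = r + 1 := by omega
  have e11 := h.eq11
  have e7 := h.scan r
  have e1 := hI.off_succ r
  rw [clearStep, runs_seq, runs_assign, runs_ite]
  simp only [Expr.eval, e11, Nat.add_sub_cancel]
  constructor
  · intro hb
    simp [e7, e1] at hb
    have hsc : sc r = I.len r + 1 := by omega
    rw [runs_seq]
    refine (runs_retire (r := r) (σ := I.waiting U) ⟨by simp [hI.zero], by simp [hI.one],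
      by simp [hI.two]⟩ (h.records.congr (by simp) (by simp) (by simp)) (by simp)
      (h.canMoveTo hN hsc)).mono fun s' t ⟨k1, k2, k3, k4⟩ => ?_
    rw [waiting_erase] at k1
    have e12 : s' 12 0 = r := by rw [k2 12 (by simp)]; simp
    have e9 : s' 9 = s 9 := by rw [k2 9 (by simp)]; simp
    have e8 : s' 8 = s 8 := by rw [k2 8 (by simp)]; simp
    simp only [runs_assign, Expr.eval, e12, e9]
    refine ⟨U.erase r, sc, s 9 r, ⟨?_, ?_, k1.congr (by simp) (by simp) (by simp), by simp, ?_,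
      h.pos, h.le, fun r' a ha hal r'' hr'' => h.free r' a ha hal r'' (Finset.mem_of_mem_erase hr''),
      ?_, ?_, ?_, ?_⟩, ?_, ?_⟩
    · intro b hb
      have h5 := h.same b hb
      have := k2 b (by simp at hb ⊢; omega)
      simp at hb
      simp [hb, this, h5]
    · exact (h.lists.erase (by simpa using k3)).congr (by simp)
    · intro r'
      simp [k2 7, h.scan]
    · intro r₁ hr₁ hi hne
      obtain ⟨hne₁, hr₁⟩ := Finset.mem_erase.1 hr₁
      obtain ⟨r', hr', a1, a2, a3, a4⟩ := h.blocked r₁ hr₁ hi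
        (fun e => hne₁ (Fin.ext (by omega)))
      refine ⟨r', Finset.mem_erase.2 ⟨?_, hr'⟩, a1, a2, by simpa [e8] using a3,
        by simpa [e9] using a4⟩
      rintro rfl
      exact hne a4.symm
    · intro r' hr' x hx
      obtain ⟨hne, hr'⟩ := Finset.mem_erase.1 hr'
      obtain ⟨r₁, hr₁, a1, a2, a3, a4⟩ := h.prv r' hr' x (by simpa [e9] using hx)
      refine ⟨r₁, Finset.mem_erase.2 ⟨fun e => a3 (by rw [e]), hr₁⟩, a1, a2, fun e => ?_,
        by simpa [e8] using a4⟩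
      obtain ⟨r₂, -, b1, -, -, b4⟩ := h.prv r hr _ e.symm
      obtain rfl := Fin.ext b1
      exact hne (Fin.ext (a4.symm.trans b4))
    · intro r' hr'
      exact Finset.mem_erase.2 ⟨by rintro rfl; omega, h.later r' hr'⟩
    · intro x hx
      obtain ⟨r₁, hr₁, a1, a2, a3, -⟩ := h.prv r hr x hx
      exact ⟨r₁, Finset.mem_erase.2 ⟨fun e => a3 (by rw [e]), hr₁⟩, a1, a2⟩
    · rw [Memory.write_apply, if_neg (by simp), k2 10 (by simp)]; simp
    · have hw : I.waiting U r = 0 := by simp [waiting, hr]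
      have := Finset.add_sum_erase U (fun r => 30 * I.len r + 300) hr
      simp only [clearingPotential, Expr.cost, Test.cost]
      split_ifs <;> omega
  · intro hb
    simp [e7, e1] at hb
    have hle := h.le r
    have e2 := hI.vert (r := r) (a := sc r) (by omega)
    rw [runs_ite]
    constructor
    · intro hc
      simp [e7, e2] at hc
      simp only [runs_assign]
      refine ⟨U, Function.update sc r (sc r + 1), r + 1, ⟨?_, h.lists.congr (by simp),
        h.records.congr (by simp) (by simp) (by simp), by simp [h.eq11], ?_, ?_, ?_, ?_, ?_, ?_,
        h.later, h.cur⟩, by simp, ?_⟩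
      · intro b hb
        have h5 := h.same b hb
        simp at hb
        simp [hb, h5]
      · intro r'
        by_cases e : r' = r
        · subst e; simp [e7, Nat.add_assoc]
        · simp [e, Fin.val_inj, h.scan]
      · intro r'
        by_cases e : r' = r
        · subst e; simp
        · simp [e, h.pos]
      · intro r'
        by_cases e : r' = r
        · subst e; simp; omega
        · simp [e, h.le]
      · intro r' a ha hal r'' hr''
        by_cases e : r' = r
        · subst e
          simp at hal
          rcases hal.lt_or_eq with h' | rfl
          · exact h.free r' a ha h' r'' hr''
          · intro e'
            rw [e', h.lists.mem r'' hr''] at hc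
            omega
        · exact h.free r' a ha (by simpa [e] using hal) r'' hr''
      · intro r₁ hr₁ hi hne
        have hne' : r₁ ≠ r := fun e => hne (by rw [e])
        obtain ⟨r', hr', a1, a2, a3, a4⟩ := h.blocked r₁ hr₁ hi hne
        exact ⟨r', hr', by simpa [hne'] using a1, by simpa [hne'] using a2, by simpa using a3,
          by simpa using a4⟩
      · intro r' hr' x hx
        simpa using h.prv r' hr' x (by simpa using hx)
      · have hs : ∑ r', (I.len r' + 1 - Function.update sc r (sc r + 1) r') + 1 =
            ∑ r', (I.len r' + 1 - sc r') := by
          rw [← Finset.add_sum_erase _ _ (Finset.mem_univ r),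
            ← Finset.add_sum_erase _ (fun r' => I.len r' + 1 - sc r') (Finset.mem_univ r)]
          rw [Finset.sum_congr rfl (g := fun r' => I.len r' + 1 - sc r') fun r' hr' => by
            simp [(Finset.mem_erase.1 hr').1]]
          simp
          omega
        simp only [clearingPotential, Expr.cost, Test.cost, if_neg (Nat.succ_ne_zero _)]
        omega
    · intro hc
      simp [e7, e2] at hc
      obtain ⟨r', hr', e3⟩ := h.lists.exists_mem _ hc
      have e5 := h.lists.mem r' hr'
      have e3' : I.vert r (sc r) = I.src r' := Fin.ext e3
      have hon : ∀ r₁, sc r₁ ≤ I.len r₁ → I.vert r₁ (sc r₁) = I.src r' →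
          I.OnPath r₁ (I.src r') ∧ r₁ ≠ r' := by
        intro r₁ a1 a2
        refine ⟨a2 ▸ I.onPath_vert a1, ?_⟩
        rintro rfl
        rw [← I.vert_zero] at a2
        have := I.vert_inj a1 (Nat.zero_le _) a2
        have := h.pos r₁
        omega
      obtain ⟨on1, on2⟩ := hon r (by omega) e3'
      simp only [runs_seq, runs_assign]
      simp [e7, e2, e3', e5]
      refine ⟨U, sc, 0, ⟨?_, h.lists.congr (by simp),
        h.records.congr (by simp) (by simp) (by simp), by simp, ?_, h.pos, h.le, h.free, ?_, ?_,
        h.later, by simp⟩, ?_⟩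
      · intro b hb
        have h5 := h.same b hb
        simp at hb
        simp [hb, h5]
      · intro r₁; simp [h.scan]
      · intro r₁ hr₁ hi _
        by_cases e : r₁ = r
        · subst e
          exact ⟨r', hr', by omega, e3', by simp, by simp⟩
        · obtain ⟨r₂, hr₂, a1, a2, a3, a4⟩ := h.blocked r₁ hr₁ hi
            (fun e' => e (Fin.ext (by omega)))
          have hne : r₂ ≠ r' := by
            rintro rfl
            obtain ⟨on3, on4⟩ := hon r₁ a1 a2
            rcases hM _ _ _ _ on1 on3 (I.onPath_src r₂) with h' | h' | h'
            · exact e h'.symm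
            · exact on2 h'
            · exact on4 h'
          exact ⟨r₂, hr₂, a1, a2, by simp [e, Fin.val_inj, a3], by simp [hne, Fin.val_inj, a4]⟩
      · intro r₂ hr₂ x hx
        by_cases e : r₂ = r'
        · subst e
          simp at hx
          exact ⟨r, hr, hx, hri, by omega, by simp⟩
        · simp [e, Fin.val_inj] at hx
          obtain ⟨r₁, hr₁, a1, a2, a3, a4⟩ := h.prv r₂ hr₂ x hx
          have hne : r₁ ≠ r := fun e' => a3 (by rw [e'])
          exact ⟨r₁, hr₁, a1, a2, by omega, by simp [hne, Fin.val_inj, a4]⟩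
      · simp
        omega

/-- If all robots in `U` are blocked, then they form a jam, which the tables `7` to `9` describe. -/
theorem exists_jam (h : I.Clearing s U sc n 0) (hN : I.NonBlockingTargets) :
    ∃ nx : Fin n → Fin n, I.Jam U nx sc ∧ ∀ r ∈ U, s 8 r = nx r ∧ s 9 (nx r) = r + 1 := by
  have hb := fun r hr => h.blocked r hr r.2 (by omega)
  refine ⟨fun r => if hr : r ∈ U then (hb r hr).choose else r, ⟨fun r hr => ?_, fun r hr => h.pos r,
    fun r hr => ?_, fun r hr => ?_⟩, fun r hr => ?_⟩
  all_goals
    obtain ⟨a0, a1, a2, a3, a4⟩ := (hb r hr).choose_spec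
  · rwa [dif_pos hr]
  · refine lt_of_le_of_ne a1 fun e => ?_
    have hne : (hb r hr).choose ≠ r := by
      intro e'
      rw [e', ← I.vert_zero] at a2
      have := I.vert_inj a1 (Nat.zero_le _) a2
      have := h.pos r
      omega
    refine ne_len_of_vert_eq hN hne (Nat.zero_le _) ?_ e
    exact (I.vert_zero _).trans a2.symm
  · rwa [dif_pos hr]
  · simp only [dif_pos hr]; exact ⟨a3, a4⟩

end Clearing

/-- Clearing ends in a jam, in linear time. -/
theorem runs_clear (hN : I.NonBlockingTargets) (hM : I.AtMostTwo) {s : Memory}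
    (h : I.Clearing s Finset.univ (fun _ => 1) 0 0) (h10 : s 10 0 = 0) :
    Runs clear s fun s' t => ∃ U sc, I.Clearing s' U sc n 0 ∧
      t ≤ I.clearingPotential Finset.univ (fun _ => 1) + 600 * n + 10 := by
  rw [clear]
  have := runs_loop (b := .lt (var 10) (.cell 0 (.lit 0))) (p :=
    (.seq (set 11 (.succ (var 10)))
      (.seq (.loop (.lt (.lit 0) (var 11)) clearStep)
        (set 10 (.succ (var 10))))))
    (fun (g : ℕ × Finset (Fin n) × (Fin n → ℕ)) s => I.Clearing s g.2.1 g.2.2 g.1 0 ∧ s 10 0 = g.1 ∧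
      g.1 ≤ n)
    (fun g => I.clearingPotential g.2.1 g.2.2 + 600 * (n - g.1)) ?_ (0, Finset.univ, fun _ => 1)
    (s := s) ⟨h, h10, Nat.zero_le _⟩
  · refine this.mono fun s' t ⟨⟨i, U, sc⟩, ⟨h1, h2, h3⟩, hb, ht⟩ => ?_
    simp only at h1 h2 h3
    have hI := I.hasInput_input.congr h1.same
    simp [hI.count, h2] at hb ht
    obtain rfl : i = n := by omega
    exact ⟨U, sc, h1, by omega⟩
  · rintro ⟨i, U, sc⟩ s' ⟨h1, h2, h3⟩ hb
    simp only at h1 h2 h3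
    have hI := I.hasInput_input.congr h1.same
    simp [hI.count, h2] at hb
    rw [runs_seq, runs_assign, runs_seq]
    simp only [Expr.eval, h2]
    have h4 : I.Clearing (s'.write 11 0 (i + 1)) U sc (i + 1) (i + 1) := by
      refine ⟨fun b hb => ?_, h1.lists.congr (by simp), h1.records.congr (by simp) (by simp)
        (by simp), by simp, by simpa using h1.scan, h1.pos, h1.le, h1.free, fun r hr hi hne => ?_,
        fun r' hr' x hx => ?_, fun r hr => h1.later r (by omega), fun x hx => ?_⟩
      · have h5 := h1.same b hb
        simp at hb
        simp [hb, h5]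
      · simpa using h1.blocked r hr (by omega) (by omega)
      · obtain ⟨r, hr, a1, a2, a3, a4⟩ := h1.prv r' hr' x (by simpa using hx)
        exact ⟨r, hr, a1, by omega, by omega, by simpa using a4⟩
      · exact ⟨⟨i, hb⟩, h1.later _ le_rfl, by simp; omega, by simp⟩
    have := runs_loop (b := .lt (.lit 0) (var 11)) (p := clearStep)
      (fun (g : ℕ × Finset (Fin n) × (Fin n → ℕ)) s => I.Clearing s g.2.1 g.2.2 (i + 1) g.1 ∧
        s 10 0 = i)
      (fun g => I.clearingPotential g.2.1 g.2.2 + if g.1 = 0 then 0 else 300) ?_ (i + 1, U, sc)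
      (s := s'.write 11 0 (i + 1)) ⟨h4, by simp [h2]⟩
    · refine this.mono fun s'' t ⟨⟨q, U', sc'⟩, ⟨k1, k2⟩, kb, kt⟩ => ?_
      simp only at k1 k2
      simp [k1.eq11] at kb
      subst kb
      rw [runs_assign]
      simp only [Expr.eval, k2]
      refine ⟨(i + 1, U', sc'), ⟨⟨fun b hb => ?_, k1.lists.congr (by simp), k1.records.congr (by simp)
        (by simp) (by simp), by simp [k1.eq11], by simpa using k1.scan, k1.pos, k1.le, k1.free,
        by simpa using k1.blocked, by simpa using k1.prv, k1.later, by simp⟩, by simp, hb⟩, ?_⟩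
      · have h5 := k1.same b hb
        simp at hb
        simp [hb, h5]
      · simp at kt
        simp
        omega
    · rintro ⟨q, U, sc⟩ s'' ⟨k1, k2⟩ kb
      simp only at k1 k2
      simp [k1.eq11] at kb
      refine (k1.runs_clearStep hN hM (by omega)).mono fun s₃ t ⟨U', sc', q', j1, j2, j3⟩ =>
        ⟨(q', U', sc'), ⟨j1, by rw [j2, k2]⟩, ?_⟩
      simp only [Test.cost, Expr.cost, if_neg (show q ≠ 0 by omega)]
      omega

theorem clearing_of_prepared {s : Memory} (h1 : SameExcept [5, 6, 7, 10] I.input s)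
    (h2 : I.Lists s Finset.univ) (h3 : I.Records s (I.waiting Finset.univ))
    (h4 : ∀ r : Fin n, s 7 r = I.offset r + 1) :
    I.Clearing (s.write 10 0 0) Finset.univ (fun _ => 1) 0 0 := by
  refine ⟨fun b hb => ?_, h2.congr (by simp), h3.congr (by simp) (by simp) (by simp), ?_,
    by simpa using h4, fun _ => le_rfl, fun _ => by omega, fun _ a _ _ => by omega,
    fun _ _ _ => by omega, fun r' _ x hx => ?_, fun r _ => Finset.mem_univ r, by simp⟩
  · simp at hb
    have := h1 b (by simp [hb])
    simp [hb, this]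
  · have := h1 11 (by simp)
    simp [this, input]
  · have := h1 9 (by simp)
    simp [this, input] at hx

end MRMPGP

/-! ### Search for a good triple with a stack -/

namespace MRMPGP

section

variable {V R : Type*} {I : MRMPGP V R} {h : ℕ} {ρ : ℕ → R} {f : R → ℕ}

/-- The inner positions before `x` have been read, where a position has been put on the stack if
its vertex was new and has been taken from the stack when its vertex was met again. So far vertices
met twice have always been at the top of the stack. -/
structure ScanState (I : MRMPGP V R) (h : ℕ) (ρ : ℕ → R) (f : R → ℕ) (x : ℕ × ℕ)
    (stack : List (ℕ × ℕ)) : Prop where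
  mem : ∀ t ∈ stack, Inner h ρ f t ∧ Before t x
  sorted : stack.Pairwise fun a b => Before b a
  popped : ∀ z, Inner h ρ f z → Before z x → z ∉ stack →
    ∃ z', Inner h ρ f z' ∧ z' ≠ z ∧ I.letter ρ z' = I.letter ρ z ∧ Before z' x
  alone : ∀ t ∈ stack, ∀ z, Inner h ρ f z → I.letter ρ z = I.letter ρ t → Before z x → z = t
  nested : ∀ p q y, Inner h ρ f p → Inner h ρ f q → Inner h ρ f y → I.letter ρ p = I.letter ρ q →
    Before p y → Before y q → Before q x →
    ∃ y', Inner h ρ f y' ∧ y' ≠ y ∧ I.letter ρ y' = I.letter ρ y ∧ Before p y' ∧ Before y' q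

theorem Before.trans {p q r : ℕ × ℕ} (h : Before p q) (h' : Before q r) : Before p r := by
  simp only [Before] at *; omega

theorem Before.irrefl (p : ℕ × ℕ) : ¬ Before p p := by simp [Before]

theorem before_succ {i a : ℕ} {z : ℕ × ℕ} : Before z (i, a + 1) ↔ Before z (i, a) ∨ z = (i, a) := by
  simp only [Before, Prod.ext_iff]; omega

namespace ScanState

variable {x t : ℕ × ℕ} {i a : ℕ} {stack : List (ℕ × ℕ)}

theorem start (I : MRMPGP V R) (h : ℕ) (ρ : ℕ → R) (f : R → ℕ) : I.ScanState h ρ f (0, 1) [] := by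
  have key : ∀ z, Inner h ρ f z → ¬ Before z (0, 1) := by
    intro z hz hb
    have := hz.2.1
    simp only [Before] at hb
    omega
  exact ⟨by simp, by simp, fun z hz hb => absurd hb (key z hz), by simp,
    fun p q y _ hq _ _ _ _ hb => absurd hb (key q hq)⟩

theorem congr (S : I.ScanState h ρ f x stack) {x' : ℕ × ℕ}
    (hx : ∀ z, Inner h ρ f z → (Before z x' ↔ Before z x)) : I.ScanState h ρ f x' stack := by
  refine ⟨fun t ht => ⟨(S.mem t ht).1, (hx t (S.mem t ht).1).2 (S.mem t ht).2⟩, S.sorted,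
    fun z hz hb hn => ?_, fun t ht z hz e hb => S.alone t ht z hz e ((hx z hz).1 hb),
    fun p q y hp hq hy e h1 h2 h3 => S.nested p q y hp hq hy e h1 h2 ((hx q hq).1 h3)⟩
  obtain ⟨z', h1, h2, h3, h4⟩ := S.popped z hz ((hx z hz).1 hb) hn
  exact ⟨z', h1, h2, h3, (hx z' h1).2 h4⟩

variable (H : I.IsRing h ρ f) (hM : I.AtMostTwo)

theorem push (S : I.ScanState h ρ f (i, a) stack) (hx : Inner h ρ f (i, a))
    (hnew : ∀ z, Inner h ρ f z → Before z (i, a) → I.letter ρ z ≠ I.letter ρ (i, a)) :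
    I.ScanState h ρ f (i, a + 1) ((i, a) :: stack) := by
  refine ⟨?_, List.pairwise_cons.2 ⟨fun t ht => (S.mem t ht).2, S.sorted⟩, ?_, ?_, ?_⟩
  · intro t ht
    rw [before_succ]
    rcases List.mem_cons.1 ht with rfl | ht
    · exact ⟨hx, Or.inr rfl⟩
    · exact ⟨(S.mem t ht).1, Or.inl (S.mem t ht).2⟩
  · intro z hz hb hn
    simp only [List.mem_cons, not_or] at hn
    obtain ⟨z', h1, h2, h3, h4⟩ := S.popped z hz ((before_succ.1 hb).resolve_right hn.1) hn.2
    exact ⟨z', h1, h2, h3, before_succ.2 (Or.inl h4)⟩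
  · intro t ht z hz e hb
    rcases List.mem_cons.1 ht with rfl | ht
    · exact (before_succ.1 hb).resolve_left fun h' => hnew z hz h' e
    · rcases before_succ.1 hb with h' | rfl
      · exact S.alone t ht z hz e h'
      · exact absurd e.symm (hnew t (S.mem t ht).1 (S.mem t ht).2)
  · intro p q y hp hq hy e h1 h2 h3
    rcases before_succ.1 h3 with h' | rfl
    · exact S.nested p q y hp hq hy e h1 h2 h'
    · exact absurd e (hnew p hp (h1.trans h2))

include H hM

theorem pop (S : I.ScanState h ρ f (i, a) (t :: stack)) (hx : Inner h ρ f (i, a))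
    (e : I.letter ρ t = I.letter ρ (i, a)) : I.ScanState h ρ f (i, a + 1) stack := by
  obtain ⟨ht, htx⟩ := S.mem t (by simp)
  have hne : t ≠ (i, a) := fun e' => Before.irrefl _ (e' ▸ htx)
  have hsort := List.pairwise_cons.1 S.sorted
  -- The vertex of `x` occurs at `t` and at `x` only.
  have only : ∀ z, Inner h ρ f z → I.letter ρ z = I.letter ρ t → z = t ∨ z = (i, a) := by
    intro z hz ez
    rcases H.letter_two hM hz ht hx ez (ez.trans e) with h' | h' | h'
    · exact Or.inl h'
    · exact Or.inr h'
    · exact absurd h' hne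
  refine ⟨?_, hsort.2, ?_, ?_, ?_⟩
  · intro z hz
    rw [before_succ]
    exact ⟨(S.mem z (by simp [hz])).1, Or.inl (S.mem z (by simp [hz])).2⟩
  · intro z hz hb hn
    by_cases hzt : z = t
    · exact ⟨(i, a), hx, by rw [hzt]; exact hne.symm, by rw [hzt, e], by rw [before_succ]; simp⟩
    by_cases hzx : z = (i, a)
    · exact ⟨t, ht, by rw [hzx]; exact hne, by rw [hzx, e], by rw [before_succ]; exact Or.inl htx⟩
    obtain ⟨z', h1, h2, h3, h4⟩ := S.popped z hz ((before_succ.1 hb).resolve_right hzx)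
      (by simp [hzt, hn])
    exact ⟨z', h1, h2, h3, before_succ.2 (Or.inl h4)⟩
  · intro t' ht' z hz ez hb
    rcases before_succ.1 hb with h' | rfl
    · exact S.alone t' (by simp [ht']) z hz ez h'
    · have := S.alone t' (by simp [ht']) t ht (e.trans ez) htx
      subst this
      exact absurd (hsort.1 _ ht') (Before.irrefl _)
  · intro p q y hp hq hy ep h1 h2 h3
    rcases before_succ.1 h3 with h' | rfl
    · exact S.nested p q y hp hq hy ep h1 h2 h'
    have hpt : p = t := (only p hp (ep.trans e.symm)).resolve_right fun e' =>
      Before.irrefl _ (e' ▸ h1.trans h2)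
    subst hpt
    have hyn : y ∉ p :: stack := by
      intro hmem
      rcases List.mem_cons.1 hmem with rfl | hmem
      · exact Before.irrefl _ h1
      · exact Before.irrefl _ (h1.trans (hsort.1 _ hmem))
    obtain ⟨y', k1, k2, k3, k4⟩ := S.popped y hy h2 hyn
    refine ⟨y', k1, k2, k3, ?_, k4⟩
    rcases Before.trichotomy p y' with h' | rfl | h'
    · exact h'
    · rcases only y hy k3.symm with h' | h'
      · exact absurd h'.symm k2
      · exact absurd (h' ▸ h2) (Before.irrefl _)
    · -- Otherwise the pair `y'`, `y` would enclose `p`, which has no partner yet.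
      obtain ⟨z, j1, j2, j3, -, j5⟩ := S.nested y' y p k1 hy hp k3 h' h1 h2
      exact absurd (S.alone p (by simp) z j1 j3 (j5.trans h2)) j2

/-- The first occurrence of a vertex met for the second time is on the stack. -/
theorem mem_stack (S : I.ScanState h ρ f x stack) (hx : Inner h ρ f x) {z : ℕ × ℕ}
    (hz : Inner h ρ f z) (hb : Before z x) (e : I.letter ρ z = I.letter ρ x) : z ∈ stack := by
  by_contra hn
  obtain ⟨z', h1, h2, h3, h4⟩ := S.popped z hz hb hn
  rcases H.letter_two hM hx hz h1 e.symm (e.symm.trans h3.symm) with h' | h' | h'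
  · exact Before.irrefl _ (h' ▸ hb)
  · exact Before.irrefl _ (h' ▸ h4)
  · exact h2 h'.symm

/-- A vertex is met for the second time, and its first occurrence is not at the top of the stack. -/
theorem goodTriple (S : I.ScanState h ρ f x (t :: stack)) (hx : Inner h ρ f x) {z : ℕ × ℕ}
    (hz : Inner h ρ f z) (hb : Before z x) (e : I.letter ρ z = I.letter ρ x)
    (hne : I.letter ρ t ≠ I.letter ρ x) : I.GoodTriple h ρ f z t x := by
  have hzx : z ≠ x := fun e' => Before.irrefl _ (e' ▸ hb)
  have hzt : z ≠ t := fun e' => hne (e' ▸ e)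
  obtain ⟨ht, htx⟩ := S.mem t (by simp)
  refine ⟨hz, ht, hx, Or.inr ?_, Or.inr htx, e, fun u hu eu => ?_, fun u hu eu => ?_⟩
  · have := S.mem_stack H hM hx hz hb e
    exact (List.pairwise_cons.1 S.sorted).1 z ((List.mem_cons.1 this).resolve_left hzt)
  · rcases H.letter_two hM hu hz hx eu (eu.trans e) with h' | h' | h'
    · exact Or.inl h'
    · exact Or.inr h'
    · exact absurd h' hzx
  · rcases Before.trichotomy x u with h' | rfl | h'
    · exact Or.inr h'
    · exact absurd eu.symm hne
    · exact Or.inl (S.alone t (by simp) u hu eu h')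

omit H hM

theorem balanced (S : I.ScanState h ρ f (h, a) []) : I.Balanced h ρ f := by
  have hb : ∀ z, Inner h ρ f z → Before z (h, a) := fun z hz => Or.inl hz.1
  refine ⟨fun y hy => ?_, fun p q y hp hq hy e h1 h2 => S.nested p q y hp hq hy e h1 h2 (hb q hq)⟩
  obtain ⟨y', h1, h2, h3, -⟩ := S.popped y hy (hb y hy) (by simp)
  exact ⟨y', h1, h2, h3⟩

/-- A vertex left on the stack occurs only once. -/
theorem goodTriple_of_end (S : I.ScanState h ρ f (h, a) (t :: stack)) :
    I.GoodTriple h ρ f t t t := by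
  have ht := (S.mem t (by simp)).1
  have := fun z hz e => S.alone t (by simp) z hz e (Or.inl hz.1)
  exact ⟨ht, ht, ht, Or.inl rfl, Or.inl rfl, rfl, fun z hz e => Or.inl (this z hz e),
    fun z hz e => Or.inl (this z hz e)⟩

end ScanState

end

end MRMPGP

/-! ### The program: search for a good triple -/

namespace RAM

/-- Reads the vertex at the place `19` of the path of the robot `12`. If it is met for the second
time and the vertex at the top of the stack is another one, then a good triple has been found. -/
def readVertex : Program :=
  .seq (set 20 (.cell 2 (var 19)))
    (.ite (.eq (.cell 32 (var 20)) (.succ (var 10)))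
      (.ite (.eq (.cell 2 (.cell 31 (.pred (var 17)))) (var 20))
        (set 17 (.pred (var 17)))
        (.seq (set 18 (.lit 1))
          (.seq (set 21 (.cell 33 (var 20)))
            (.seq (set 22 (.cell 34 (var 20)))
              (.seq (set 23 (.cell 30 (.pred (var 17))))
                (.seq (set 24 (.cell 31 (.pred (var 17))))
                  (.seq (set 25 (var 12)) (set 26 (var 19)))))))))
      (.seq (.assign 32 (var 20) (.succ (var 10)))
        (.seq (.assign 33 (var 20) (var 12))
          (.seq (.assign 34 (var 20) (var 19))
            (.seq (.assign 30 (var 17) (var 12))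
              (.seq (.assign 31 (var 17) (var 19))
                (set 17 (.succ (var 17)))))))))

/-- Reads the cycle path of the robot `12` without its ends. -/
def readPath : Program :=
  .seq (set 19 (.succ (.cell 1 (var 12))))
    (.loop (.lt (var 19) (.cell 7 (var 12)))
      (.seq readVertex
        (.ite (.eq (var 18) (.lit 0))
          (set 19 (.succ (var 19)))
          (set 19 (.cell 7 (var 12))))))

/-- Reads the cycle paths of a ring, beginning with that of the robot `10`, until a good triple has
been found. -/
def readRing : Program :=
  .loop (.lt (.lit 0) (var 15))
    (.seq readPath
      (.ite (.eq (var 18) (.lit 0))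
        (.seq (set 12 (.cell 8 (var 12)))
          (.ite (.eq (var 12) (var 10)) (set 15 (.lit 0)) .skip))
        (set 15 (.lit 0))))

/-- A position left on the stack is taken as a good triple. -/
def takeTop : Program :=
  .ite (.eq (var 18) (.lit 0))
    (.ite (.lt (.lit 0) (var 17))
      (.seq (set 18 (.lit 1))
        (.seq (set 21 (.cell 30 (.pred (var 17))))
          (.seq (set 22 (.cell 31 (.pred (var 17))))
            (.seq (set 23 (var 21))
              (.seq (set 24 (var 22))
                (.seq (set 25 (var 21)) (set 26 (var 22))))))))
      .skip)
    .skip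

/-- Searches the ring of the robot `10` for a good triple. -/
def search : Program :=
  .seq (set 17 (.lit 0))
    (.seq (set 18 (.lit 0))
      (.seq (set 12 (var 10))
        (.seq (set 15 (.lit 1))
          (.seq readRing takeTop))))

end RAM

namespace MRMPGP

open RAM

variable {m n : ℕ} {I : MRMPGP (Fin m) (Fin n)} {s s' : Memory} {h : ℕ} {ρ : ℕ → Fin n}
  {f : Fin n → ℕ}

/-- The place of a position. -/
def place (I : MRMPGP (Fin m) (Fin n)) (ρ : ℕ → Fin n) (p : ℕ × ℕ) : ℕ := I.offset (ρ p.1) + p.2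

/-- The stack in the memory holds the positions in the list, the first one at the top. -/
def Stacked (I : MRMPGP (Fin m) (Fin n)) (ρ : ℕ → Fin n) (s : Memory) : List (ℕ × ℕ) → Prop
  | [] => True
  | t :: stack => s 30 stack.length = ρ t.1 ∧ s 31 stack.length = I.place ρ t ∧ I.Stacked ρ s stack

theorem Stacked.congr {stack : List (ℕ × ℕ)} (hs : I.Stacked ρ s stack)
    (h0 : ∀ k < stack.length, s' 30 k = s 30 k) (h1 : ∀ k < stack.length, s' 31 k = s 31 k) :
    I.Stacked ρ s' stack := by
  induction stack with
  | nil => trivial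
  | cons t stack ih =>
    have hlt : stack.length < (t :: stack).length := by simp
    exact ⟨by rw [h0 _ hlt, hs.1], by rw [h1 _ hlt, hs.2.1],
      ih hs.2.2 (fun k hk => h0 k (hk.trans hlt)) (fun k hk => h1 k (hk.trans hlt))⟩

/-- The memory represents a state of the search for a good triple: the vertices read so far are
marked with the number `c`. -/
structure Reading (I : MRMPGP (Fin m) (Fin n)) (h : ℕ) (ρ : ℕ → Fin n) (f : Fin n → ℕ) (c : ℕ)
    (s : Memory) (x : ℕ × ℕ) (stack : List (ℕ × ℕ)) : Prop where
  scan : I.ScanState h ρ f x stack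
  height : s 17 0 = stack.length
  found : s 18 0 = 0
  stacked : I.Stacked ρ s stack
  mark : ∀ z, Inner h ρ f z → Before z x → s 32 (I.letter ρ z) = c
  exists_mark : ∀ v, s 32 v = c → ∃ z, Inner h ρ f z ∧ Before z x ∧ (I.letter ρ z).val = v ∧
    s 33 v = ρ z.1 ∧ s 34 v = I.place ρ z

theorem Reading.congr {c : ℕ} {x x' : ℕ × ℕ} {stack : List (ℕ × ℕ)}
    (S : I.Reading h ρ f c s x stack) (hx : ∀ z, Inner h ρ f z → (Before z x' ↔ Before z x))
    (hs : ∀ b ∈ [17, 18, 30, 31, 32, 33, 34], s' b = s b) : I.Reading h ρ f c s' x' stack := by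
  refine ⟨S.scan.congr hx, by rw [hs 17 (by simp), S.height], by rw [hs 18 (by simp), S.found],
    S.stacked.congr (by simp [hs]) (by simp [hs]), fun z hz hb => ?_, fun v hv => ?_⟩
  · rw [hs 32 (by simp), S.mark z hz ((hx z hz).1 hb)]
  · rw [hs 32 (by simp)] at hv
    obtain ⟨z, h1, h2, h3, h4, h5⟩ := S.exists_mark v hv
    exact ⟨z, h1, (hx z h1).2 h2, h3, by rw [hs 33 (by simp), h4], by rw [hs 34 (by simp), h5]⟩

/-- The memory describes a good triple. -/
def Found (I : MRMPGP (Fin m) (Fin n)) (h : ℕ) (ρ : ℕ → Fin n) (f : Fin n → ℕ) (s : Memory) :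
    Prop :=
  s 18 0 = 1 ∧ ∃ p y q, I.GoodTriple h ρ f p y q ∧ s 21 0 = ρ p.1 ∧ s 22 0 = I.place ρ p ∧
    s 23 0 = ρ y.1 ∧ s 24 0 = I.place ρ y ∧ s 25 0 = ρ q.1 ∧ s 26 0 = I.place ρ q

theorem Found.congr (F : I.Found h ρ f s) (hs : ∀ b ∈ [18, 21, 22, 23, 24, 25, 26], s' b = s b) :
    I.Found h ρ f s' := by
  unfold Found at *
  simp only [List.mem_cons, forall_eq_or_imp] at hs
  simpa only [hs] using F

section

variable (hI : I.HasInput s) (H : I.IsRing h ρ f) (hM : I.AtMostTwo) {c : ℕ}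
include hI H

theorem runs_readVertex (hM : I.AtMostTwo) {i a : ℕ} {stack : List (ℕ × ℕ)}
    (S : I.Reading h ρ f c s (i, a) stack) (hx : Inner h ρ f (i, a)) (h10 : s 10 0 + 1 = c)
    (hc : ∀ v, s 32 v ≤ c) (h12 : s 12 0 = ρ i) (h19 : s 19 0 = I.place ρ (i, a)) :
    Runs readVertex s fun s' t =>
      SameExcept [17, 18, 20, 21, 22, 23, 24, 25, 26, 30, 31, 32, 33, 34] s s' ∧
      (∀ v, s' 32 v ≤ c) ∧ t ≤ 60 ∧
      ((∃ stack, I.Reading h ρ f c s' (i, a + 1) stack) ∨ I.Found h ρ f s') := by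
  have letter : ∀ z, Inner h ρ f z → s 2 (I.place ρ z) = I.letter ρ z := fun z hz =>
    hI.vert (hz.2.2.le.trans (H.flt _).le)
  have e20 := letter _ hx
  rw [readVertex, runs_seq, runs_assign, runs_ite]
  simp only [Expr.eval, h19, e20]
  constructor
  · intro hb
    simp [h10] at hb
    obtain ⟨z, hz, hzx, ez, e33, e34⟩ := S.exists_mark _ hb
    have ez' : I.letter ρ z = I.letter ρ (i, a) := Fin.ext ez
    have hmem := S.scan.mem_stack H hM hx hz hzx ez'
    obtain ⟨t, rest, rfl⟩ := List.exists_cons_of_ne_nil (List.ne_nil_of_mem hmem)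
    obtain ⟨e30, e31, hst⟩ := S.stacked
    have e17 := S.height
    have et := letter t (S.scan.mem t (by simp)).1
    rw [runs_ite]
    constructor
    · intro hb'
      simp [e17, e31, et, Fin.val_inj] at hb'
      rw [runs_assign]
      refine ⟨fun b hb => ?_, by simpa using hc, by simp, Or.inl ⟨rest,
        S.scan.pop H hM hx hb', by simp [e17], by simpa using S.found,
        hst.congr (by simp) (by simp), fun u hu hb' => ?_, fun v hv => ?_⟩⟩
      · simp at hb; simp [hb]
      · rcases before_succ.1 hb' with h' | rfl
        · simpa using S.mark u hu h'
        · simpa using hb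
      · simp at hv
        obtain ⟨u, k1, k2, k3, k4, k5⟩ := S.exists_mark v hv
        exact ⟨u, k1, before_succ.2 (Or.inl k2), k3, by simpa using k4, by simpa using k5⟩
    · intro hb'
      simp [e17, e31, et, Fin.val_inj] at hb'
      simp only [runs_seq, runs_assign]
      refine ⟨fun b hb => ?_, by simpa using hc, by simp, Or.inr ⟨by simp, z, t, (i, a),
        S.scan.goodTriple H hM hx hz hzx ez' hb', ?_⟩⟩
      · simp at hb; simp [hb]
      · simp [e17, e30, e31, e33, e34, h12, h19]
  · intro hb
    simp [h10] at hb
    have hnew : ∀ z, Inner h ρ f z → Before z (i, a) → I.letter ρ z ≠ I.letter ρ (i, a) :=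
      fun z hz hzx e => hb (e ▸ S.mark z hz hzx)
    have e17 := S.height
    simp only [runs_seq, runs_assign]
    refine ⟨fun b hb => ?_, fun v => ?_, by simp, Or.inl ⟨(i, a) :: stack,
        S.scan.push hx hnew, by simp [e17], by simpa using S.found,
        ⟨?_, ?_, S.stacked.congr (fun k hk => ?_) fun k hk => ?_⟩, fun u hu hb' => ?_,
        fun v hv => ?_⟩⟩
    · simp at hb; simp [hb]
    · by_cases e : v = I.letter ρ (i, a)
      · simp [e, h10]
      · simpa [e] using hc v
    · simp [e17, h12]
    · simp [e17, h19]
    · simp [e17, hk.ne]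
    · simp [e17, hk.ne]
    · rcases before_succ.1 hb' with h' | rfl
      · simpa [Fin.val_inj, hnew u hu h'] using S.mark u hu h'
      · simp [h10]
    · by_cases e : v = I.letter ρ (i, a)
      · exact ⟨(i, a), hx, by rw [before_succ]; simp, e.symm, by simp [e, h12], by simp [e, h19]⟩
      · simp [e] at hv
        obtain ⟨u, k1, k2, k3, k4, k5⟩ := S.exists_mark v hv
        exact ⟨u, k1, before_succ.2 (Or.inl k2), k3, by simpa [e] using k4, by simpa [e] using k5⟩

theorem runs_readPath (hM : I.AtMostTwo) (h7 : ∀ i, s 7 (ρ i) = I.offset (ρ i) + f (ρ i)) {i : ℕ}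
    {stack : List (ℕ × ℕ)} (S : I.Reading h ρ f c s (i, 1) stack) (hi : i < h)
    (h10 : s 10 0 + 1 = c) (hc : ∀ v, s 32 v ≤ c) (h12 : s 12 0 = ρ i) :
    Runs readPath s fun s' t =>
      SameExcept [17, 18, 19, 20, 21, 22, 23, 24, 25, 26, 30, 31, 32, 33, 34] s s' ∧
      (∀ v, s' 32 v ≤ c) ∧ t ≤ 100 * f (ρ i) + 20 ∧
      ((∃ stack, I.Reading h ρ f c s' (i + 1, 1) stack) ∨ I.Found h ρ f s') := by
  have e1 := hI.off (ρ i)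
  rw [readPath, runs_seq, runs_assign]
  simp only [Expr.eval, h12, e1]
  have := runs_loop (b := .lt (var 19) (.cell 7 (var 12))) (p :=
      (.seq readVertex
        (.ite (.eq (var 18) (.lit 0))
          (set 19 (.succ (var 19)))
          (set 19 (.cell 7 (var 12))))))
    (fun (a : ℕ) s' =>
      SameExcept [17, 18, 19, 20, 21, 22, 23, 24, 25, 26, 30, 31, 32, 33, 34] s s' ∧
      (∀ v, s' 32 v ≤ c) ∧ 0 < a ∧ s' 19 0 = I.place ρ (i, a) ∧ a ≤ f (ρ i) ∧
      ((∃ stack, I.Reading h ρ f c s' (i, a) stack) ∨ a = f (ρ i) ∧ I.Found h ρ f s'))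
    (fun a => 100 * (f (ρ i) - a)) ?_ 1 (s := s.write 19 0 (I.offset (ρ i) + 1))
    ⟨fun b hb => by simp at hb; simp [hb], by simpa using hc, Nat.one_pos, by simp [place],
      H.fpos i, Or.inl ⟨stack, S.congr (fun _ _ => Iff.rfl) (by simp)⟩⟩
  · refine this.mono fun s' t ⟨a, ⟨k1, k2, k3, k4, k5, k6⟩, hb, ht⟩ => ?_
    have e12 : s' 12 0 = ρ i := by rw [k1 12 (by simp), h12]
    have e7 : s' 7 (ρ i) = I.offset (ρ i) + f (ρ i) := by rw [k1 7 (by simp), h7]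
    simp [e12, e7, k4, place] at hb ht
    refine ⟨k1, k2, by simp; omega, ?_⟩
    rcases k6 with ⟨stack', k6⟩ | ⟨-, k6⟩
    · refine Or.inl ⟨stack', k6.congr (fun z hz => ?_) (by simp)⟩
      have h1 := hz.2
      simp only [Before]
      by_cases e : z.1 = i
      · rw [e] at h1; omega
      · omega
    · exact Or.inr k6
  · rintro a s' ⟨k1, k2, k3, k4, k5, k6⟩ hb
    have e12 : s' 12 0 = ρ i := by rw [k1 12 (by simp), h12]
    have e7 : s' 7 (ρ i) = I.offset (ρ i) + f (ρ i) := by rw [k1 7 (by simp), h7]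
    have e10 : s' 10 = s 10 := k1 10 (by simp)
    simp [e12, e7, k4, place] at hb
    rcases k6 with ⟨stack', k6⟩ | ⟨k6, -⟩
    swap
    · omega
    rw [runs_seq]
    refine (runs_readVertex (hI.congr k1) H hM k6 ⟨hi, k3, hb⟩ (by rw [e10, h10]) k2 e12 k4).mono
      fun s'' t ⟨j1, j2, j3, j4⟩ => ?_
    have e12' : s'' 12 = s' 12 := j1 12 (by simp)
    have e7' : s'' 7 = s' 7 := j1 7 (by simp)
    have e19 : s'' 19 = s' 19 := j1 19 (by simp)
    have hsame : ∀ x, SameExcept [17, 18, 19, 20, 21, 22, 23, 24, 25, 26, 30, 31, 32, 33, 34] s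
        (s''.write 19 0 x) := by
      intro x b hb
      have a1 := k1 b hb
      have a2 := j1 b (by simp at hb ⊢; omega)
      simp at hb
      simp [hb, a1, a2]
    simp only [runs_ite, runs_assign]
    simp only [Expr.eval, Expr.cost, Test.cost, e19, k4, e12', e12, e7', e7]
    rcases j4 with ⟨stack'', j4⟩ | j4
    · refine ⟨fun _ => ⟨a + 1, ⟨hsame _, by simpa using j2, by omega, by simp [place, Nat.add_assoc],
        hb, Or.inl ⟨stack'', j4.congr (fun _ _ => Iff.rfl) (by simp)⟩⟩, by omega⟩, fun hn => ?_⟩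
      simp [j4.found] at hn
    · refine ⟨fun hn => ?_, fun _ => ⟨f (ρ i), ⟨hsame _, by simpa using j2, by omega,
        by simp [place], le_rfl, Or.inr ⟨rfl, j4.congr (by simp)⟩⟩, by omega⟩⟩
      simp [j4.1] at hn

/-- The search finds out in linear time whether a ring is balanced. -/
theorem runs_search (hM : I.AtMostTwo) (h7 : ∀ i, s 7 (ρ i) = I.offset (ρ i) + f (ρ i))
    (h8 : ∀ i, s 8 (ρ i) = ρ (i + 1)) (h10 : s 10 0 = ρ 0) (hc : ∀ v, s 32 v ≤ ρ 0) :
    Runs search s fun s' t =>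
      SameExcept [12, 15, 17, 18, 19, 20, 21, 22, 23, 24, 25, 26, 30, 31, 32, 33, 34] s s' ∧
      (∀ v, s' 32 v ≤ ρ 0 + 1) ∧ t ≤ ∑ i ∈ Finset.range h, (100 * f (ρ i) + 100) + 100 ∧
      (s' 18 0 = 0 ∧ I.Balanced h ρ f ∨ I.Found h ρ f s') := by
  have hh := H.pos
  simp only [search, runs_seq, runs_assign, Expr.eval]
  have := runs_loop (b := .lt (.lit 0) (var 15)) (p :=
    (.seq readPath
      (.ite (.eq (var 18) (.lit 0))
        (.seq (set 12 (.cell 8 (var 12)))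
          (.ite (.eq (var 12) (var 10)) (set 15 (.lit 0)) .skip))
        (set 15 (.lit 0)))))
    (fun (i : ℕ) s' =>
      SameExcept [12, 15, 17, 18, 19, 20, 21, 22, 23, 24, 25, 26, 30, 31, 32, 33, 34] s s' ∧
      (∀ v, s' 32 v ≤ ρ 0 + 1) ∧ i ≤ h ∧
      ((∃ stack, I.Reading h ρ f (ρ 0 + 1) s' (i, 1) stack ∧ s' 12 0 = ρ i ∧
        s' 15 0 = if i = h then 0 else 1) ∨ (s' 15 0 = 0 ∧ I.Found h ρ f s')))
    (fun i => ∑ i ∈ Finset.Ico i h, (100 * f (ρ i) + 100)) ?_ 0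
    (s := (((s.write 17 0 0).write 18 0 0).write 12 0 (s 10 0)).write 15 0 1)
    ⟨fun b hb => by simp at hb; simp [hb], fun v => by have := hc v; simp; omega, Nat.zero_le _,
      Or.inl ⟨[], ⟨ScanState.start I h ρ f, by simp, by simp, trivial, fun z hz hb => ?_,
        fun v hv => ?_⟩, by simp [h10], by simp [hh.ne]⟩⟩
  · refine this.mono fun s' t ⟨i, ⟨k1, k2, k3, k4⟩, hb, ht⟩ => ?_
    have hts : t ≤ ∑ i ∈ Finset.range h, (100 * f (ρ i) + 100) + 5 := by
      rw [Finset.range_eq_Ico]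
      simp at ht ⊢
      omega
    rw [takeTop, runs_ite]
    rcases k4 with ⟨stack, k4, -, k5⟩ | ⟨-, k4⟩
    · refine ⟨fun _ => ?_, fun hn => absurd k4.found (by simpa using hn)⟩
      have hih : i = h := by
        by_contra hne
        simp [k5, hne] at hb
      subst hih
      have e17 := k4.height
      rw [runs_ite]
      constructor
      · intro hb'
        simp [e17] at hb'
        obtain ⟨t', rest, rfl⟩ := List.exists_cons_of_ne_nil (List.length_pos_iff.1 hb')
        obtain ⟨e30, e31, -⟩ := k4.stacked
        have g := k4.scan.goodTriple_of_end
        simp only [runs_seq, runs_assign]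
        refine ⟨fun b hb => ?_, by simpa using k2, by simp; omega, Or.inr ⟨by simp, t', t', t', g,
          by simp [e17, e30, e31]⟩⟩
        have := k1 b hb
        simp at hb
        simp [hb, this]
      · intro hb'
        simp [e17] at hb'
        subst hb'
        rw [runs_skip]
        exact ⟨k1, k2, by simp; omega, Or.inl ⟨k4.found, k4.scan.balanced⟩⟩
    · refine ⟨fun hn => ?_, fun _ => ?_⟩
      · simp [k4.1] at hn
      · rw [runs_skip]
        exact ⟨k1, k2, by simp; omega, Or.inr k4⟩
  · rintro i s' ⟨k1, k2, k3, k4⟩ hb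
    rcases k4 with ⟨stack, k4, k5, k6⟩ | ⟨k4, -⟩
    swap
    · simp [k4] at hb
    have hih : i < h := by
      refine lt_of_le_of_ne k3 fun e => ?_
      simp [k6, e] at hb
    rw [if_neg hih.ne] at k6
    have e10 : s' 10 0 = ρ 0 := by rw [k1 10 (by simp), h10]
    have e8 : s' 8 = s 8 := k1 8 (by simp)
    rw [runs_seq]
    refine (runs_readPath (hI.congr k1) H hM (fun i => by rw [k1 7 (by simp), h7]) k4 hih
      (by rw [e10]) k2 k5).mono fun s'' t ⟨j1, j2, j3, j4⟩ => ?_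
    have e12' : s'' 12 0 = ρ i := by rw [j1 12 (by simp), k5]
    have e15' : s'' 15 0 = 1 := by rw [j1 15 (by simp), k6]
    have e10' : s'' 10 0 = ρ 0 := by rw [j1 10 (by simp), e10]
    have e8' : s'' 8 (ρ i) = ρ (i + 1) := by rw [j1 8 (by simp), e8, h8]
    have hsum := Finset.sum_eq_sum_Ico_succ_bot hih fun i => 100 * f (ρ i) + 100
    have hsame : SameExcept [12, 15, 17, 18, 19, 20, 21, 22, 23, 24, 25, 26, 30, 31, 32, 33, 34]
        s s'' := k1.trans j1 (by simp) (by simp)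
    have hr := H.succ_eq_zero_iff hih
    rw [runs_ite]
    rcases j4 with ⟨stack', j4⟩ | j4
    · refine ⟨fun _ => ?_, fun hn => absurd j4.found (by simpa using hn)⟩
      rw [runs_seq, runs_assign, runs_ite]
      constructor
      · intro hb'
        simp [e12', e8', e10', Fin.val_inj, hr] at hb'
        rw [runs_assign]
        refine ⟨i + 1, ⟨fun b hb => ?_, by simpa using j2, hih, Or.inl ⟨stack',
          j4.congr (fun _ _ => Iff.rfl) (by simp), by simp [e12', e8'], by simp [hb']⟩⟩, ?_⟩
        · have := hsame b hb
          simp at hb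
          simp [hb, this]
        · simp; omega
      · intro hb'
        simp [e12', e8', e10', Fin.val_inj, hr] at hb'
        rw [runs_skip]
        refine ⟨i + 1, ⟨fun b hb => ?_, by simpa using j2, hih, Or.inl ⟨stack',
          j4.congr (fun _ _ => Iff.rfl) (by simp), by simp [e12', e8'], by simp [hb', e15']⟩⟩, ?_⟩
        · have := hsame b hb
          simp at hb
          simp [hb, this]
        · simp; omega
    · refine ⟨fun hn => ?_, fun _ => ?_⟩
      · simp [j4.1] at hn
      · rw [runs_assign]
        refine ⟨i + 1, ⟨fun b hb => ?_, by simpa using j2, hih, Or.inr ⟨by simp,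
          j4.congr (by simp)⟩⟩, ?_⟩
        · have := hsame b hb
          simp at hb
          simp [hb, this]
        · simp; omega
  · exfalso
    have := hz.2.1
    simp only [Before] at hb
    omega
  · have := hc v
    simp at hv
    omega

end

end MRMPGP

/-! ### The program: dissolving a ring -/

namespace RAM

/-- Rotates the ring of the good triple given by the variables `21` to `26`. -/
def rotate : Program :=
  .seq (moveTo (var 21) (var 22))
    (.seq (set 12 (var 21))
      (.seq (set 27 (.cell 8 (var 25)))
        (.seq moveBack
          (.seq (moveTo (var 23) (var 24))
            (.seq (set 12 (var 23))
              (.seq (set 27 (var 21))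
                (.seq moveBack
                  (.seq (moveTo (var 25) (var 26))
                    (.seq (set 12 (var 25))
                      (.seq (set 27 (var 23))
                        (.seq moveBack (moveTo (var 25) (.cell 7 (var 25))))))))))))))

/-- Moves the robots of the ring of the robot `10` to their targets. -/
def retireRing : Program :=
  .seq (set 12 (var 10))
    (.seq (set 15 (.lit 1))
      (.loop (.lt (.lit 0) (var 15))
        (.seq retire
          (.seq (set 12 (.cell 8 (var 12)))
            (.ite (.eq (var 12) (var 10)) (set 15 (.lit 0)) .skip)))))

end RAM

namespace MRMPGP

open RAM

variable {m n : ℕ} {I : MRMPGP (Fin m) (Fin n)} {s : Memory} {h : ℕ} {ρ : ℕ → Fin n}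
  {f : Fin n → ℕ}

theorem Records.of_same {s s' : Memory} {σ : Fin n → ℕ} (h : I.Records s σ) {X : List ℕ}
    (hs : SameExcept X s s') (h3 : 3 ∉ X := by simp) (h4 : 4 ∉ X := by simp)
    (h6 : 6 ∉ X := by simp) : I.Records s' σ :=
  h.congr (hs 3 h3) (hs 4 h4) (hs 6 h6)

theorem runs_moveTo_of_macroSteps {σ σ' : Fin n → ℕ} {er ej : Expr} {r : Fin n} {j : ℕ}
    (hs : I.Records s σ) (hr : er.eval s = r)
    (hj : ej.eval (s.write 13 0 r) = I.offset r + j) (hm : I.MacroSteps σ [(r, j)] σ') :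
    Runs (moveTo er ej) s fun s' t => I.Records s' σ' ∧ SameExcept [3, 4, 6, 13, 14] s s' ∧
      t + 30 * ∑ r, σ r ≤ 30 * ∑ r, σ' r + (14 + er.cost + ej.cost) := by
  obtain ⟨hc, rfl⟩ := hm
  refine (runs_moveTo hs hr hj hc).mono fun s' t ⟨h1, h2, h3⟩ => ⟨h1, h2, ?_⟩
  have hle : σ r ≤ j := hc.1
  rw [sum_update hle]
  omega

/-- One step of a rotation: a robot of a good triple moves, and robots behind it follow. -/
theorem runs_moveTo_moveBack {σ σ' : Fin n → ℕ} {er ej e27 : Expr} {r : Fin n} {j lo k : ℕ}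
    (hs : I.Records s σ) (hne : ∀ i, 0 < i → i ≤ k → ρ (lo + i) ≠ ρ lo)
    (h9 : ∀ i, s 9 (ρ (i + 1)) = ρ i + 1) (h7 : ∀ i, s 7 (ρ i) = I.offset (ρ i) + f (ρ i))
    (hr : er.eval s = r) (hj : ej.eval (s.write 13 0 r) = I.offset r + j)
    {e12 : Expr} (h12 : ∀ s', SameExcept [3, 4, 6, 13, 14] s s' → e12.eval s' = ρ (lo + k))
    (h27 : ∀ s', SameExcept [3, 4, 6, 12, 13, 14] s s' → e27.eval s' = ρ lo)
    (hm : I.MacroSteps σ ([(r, j)] ++ finishDown ρ f lo k) σ') {p : Program}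
    {Q : Memory → ℕ → Prop}
    (hQ : ∀ s' t, I.Records s' σ' → SameExcept [3, 4, 6, 12, 13, 14, 15, 27] s s' →
      t + 30 * ∑ r, σ r ≤
        30 * ∑ r, σ' r + 60 * k + (80 + er.cost + ej.cost + e12.cost + e27.cost) →
      Runs p s' fun s'' t' => Q s'' (t + t')) :
    Runs (.seq (moveTo er ej) (.seq (set 12 e12) (.seq (set 27 e27) (.seq moveBack p)))) s Q := by
  obtain ⟨τ, hm1, hm2⟩ := MacroSteps.append_iff.1 hm
  rw [runs_seq]
  refine (runs_moveTo_of_macroSteps hs hr hj hm1).mono fun s₁ t₁ ⟨a1, a2, a3⟩ => ?_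
  have b1 := h12 s₁ a2
  have b2 := h27 (s₁.write 12 0 (ρ (lo + k))) fun b hb => by
    have := a2 b (by simp at hb ⊢; omega)
    simp at hb
    simp [hb, this]
  simp only [runs_seq, runs_assign]
  simp only [Expr.eval, b1, b2]
  have hsame : SameExcept [12, 27] s₁ ((s₁.write 12 0 (ρ (lo + k))).write 27 0 (ρ lo)) := by
    intro b hb
    simp at hb
    simp [hb]
  have hsame' := a2.trans (Z := [3, 4, 6, 12, 13, 14, 27]) hsame (by simp) (by simp)
  refine (runs_moveBack (a1.of_same hsame) hne (fun i => by rw [hsame' 9 (by simp), h9])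
    (fun i => by rw [hsame' 7 (by simp), h7]) (by simp) (by simp) hm2).mono
    fun s₂ t₂ ⟨c1, c2, c3⟩ => ?_
  refine (hQ s₂ (t₁ + (1 + e12.cost + 1 + (1 + e27.cost + 1 + t₂))) c1
    (hsame'.trans c2 (by simp) (by simp)) (by omega)).mono fun s₃ t₃ hq => ?_
  convert hq using 1
  simp only [Expr.cost]
  omega

theorem runs_rotate (H : I.IsRing h ρ f) (h7 : ∀ i, s 7 (ρ i) = I.offset (ρ i) + f (ρ i))
    (h8 : ∀ i, s 8 (ρ i) = ρ (i + 1)) (h9 : ∀ i, s 9 (ρ (i + 1)) = ρ i + 1) {σ σ' : Fin n → ℕ}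
    (hs : I.Records s σ) {p y q : ℕ × ℕ} (g : I.GoodTriple h ρ f p y q) (h21 : s 21 0 = ρ p.1)
    (h22 : s 22 0 = I.place ρ p) (h23 : s 23 0 = ρ y.1) (h24 : s 24 0 = I.place ρ y)
    (h25 : s 25 0 = ρ q.1) (h26 : s 26 0 = I.place ρ q)
    (hm : I.MacroSteps σ (rotation h ρ f p y q) σ') :
    Runs rotate s fun s' t => I.Records s' σ' ∧ SameExcept [3, 4, 6, 12, 13, 14, 15, 27] s s' ∧
      t + 30 * ∑ r, σ r ≤ 30 * ∑ r, σ' r + 60 * h + 400 := by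
  have hq := g.hq.1
  have hpy : p.1 ≤ y.1 := by
    rcases g.hpy with e | e
    · rw [e]
    · simp only [Before] at e; omega
  have hyq : y.1 ≤ q.1 := by
    rcases g.hyq with e | e
    · rw [e]
    · simp only [Before] at e; omega
  have hne : ∀ lo i, 0 < i → i < h → ρ (lo + i) ≠ ρ lo := by
    intro lo i hi hih e
    rw [H.eq_iff] at e
    have := (Nat.modEq_iff_dvd' (Nat.le_add_right lo i)).1 (e.symm : lo ≡ lo + i [MOD h])
    rw [Nat.add_sub_cancel_left] at this
    exact absurd (Nat.le_of_dvd hi this) (by omega)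
  have hwrap : ρ (q.1 + 1 + (p.1 + h - q.1 - 1)) = ρ p.1 := by
    rw [show q.1 + 1 + (p.1 + h - q.1 - 1) = p.1 + h by omega, H.per]
  unfold rotation at hm
  rw [List.append_assoc, List.append_assoc, List.append_assoc, List.append_assoc,
    List.append_assoc, ← List.append_assoc, MacroSteps.append_iff] at hm
  obtain ⟨τ, hm1, hm⟩ := hm
  rw [← List.append_assoc, MacroSteps.append_iff] at hm
  obtain ⟨τ', hm2, hm⟩ := hm
  rw [← List.append_assoc, MacroSteps.append_iff] at hm
  obtain ⟨τ'', hm3, hm⟩ := hm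
  rw [rotate]
  refine runs_moveTo_moveBack hs (fun i h1 h2 => hne _ i h1 (by omega)) h9 h7
    (r := ρ p.1) (j := p.2) (by simpa using h21) (by simpa [place] using h22)
    (fun s' hs' => by rw [hwrap]; simp [hs' 21, h21])
    (fun s' hs' => by simp [hs' 25, hs' 8, h25, h8]) hm1 fun s₁ t₁ a1 a2 a3 => ?_
  refine runs_moveTo_moveBack a1 (fun i h1 h2 => hne _ i h1 (by omega))
    (fun i => by rw [a2 9 (by simp), h9]) (fun i => by rw [a2 7 (by simp), h7])
    (r := ρ y.1) (j := y.2) (by simp [a2 23, h23]) (by simpa [a2 24, place] using h24)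
    (fun s' hs' => by rw [Nat.add_sub_cancel' hpy]; simp [hs' 23, a2 23, h23])
    (fun s' hs' => by simp [hs' 21, a2 21, h21]) hm2 fun s₂ t₂ b1 b2 b3 => ?_
  replace b2 := a2.trans (Z := [3, 4, 6, 12, 13, 14, 15, 27]) b2 (by simp) (by simp)
  refine runs_moveTo_moveBack b1 (fun i h1 h2 => hne _ i h1 (by omega))
    (fun i => by rw [b2 9 (by simp), h9]) (fun i => by rw [b2 7 (by simp), h7])
    (r := ρ q.1) (j := q.2) (by simp [b2 25, h25]) (by simpa [b2 26, place] using h26)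
    (fun s' hs' => by rw [Nat.add_sub_cancel' hyq]; simp [hs' 25, b2 25, h25])
    (fun s' hs' => by simp [hs' 23, b2 23, h23]) hm3 fun s₃ t₃ c1 c2 c3 => ?_
  replace c2 := b2.trans (Z := [3, 4, 6, 12, 13, 14, 15, 27]) c2 (by simp) (by simp)
  refine (runs_moveTo_of_macroSteps c1 (r := ρ q.1) (j := f (ρ q.1)) (by simp [c2 25, h25])
    (by simp [c2 25, c2 7, h25, h7]) hm).mono fun s₄ t₄ ⟨d1, d2, d3⟩ =>
    ⟨d1, c2.trans d2 (by simp) (by simp), ?_⟩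
  simp only [Expr.cost] at a3 b3 c3 d3
  omega

theorem runs_retireRing (hI : I.HasInput s) (H : I.IsRing h ρ f)
    (h8 : ∀ i, s 8 (ρ i) = ρ (i + 1)) (h10 : s 10 0 = ρ 0) {σ σ' : Fin n → ℕ}
    (hs : I.Records s σ) {U : Finset (Fin n)} (hL : I.Lists s U)
    (hm : I.MacroSteps σ (toTargets I ρ 0 h) σ') :
    Runs retireRing s fun s' t => I.Records s' σ' ∧
      I.Lists s' (U.filter fun r => ∀ j < h, ρ j ≠ r) ∧
      SameExcept [3, 4, 5, 6, 12, 13, 14, 15] s s' ∧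
      t + 30 * ∑ r, σ r ≤ 30 * ∑ r, σ' r + 100 * h + 20 := by
  have hh := H.pos
  simp only [retireRing, runs_seq, runs_assign, Expr.eval, h10]
  have := runs_loop (b := .lt (.lit 0) (var 15)) (p :=
        (.seq retire
          (.seq (set 12 (.cell 8 (var 12)))
            (.ite (.eq (var 12) (var 10)) (set 15 (.lit 0)) .skip))))
    (fun (g : ℕ × (Fin n → ℕ)) s' => I.Records s' g.2 ∧
      I.Lists s' (U.filter fun r => ∀ j < g.1, ρ j ≠ r) ∧
      SameExcept [3, 4, 5, 6, 12, 13, 14, 15] s s' ∧ g.1 ≤ h ∧ s' 12 0 = ρ g.1 ∧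
      (s' 15 0 = if g.1 = h then 0 else 1) ∧ I.MacroSteps g.2 (toTargets I ρ g.1 (h - g.1)) σ')
    (fun g => 30 * (∑ r, σ' r - ∑ r, g.2 r) + 100 * (h - g.1)) ?_ (0, σ)
    (s := (s.write 12 0 (ρ 0)).write 15 0 1)
    ⟨hs.congr (by simp) (by simp) (by simp), by simpa using hL.congr (by simp),
      fun b hb => by simp at hb; simp [hb], Nat.zero_le _, by simp, by simp [hh.ne], hm⟩
  · refine this.mono fun s' t ⟨⟨i, τ⟩, ⟨k1, k2, k3, k4, k5, k6, k7⟩, hb, ht⟩ => ?_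
    simp only at k1 k2 k4 k5 k6 k7
    have hih : i = h := by
      by_contra hne
      simp [k6, hne] at hb
    subst hih
    rw [Nat.sub_self] at k7
    obtain rfl : σ' = τ := k7
    have := hm.sum_le
    refine ⟨k1, k2, k3, ?_⟩
    simp at ht ⊢
    omega
  · rintro ⟨i, τ⟩ s' ⟨k1, k2, k3, k4, k5, k6, k7⟩ hb
    simp only at k1 k2 k4 k5 k6 k7
    have hih : i < h := by
      refine lt_of_le_of_ne k4 fun e => ?_
      simp [k6, e] at hb
    rw [if_neg hih.ne] at k6
    rw [show h - i = (h - (i + 1)) + 1 by omega] at k7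
    obtain ⟨hc, hrest⟩ := k7
    rw [runs_seq]
    refine (runs_retire (hI.congr k3) k1 k5 hc).mono fun s'' t ⟨j1, j2, j3, j4⟩ => ?_
    have e12' : s'' 12 0 = ρ i := by rw [j2 12 (by simp), k5]
    have e15' : s'' 15 0 = 1 := by rw [j2 15 (by simp), k6]
    have e10' : s'' 10 0 = ρ 0 := by rw [j2 10 (by simp), k3 10 (by simp), h10]
    have e8' : s'' 8 (ρ i) = ρ (i + 1) := by rw [j2 8 (by simp), k3 8 (by simp), h8]
    have hsame : SameExcept [3, 4, 5, 6, 12, 13, 14, 15] s s'' := k3.trans j2 (by simp) (by simp)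
    have hr := H.succ_eq_zero_iff hih
    have hU : (U.filter fun r => ∀ j < i, ρ j ≠ r).erase (ρ i) =
        U.filter fun r => ∀ j < i + 1, ρ j ≠ r := by
      ext r
      simp only [Finset.mem_erase, Finset.mem_filter, Nat.lt_succ_iff_lt_or_eq, or_imp,
        forall_and, forall_eq, ne_comm (a := r)]
      tauto
    have hL' := k2.erase j3
    rw [hU] at hL'
    have hsum : ∑ r, Function.update τ (ρ i) (I.len (ρ i)) r =
      ∑ r, τ r + (I.len (ρ i) - τ (ρ i)) := sum_update hc.1
    have hle : ∑ r, Function.update τ (ρ i) (I.len (ρ i)) r ≤ ∑ r, σ' r := hrest.sum_le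
    rw [runs_seq, runs_assign, runs_ite]
    simp only [runs_assign, runs_skip]
    refine ⟨fun hb' => ⟨(i + 1, Function.update τ (ρ i) (I.len (ρ i))), ⟨j1.congr (by simp)
      (by simp) (by simp), hL'.congr (by simp), fun b hb => ?_, hih, by simp [e12', e8'], ?_,
      hrest⟩, ?_⟩, fun hb' => ⟨(i + 1, Function.update τ (ρ i) (I.len (ρ i))), ⟨j1.congr (by simp)
      (by simp) (by simp), hL'.congr (by simp), fun b hb => ?_, hih, by simp [e12', e8'], ?_,
      hrest⟩, ?_⟩⟩
    · have := hsame b hb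
      simp at hb
      simp [hb, this]
    · simp [e12', e8', e10', Fin.val_inj, hr] at hb'
      simp [hb']
    · simp only [Expr.cost, Test.cost]
      generalize ∑ r, Function.update τ (ρ i) (I.len (ρ i)) r = Z at *
      omega
    · have := hsame b hb
      simp at hb
      simp [hb, this]
    · simp [e12', e8', e10', Fin.val_inj, hr] at hb'
      simp [hb', e15']
    · simp only [Expr.cost, Test.cost]
      generalize ∑ r, Function.update τ (ρ i) (I.len (ρ i)) r = Z at *
      omega

end MRMPGP

/-! ### The whole program -/

namespace RAM

/-- Dissolves the ring of the robot `10`, if possible. -/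
def treatRing : Program :=
  .seq search
    (.ite (.eq (var 18) (.lit 0))
      (.seq (set 16 (.lit 1)) (set 10 (.cell 0 (.lit 0))))
      (.seq rotate retireRing))

/-- Dissolves the rings one after the other, until one cannot be dissolved. -/
def treatRings : Program :=
  .loop (.lt (var 10) (.cell 0 (.lit 0)))
    (.seq (.ite (.eq (.cell 5 (.cell 2 (.cell 1 (var 10)))) (.lit 0)) .skip treatRing)
      (set 10 (.succ (var 10))))

/-- Outputs a motion plan or reports that none exists. -/
def planner : Program :=
  .seq prepare
    (.seq (set 10 (.lit 0))
      (.seq clear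
        (.seq (set 10 (.lit 0))
          (.seq treatRings
            (.ite (.eq (var 16) (.lit 0)) (.assign 3 (.lit 0) (.lit 1)) .skip)))))

end RAM

namespace MRMPGP

open RAM

variable {m n : ℕ} {I : MRMPGP (Fin m) (Fin n)} {s : Memory}

/-- The memory represents a jam of the robots in `U`, none of which comes before `i`. The marks left by
rings treated before are at most `i`, hence differ from the mark `i + 1` of the next ring. -/
structure Jammed (I : MRMPGP (Fin m) (Fin n)) (s : Memory) (U : Finset (Fin n))
    (nx : Fin n → Fin n) (f : Fin n → ℕ) (i : ℕ) : Prop where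
  input : I.HasInput s
  lists : I.Lists s U
  records : I.Records s (I.waiting U)
  jam : I.Jam U nx f
  scan : ∀ r ∈ U, s 7 r = I.offset r + f r
  nxt : ∀ r ∈ U, s 8 r = nx r
  prv : ∀ r ∈ U, s 9 (nx r) = r + 1
  le : ∀ r ∈ U, i ≤ r.val
  mark : ∀ v, s 32 v ≤ i
  fail : s 16 0 = 0

/-- The program has reported rightly that there is no motion plan. -/
def Failed (I : MRMPGP (Fin m) (Fin n)) (s : Memory) : Prop :=
  s 0 0 = n ∧ s 3 0 = 0 ∧ s 16 0 = 1 ∧ ¬ I.Solvable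

theorem sum_removeOrbit {U : Finset (Fin n)} {nx : Fin n → Fin n} {f : Fin n → ℕ}
    (J : I.Jam U nx f) (hM : I.AtMostTwo) {r₀ : Fin n} (h₀ : r₀ ∈ U) (w : Fin n → ℕ) :
    ∑ r ∈ removeOrbit U nx r₀, w r +
      ∑ i ∈ Finset.range (Function.minimalPeriod nx r₀), w (orbit nx r₀ i) = ∑ r ∈ U, w r := by
  have H := J.isRing hM h₀
  rw [← Finset.sum_image (g := orbit nx r₀) fun a ha b hb e =>
    H.inj a b (by simpa using ha) (by simpa using hb) e, ← Finset.sum_union]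
  · congr 1
    ext r
    simp only [Finset.mem_union, mem_removeOrbit, Finset.mem_image, Finset.mem_range]
    constructor
    · rintro (⟨h, -⟩ | ⟨i, -, rfl⟩)
      · exact h
      · exact J.orbit_mem h₀ i
    · intro hr
      by_cases h : ∃ i, orbit nx r₀ i = r
      · obtain ⟨i, rfl⟩ := h
        exact Or.inr (H.exists_lt i)
      · push Not at h
        exact Or.inl ⟨hr, h⟩
  · rw [Finset.disjoint_left]
    intro r hr hr'
    obtain ⟨i, -, rfl⟩ := Finset.mem_image.1 hr'
    exact (mem_removeOrbit.1 hr).2 i rfl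

/-- A bound for the time that remains to be spent on dissolving rings: the robots in `U` have to be
moved to their targets, and the cycle paths have to be searched. -/
def jamPotential (I : MRMPGP (Fin m) (Fin n)) (U : Finset (Fin n)) : ℕ :=
  30 * (∑ r, I.len r - ∑ r, I.waiting U r) + ∑ r ∈ U, (100 * I.len r + 1000)

theorem sum_waiting_le (U : Finset (Fin n)) : ∑ r, I.waiting U r ≤ ∑ r, I.len r :=
  Finset.sum_le_sum fun r _ => by rw [waiting]; split_ifs <;> omega

theorem runs_treatRing (hM : I.AtMostTwo) (hN : I.NonBlockingTargets) {U : Finset (Fin n)}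
    {nx : Fin n → Fin n} {f : Fin n → ℕ} {r₀ : Fin n} (h : I.Jammed s U nx f r₀) (h₀ : r₀ ∈ U)
    (h10 : s 10 0 = r₀) :
    Runs treatRing s fun s' t => ∃ U', t + I.jamPotential U' ≤ I.jamPotential U ∧
      (s' 10 0 = r₀ ∧ I.Jammed s' U' nx f (r₀ + 1) ∨ s' 10 0 = n ∧ I.Failed s') := by
  have J := h.jam
  have H := J.isRing hM h₀
  have hh := H.pos
  have hmem := J.orbit_mem h₀
  set ρ := orbit nx r₀ with hρ
  set k := Function.minimalPeriod nx r₀ with hk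
  have h0 : ρ 0 = r₀ := rfl
  have h8 : ∀ i, s 8 (ρ i) = ρ (i + 1) := fun i => by rw [h.nxt _ (hmem i), hρ, orbit_succ]
  have h9 : ∀ i, s 9 (ρ (i + 1)) = ρ i + 1 := fun i => by
    rw [hρ, orbit_succ, ← hρ]; exact h.prv _ (hmem i)
  have h7 : ∀ i, s 7 (ρ i) = I.offset (ρ i) + f (ρ i) := fun i => h.scan _ (hmem i)
  have hsum := sum_removeOrbit J hM h₀ fun r => 100 * I.len r + 1000
  rw [← hρ, ← hk] at hsum
  have hlen : ∑ i ∈ Finset.range k, (100 * f (ρ i) + 100) + 900 * k ≤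
      ∑ i ∈ Finset.range k, (100 * I.len (ρ i) + 1000) := by
    have e : 900 * k = ∑ i ∈ Finset.range k, 900 := by simp [Nat.mul_comm]
    rw [e, ← Finset.sum_add_distrib]
    exact Finset.sum_le_sum fun i _ => by have := H.flt i; omega
  rw [treatRing, runs_seq]
  refine (runs_search h.input H hM h7 h8 h10 h.mark).mono fun s₁ t₁ ⟨a1, a2, a3, a4⟩ => ?_
  have hI₁ := h.input.congr a1
  rw [runs_ite]
  rcases a4 with ⟨a4, hB⟩ | ⟨a4, p, y, q, g, g1, g2, g3, g4, g5, g6⟩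
  · refine ⟨fun _ => ?_, fun hn => absurd a4 (by simpa using hn)⟩
    simp only [runs_seq, runs_assign]
    refine ⟨∅, ?_, Or.inr ⟨by simp [hI₁.count], by simp [hI₁.count], ?_, by simp,
      fun hs => ?_⟩⟩
    · have hw : I.waiting ∅ = I.len := by funext r; simp [waiting]
      simp only [jamPotential, hw, Nat.sub_self, Finset.sum_empty, Expr.cost, Test.cost]
      omega
    · simp [a1 3, h.records.flag]
    · obtain ⟨plan, hp⟩ := steps_waiting_of_solvable hN U hs
      exact J.no_plan hM h₀ hB plan hp
  · refine ⟨fun hn => by simp [a4] at hn, fun _ => ?_⟩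
    have hm := J.macroSteps hM hN h₀ g
    have hle := hm.sum_le
    have hle' := sum_waiting_le (I := I) (removeOrbit U nx r₀)
    obtain ⟨τ, hm1, hm2⟩ := MacroSteps.append_iff.1 hm
    rw [runs_seq]
    refine (runs_rotate H (fun i => by rw [a1 7 (by simp), h7]) (fun i => by rw [a1 8 (by simp), h8])
      (fun i => by rw [a1 9 (by simp), h9]) (h.records.of_same a1) g g1 g2 g3 g4 g5 g6 hm1).mono
      fun s₂ t₂ ⟨b1, b2, b3⟩ => ?_
    have c2 := a1.trans (Z := [3, 4, 6, 12, 13, 14, 15, 17, 18, 19, 20, 21, 22, 23, 24, 25, 26, 27,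
      30, 31, 32, 33, 34]) b2 (by simp) (by simp)
    refine (runs_retireRing (hI₁.congr b2) H (fun i => by rw [c2 8 (by simp), h8])
      (by rw [c2 10 (by simp), h10, h0]) b1 (h.lists.congr (c2 5 (by simp))) hm2).mono
      fun s₃ t₃ ⟨d1, d2, d3, d4⟩ => ?_
    have e2 := c2.trans (Z := [3, 4, 5, 6, 12, 13, 14, 15, 17, 18, 19, 20, 21, 22, 23, 24, 25, 26,
      27, 30, 31, 32, 33, 34]) d3 (by simp) (by simp)
    have hU : (U.filter fun r => ∀ j < k, ρ j ≠ r) = removeOrbit U nx r₀ := by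
      ext r
      rw [mem_removeOrbit, Finset.mem_filter]
      refine and_congr_right fun _ => ⟨fun hr i e => ?_, fun hr i _ => hr i⟩
      obtain ⟨j, hj, e'⟩ := H.exists_lt i
      exact hr j hj (e'.trans e)
    rw [hU] at d2
    refine ⟨removeOrbit U nx r₀, ?_, Or.inl ⟨by rw [e2 10 (by simp), h10], h.input.congr e2, d2, d1,
      J.remove hM h₀, fun r hr => ?_, fun r hr => ?_, fun r hr => ?_, fun r hr => ?_, fun v => ?_, ?_⟩⟩
    · simp only [jamPotential, Expr.cost, Test.cost]
      omega
    · rw [e2 7 (by simp), h.scan r (mem_removeOrbit.1 hr).1]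
    · rw [e2 8 (by simp), h.nxt r (mem_removeOrbit.1 hr).1]
    · rw [e2 9 (by simp), h.prv r (mem_removeOrbit.1 hr).1]
    · refine Nat.succ_le_of_lt (lt_of_le_of_ne (h.le r (mem_removeOrbit.1 hr).1) fun e => ?_)
      exact (mem_removeOrbit.1 hr).2 0 (Fin.ext e)
    · rw [d3 32 (by simp), b2 32 (by simp)]
      exact a2 v
    · rw [e2 16 (by simp), h.fail]

theorem runs_treatRings (hM : I.AtMostTwo) (hN : I.NonBlockingTargets) {U : Finset (Fin n)}
    {nx : Fin n → Fin n} {f : Fin n → ℕ} (h : I.Jammed s U nx f 0) (h10 : s 10 0 = 0) :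
    Runs treatRings s fun s' t => t ≤ I.jamPotential U + 100 * n + 10 ∧
      (s' 16 0 = 0 ∧ I.Records s' I.len ∨ I.Failed s') := by
  rw [treatRings]
  have := runs_loop (b := .lt (var 10) (.cell 0 (.lit 0))) (p :=
    (.seq (.ite (.eq (.cell 5 (.cell 2 (.cell 1 (var 10)))) (.lit 0)) .skip treatRing)
      (set 10 (.succ (var 10)))))
    (fun (g : ℕ × Finset (Fin n)) s => (s 10 0 = g.1 ∧ g.1 ≤ n ∧ I.Jammed s g.2 nx f g.1) ∨
      (n < s 10 0 ∧ I.Failed s))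
    (fun g => 100 * (n - g.1) + I.jamPotential g.2) ?_ (0, U) (s := s)
    (Or.inl ⟨h10, Nat.zero_le _, h⟩)
  · refine this.mono fun s' t ⟨⟨i, U'⟩, hg, hb, ht⟩ => ⟨?_, ?_⟩
    · simp at ht
      omega
    · rcases hg with ⟨k1, k2, k3⟩ | ⟨-, k1⟩
      · simp only at k1 k2 k3
        simp [k1, k3.input.count] at hb
        have hU : U' = ∅ := Finset.eq_empty_of_forall_notMem fun r hr => by
          have := k3.le r hr
          omega
        have hw : I.waiting U' = I.len := by funext r; simp [waiting, hU]
        exact Or.inl ⟨k3.fail, hw ▸ k3.records⟩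
      · exact Or.inr k1
  · rintro ⟨i, U'⟩ s' hg hb
    rcases hg with ⟨k1, k2, k3⟩ | ⟨k1, k2⟩
    swap
    · simp [k2.1] at hb
      omega
    simp only at k1 k2 k3
    simp [k1, k3.input.count] at hb
    have e1 := k3.input.off ⟨i, hb⟩
    have e2 := k3.input.src ⟨i, hb⟩
    have e5 := k3.lists.mem_iff ⟨i, hb⟩
    simp only at e1 e2
    rw [runs_seq, runs_ite]
    constructor
    · intro hc
      simp [k1, e1, e2] at hc
      rw [runs_skip, runs_assign]
      have hi : ⟨i, hb⟩ ∉ U' := fun hm => e5.2 hm hc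
      refine ⟨(i + 1, U'), Or.inl ⟨by simp [k1], hb, ⟨?_, k3.lists.congr (by simp),
        k3.records.congr (by simp) (by simp) (by simp), k3.jam, by simpa using k3.scan,
        by simpa using k3.nxt, by simpa using k3.prv, fun r hr => ?_, fun v => ?_,
        by simpa using k3.fail⟩⟩, ?_⟩
      · exact ⟨by simp [k3.input.zero], by simp [k3.input.one], by simp [k3.input.two]⟩
      · refine Nat.succ_le_of_lt (lt_of_le_of_ne (k3.le r hr) fun e => ?_)
        exact hi (by rwa [show (⟨i, hb⟩ : Fin n) = r from Fin.ext e])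
      · have := k3.mark v
        simp
        omega
      · simp
        omega
    · intro hc
      simp [k1, e1, e2] at hc
      refine (runs_treatRing hM hN (r₀ := ⟨i, hb⟩) k3 (e5.1 hc) k1).mono
        fun s'' t ⟨U'', ht, hs⟩ => ?_
      rw [runs_assign]
      rcases hs with ⟨j1, j2⟩ | ⟨j1, j2⟩
      · refine ⟨(i + 1, U''), Or.inl ⟨by simp [j1], hb, ⟨?_, j2.lists.congr (by simp),
          j2.records.congr (by simp) (by simp) (by simp), j2.jam, by simpa using j2.scan,
          by simpa using j2.nxt, by simpa using j2.prv, j2.le, by simpa using j2.mark,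
          by simpa using j2.fail⟩⟩, ?_⟩
        · exact ⟨by simp [j2.input.zero], by simp [j2.input.one], by simp [j2.input.two]⟩
        · simp
          omega
      · obtain ⟨l1, l2, l3, l4⟩ := j2
        refine ⟨(i + 1, U''), Or.inr ⟨by simp [j1], by simpa using l1, by simpa using l2,
          by simpa using l3, l4⟩, ?_⟩
        simp
        omega

/-- The program is correct and runs in linear time. -/
theorem runs_planner (hN : I.NonBlockingTargets) (hM : I.AtMostTwo) :
    Runs planner I.input fun s t => t ≤ 3000 * (I.totalLength + 1) ∧
      ((∃ plan, ReportsPlan s plan ∧ I.IsMotionPlan plan) ∨ (ReportsNone s ∧ ¬ I.Solvable)) := by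
  rw [planner, runs_seq]
  refine (runs_prepare I).mono fun s₁ t₁ ⟨a1, a2, a3, a4, a5⟩ => ?_
  rw [runs_seq, runs_assign, runs_seq]
  refine (runs_clear hN hM (clearing_of_prepared a1 a2 a3 a4) (by simp)).mono
    fun s₂ t₂ ⟨U, f, b1, b2⟩ => ?_
  obtain ⟨nx, J, hnx⟩ := b1.exists_jam hN
  have hI := I.hasInput_input.congr b1.same
  rw [runs_seq, runs_assign, runs_seq]
  have hJ : I.Jammed (s₂.write 10 0 0) U nx f 0 := by
    refine ⟨⟨by simp [hI.zero], by simp [hI.one], by simp [hI.two]⟩, b1.lists.congr (by simp),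
      b1.records.congr (by simp) (by simp) (by simp), J, fun r _ => by simpa using b1.scan r,
      fun r hr => by simpa using (hnx r hr).1, fun r hr => by simpa using (hnx r hr).2,
      fun _ _ => Nat.zero_le _, fun v => ?_, ?_⟩
    · simp [b1.same 32, input]
    · simp [b1.same 16, input]
  refine (runs_treatRings hM hN hJ (by simp)).mono fun s₃ t₃ ⟨c1, c2⟩ => ?_
  have hT : I.totalLength = ∑ r, I.len r + n := by
    rw [totalLength_eq, Finset.sum_add_distrib]; simp
  have hp1 : I.clearingPotential Finset.univ (fun _ => 1) ≤ 330 * ∑ r, I.len r + 300 * n := by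
    simp only [clearingPotential, Nat.add_sub_cancel, Finset.sum_add_distrib, ← Finset.mul_sum]
    simp
    omega
  have hp2 : I.jamPotential U ≤ 130 * ∑ r, I.len r + 1000 * n := by
    have := Finset.sum_le_sum_of_subset (f := fun r => 100 * I.len r + 1000) (Finset.subset_univ U)
    rw [Finset.sum_add_distrib (s := Finset.univ), ← Finset.mul_sum] at this
    simp at this
    rw [jamPotential]
    omega
  rw [runs_ite, runs_assign, runs_skip]
  refine ⟨fun hb => ⟨?_, Or.inl ?_⟩, fun hb => ⟨?_, Or.inr ?_⟩⟩
  · simp only [Expr.cost, Test.cost]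
    omega
  · rcases c2 with ⟨-, c2⟩ | c2
    · obtain ⟨plan, h1, h2, h3⟩ := c2.plan
      refine ⟨plan, ⟨by simp, by simpa using h2, fun j => ?_⟩, (I.isPlanFrom_iff_steps _ _).2 h1⟩
      simpa using h3 j j.2
    · simp [c2.2.2.1] at hb
  · simp only [Expr.cost, Test.cost]
    omega
  · rcases c2 with ⟨c2, -⟩ | c2
    · simp [c2] at hb
    · exact ⟨c2.2.1, c2.2.2.2⟩

end MRMPGP

theorem mainTheorem1 :
    (∀ (V R : Type*) [Fintype V] [Fintype R] [DecidableEq R] (I : MRMPGP V R),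
      I.NonBlockingTargets → I.vertexMultiplicity ≤ 2 →
        (∃ σ, I.ClearedTo σ) ∧
        ∀ σ, I.ClearedTo σ →
          (∀ C : I.BlockingCycle σ, (∀ i, ¬ C.IsScout i) → ∃ G, C.graph.UntanglesTo G) ∧
          (I.Solvable ↔
            ∀ C : I.BlockingCycle σ, (∀ i, ¬ C.IsScout i) →
              ∀ G, C.graph.UntanglesTo G → ¬ G.HasStartCycle) ∧
          (I.Solvable ↔
            ∀ C : I.BlockingCycle σ, (∀ i, ¬ C.IsScout i) →
              ∃ G, C.graph.UntanglesTo G ∧ ¬ G.HasStartCycle)) ∧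
    (∃ (P : RAM.Program) (c : ℕ), ∀ (m n : ℕ) (I : MRMPGP (Fin m) (Fin n)),
      I.NonBlockingTargets → I.vertexMultiplicity ≤ 2 →
        ∃ (s : RAM.Memory) (t : ℕ), RAM.Exec P I.input s t ∧ t ≤ c * (I.totalLength + 1) ∧
          ((∃ plan, MRMPGP.ReportsPlan s plan ∧ I.IsMotionPlan plan) ∨
            (MRMPGP.ReportsNone s ∧ ¬ I.Solvable))) := by
  refine ⟨fun V R _ _ _ I hN hmult => ⟨I.exists_clearedTo,
    fun σ hσ => MRMPGP.solvable_iff_of_clearedTo hN hmult hσ⟩, ?_⟩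
  refine ⟨RAM.planner, 3000, fun m n I hN hmult => ?_⟩
  obtain ⟨s, t, h, ht, hQ⟩ := MRMPGP.runs_planner hN (MRMPGP.atMostTwo_of_vertexMultiplicity_le hmult)
  exact ⟨s, t, h, ht, hQ⟩
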